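/- Let $k$ be a field of characteristic zero and let $q,r\ge 2$ be coprime integers. Let $m\ge 0$ be an integer, $\underline{n}=(n_0,\ldots,n_m)$ a tuple of integers $n_i>1$, and $p\in k[u]$ a polynomial with $p(0)\ne 0$. Put $$R_m(\underline{n},p)=k[x_0,\ldots,x_m,y,z,t]\Big/\Big(\big(\textstyle\prod_{i=0}^m x_i^{n_i}\big)\,y+z^q+t^r+x_0\,p\big(\textstyle\prod_{i=0}^m x_i\big)\Big),\qquad X_m(\underline{n},p)=\mathrm{Spec}\,R_m(\underline{n},p).$$ For a $k$-algebra $A$, a $k$-derivation $\partial$ of $A$ is locally nilpotent if for every $a\in A$ there is an $N\geq 0$ with $\partial^N(a)=0$. The Makar-Limanov invariant $\mathrm{ML}(A)$ is the intersection of the kernels of all locally nilpotent $k$-derivations of $A$, and the Derksen invariant $\mathrm{DK}(A)$ is the $k$-subalgebra of $A$ generated by the kernels of all nonzero locally nilpotent $k$-derivations of $A$. Then, as $k$-subalgebras of $R_m(\underline{n},p)$ generated by the classes of the indicated variables, $$\mathrm{ML}(R_m(\underline{n},p))=k[x_0,\ldots,x_m]\quad\text{and}\quad \mathrm{DK}(R_m(\underline{n},p))=k[x_0,\ldots,x_m,z,t].$$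 Moreover, $R_m(\underline{n},p)$ is not isomorphic as a $k$-algebra to a polynomial ring over $k$ (in any set of variables), and the $k$-scheme $X_m(\underline{n},p)$ is not isomorphic over $k$ to the affine space $\mathbb{A}^{m+3}_k$. -/

import Mathlib

universe u

open CategoryTheory AlgebraicGeometry

/-- A `k`-derivation `D` of a `k`-algebra `A` is locally nilpotent if every element of `A` is
annihilated by some iterate of `D`. -/
def IsLocallyNilpotentDerivation {k A : Type*} [CommRing k] [CommRing A] [Algebra k A]
    (D : Derivation k A A) : Prop :=
  ∀ a : A, ∃ N : ℕ, D^[N] a = 0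

/-- The kernel (algebra of constants) of a `k`-derivation, as a `k`-subalgebra. -/
def derivationKernel {k A : Type*} [CommRing k] [CommRing A] [Algebra k A]
    (D : Derivation k A A) : Subalgebra k A where
  carrier := {a | D a = 0}
  mul_mem' {a b} ha hb := by
    have ha' : D a = 0 := ha
    have hb' : D b = 0 := hb
    change D (a * b) = 0
    simp [ha', hb']
  add_mem' {a b} ha hb := by
    have ha' : D a = 0 := ha
    have hb' : D b = 0 := hb
    change D (a + b) = 0
    simp [ha', hb']
  algebraMap_mem' c := D.map_algebraMap c

/-- The Makar-Limanov invariant: the intersection of the kernels of all locally nilpotent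
`k`-derivations of `A`. -/
def makarLimanovInvariant (k A : Type*) [CommRing k] [CommRing A] [Algebra k A] :
    Subalgebra k A :=
  ⨅ (D : Derivation k A A) (_ : IsLocallyNilpotentDerivation D), derivationKernel D

/-- The Derksen invariant: the `k`-subalgebra generated by the kernels of all nonzero locally
nilpotent `k`-derivations of `A`. -/
def derksenInvariant (k A : Type*) [CommRing k] [CommRing A] [Algebra k A] :
    Subalgebra k A :=
  ⨆ (D : Derivation k A A) (_ : IsLocallyNilpotentDerivation D ∧ D ≠ 0), derivationKernel D

namespace KorasRussell

/-- The names of the variables `x_0, …, x_m, y, z, t`. -/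
inductive Var (m : ℕ) : Type
  | x (i : Fin (m + 1)) : Var m
  | y : Var m
  | z : Var m
  | t : Var m

/-- The polynomial `(∏ x_i ^ n_i) * y + z ^ q + t ^ r + x_0 * p (∏ x_i)`. -/
noncomputable def equation {k : Type*} [Field k] (q r m : ℕ) (n : Fin (m + 1) → ℕ)
    (p : Polynomial k) : MvPolynomial (Var m) k :=
  (∏ i, MvPolynomial.X (Var.x i) ^ n i) * MvPolynomial.X Var.y
    + MvPolynomial.X Var.z ^ q + MvPolynomial.X Var.t ^ r
    + MvPolynomial.X (Var.x 0) *
      Polynomial.aeval (∏ i, (MvPolynomial.X (Var.x i) : MvPolynomial (Var m) k)) p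

/-- The `k`-algebra `R_m(n, p)` (for the exponents `q`, `r`). -/
abbrev R {k : Type*} [Field k] (q r m : ℕ) (n : Fin (m + 1) → ℕ) (p : Polynomial k) : Type _ :=
  MvPolynomial (Var m) k ⧸ Ideal.span {equation q r m n p}

/-- The class in `R_m(n, p)` of a variable. -/
noncomputable def coord {k : Type*} [Field k] (q r m : ℕ) (n : Fin (m + 1) → ℕ)
    (p : Polynomial k) (v : Var m) : R q r m n p :=
  Ideal.Quotient.mk (Ideal.span {equation q r m n p}) (MvPolynomial.X v)

/-- The `k`-scheme `X_m(n, p) = Spec R_m(n, p)`, as an object over `Spec k`. -/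
noncomputable def X {k : Type*} [Field k] (q r m : ℕ) (n : Fin (m + 1) → ℕ)
    (p : Polynomial k) : Over (Spec (CommRingCat.of k)) :=
  Over.mk (Spec.map (CommRingCat.ofHom (algebraMap k (R q r m n p))))

/-- Affine `d`-space over the field `k`, as an object over `Spec k`. -/
noncomputable def affineSpace (k : Type u) [Field k] (d : ℕ) : Over (Spec (CommRingCat.of k)) :=
  Over.mk (AffineSpace (ULift.{u} (Fin d)) (Spec (CommRingCat.of k)) ↘ Spec (CommRingCat.of k))

end KorasRussell

/-!
The equation expresses `y` as a Laurent polynomial in `x_0, …, x_m` with coefficients in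
`k[x_0, …, x_m, z, t]`, so the coordinate ring embeds into the Laurent polynomial ring
`k[x_i^±1, z^±1, t^±1]`, and each of its derivations extends there. For a weight with values in an
ordered group, the leading part of a locally nilpotent derivation is a homogeneous derivation that
is locally nilpotent on the ring of leading components and annihilates the leading components of
constants.

*Constants do not involve `y`* (`mem_xztSubalgebra_of_apply_eq_zero`). For lexicographic weights,
the ring of leading components is generated by the `x_i`, `z`, `t` and `ŷ = -(z^q + t^r) / x^n`,
where `x^n = ∏ x_i^{n_i}`, and its homogeneous elements are products of powers of the `x_i` and of
`ŷ` with a weighted form in `z` and `t` (`IsAdmissible.eq_mul_of_component_eq`). If a constant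
involves `y`, then its leading component is divisible by `ŷ` for one of these weights; as constants
are factorially closed, `ŷ` is annihilated by the leading derivation. This is impossible
(`apply_yTop_ne_zero`). The reason is the inequality of Mason and Stothers: if `c * a^i + d * b^j`
is a nonzero constant, with nonzero constants `c`, `d` and `i, j ≥ 2`, then `a` and `b` are
constants, as one sees from the polynomials `exp(X D) a` and `exp(X D) b`
(`apply_eq_zero_of_pow_add_pow`). Applied to the factors `z^q - ρ t^r` of weighted forms, it shows
that the constants are generated by variables (`constants_le_adjoin`). Since their transcendence
degree is `m + 2`, few of the variables are not constants, and the same inequality applied to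
`x^n * ŷ + z^q + t^r = 0` gives a contradiction.

*Every `x_i` is a constant* (`apply_coord_x_eq_zero`). Suppose that `x_i` is not a constant. All
constants are polynomials in the `x_j`, `z`, `t`, and no nonzero constant is divisible by `x_i`, so
that reduction modulo `x_i` is injective on them. If `g` is one of `z`, `t`, `x_j` with `j ≠ i`, and
not a constant, then `x_i` is algebraic over the constants with `g` adjoined, since the coordinate
ring has transcendence degree one over the constants. The constant term of an equation for `x_i`,
reduced modulo `x_i`, is an equation for `g` over the reduced constants. These are annihilated by
the leading part `D'` of the derivation with respect to the order of vanishing along `x_i`, hence so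
is `g`. The equation of the coordinate ring then gives `D' x_i = 0` and `D' = 0`, a contradiction.

The derivations `x^n ∂_z - q z^{q-1} ∂_y` and `x^n ∂_t - r t^{r-1} ∂_y` (`shear`) show that there
are no other common constants than the polynomials in the `x_i`, and that `z` and `t` belong to the
Derksen invariant. Finally, the only common constants of the partial derivatives of a polynomial
ring are the scalars, while `x_0` is not a scalar, and an isomorphism of affine schemes over `k`
comes from an isomorphism of `k`-algebras.
-/

namespace KorasRussell

open Polynomial

/-! ### Locally nilpotent derivations in characteristic zero -/

section Derivations

variable {k B : Type*} [Field k] [CommRing B] [Algebra k B]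

theorem iterate_mul_eq_zero (D : Derivation k B B) :
    ∀ (i j : ℕ) (a b : B), D^[i] a = 0 → D^[j] b = 0 → D^[i + j] (a * b) = 0
  | 0, j, a, b, ha, _ => by
    have : a = 0 := ha
    rw [this, zero_mul, iterate_map_zero]
  | i + 1, 0, a, b, _, hb => by
    have : b = 0 := hb
    rw [this, mul_zero, iterate_map_zero]
  | i + 1, j + 1, a, b, ha, hb => by
    have h1 : D^[(i + 1) + j] (a * D b) = 0 := iterate_mul_eq_zero D (i + 1) j a (D b) ha hb
    have h2 : D^[i + (j + 1)] (D a * b) = 0 := iterate_mul_eq_zero D i (j + 1) (D a) b ha hb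
    have h3 : (i + 1) + (j + 1) = ((i + 1) + j) + 1 := by omega
    have h4 : i + (j + 1) = (i + 1) + j := by omega
    rw [h4] at h2
    rw [h3, Function.iterate_succ_apply, D.leibniz, smul_eq_mul, smul_eq_mul, mul_comm b (D a),
      iterate_map_add, h1, h2, add_zero]

theorem iterate_eq_zero_of_le (D : Derivation k B B) {i j : ℕ} (hij : i ≤ j) {a : B}
    (ha : D^[i] a = 0) : D^[j] a = 0 := by
  obtain ⟨l, rfl⟩ := Nat.exists_eq_add_of_le' hij
  rw [Function.iterate_add_apply, ha, iterate_map_zero]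

/-- The subalgebra of the elements annihilated by some iterate of `D`. -/
def nilpotentPart (D : Derivation k B B) : Subalgebra k B where
  carrier := {a | ∃ N : ℕ, D^[N] a = 0}
  mul_mem' := by
    rintro a b ⟨i, hi⟩ ⟨j, hj⟩
    exact ⟨i + j, iterate_mul_eq_zero D i j a b hi hj⟩
  add_mem' := by
    rintro a b ⟨i, hi⟩ ⟨j, hj⟩
    refine ⟨i + j, ?_⟩
    rw [iterate_map_add, iterate_eq_zero_of_le D (Nat.le_add_right i j) hi,
      iterate_eq_zero_of_le D (Nat.le_add_left j i) hj, add_zero]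
  algebraMap_mem' c := ⟨1, D.map_algebraMap c⟩

theorem mem_nilpotentPart_of_apply {D : Derivation k B B} {a : B}
    (h : D a ∈ nilpotentPart D) : a ∈ nilpotentPart D := by
  obtain ⟨N, hN⟩ := h
  exact ⟨N + 1, hN⟩

theorem mem_nilpotentPart_of_apply_eq_zero {D : Derivation k B B} {a : B}
    (h : D a = 0) : a ∈ nilpotentPart D := ⟨1, h⟩

/-- The `n`-th divided power of `D`, the coefficient of `X ^ n` in `exp (X D)`. -/
noncomputable def dividedIterate (D : Derivation k B B) (n : ℕ) (a : B) : B :=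
  ((n.factorial : k)⁻¹) • D^[n] a

theorem dividedIterate_zero (D : Derivation k B B) (a : B) : dividedIterate D 0 a = a := by
  simp [dividedIterate]

theorem dividedIterate_one (D : Derivation k B B) (a : B) : dividedIterate D 1 a = D a := by
  simp [dividedIterate]

theorem succ_smul_dividedIterate [CharZero k] (D : Derivation k B B) (n : ℕ) (a : B) :
    ((n + 1 : ℕ) : k) • dividedIterate D (n + 1) a = D (dividedIterate D n a) := by
  rw [dividedIterate, dividedIterate, D.map_smul, smul_smul, Function.iterate_succ_apply',
    Nat.factorial_succ]
  congr 1
  have h1 : ((n + 1 : ℕ) : k) ≠ 0 := Nat.cast_ne_zero.mpr n.succ_ne_zero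
  have h2 : (n.factorial : k) ≠ 0 := Nat.cast_ne_zero.mpr n.factorial_ne_zero
  push_cast at h1 ⊢
  field_simp

theorem dividedIterate_mul [CharZero k] (D : Derivation k B B) (n : ℕ) (a b : B) :
    dividedIterate D n (a * b) =
      ∑ ij ∈ Finset.HasAntidiagonal.antidiagonal n,
        dividedIterate D ij.1 a * dividedIterate D ij.2 b := by
  induction n with
  | zero => simp [dividedIterate_zero]
  | succ n ih =>
    have h1 : ((n + 1 : ℕ) : k) ≠ 0 := Nat.cast_ne_zero.mpr n.succ_ne_zero
    refine (smul_right_injective B h1) ?_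
    change ((n + 1 : ℕ) : k) • dividedIterate D (n + 1) (a * b) = ((n + 1 : ℕ) : k) • _
    rw [succ_smul_dividedIterate, ih, map_sum, Finset.smul_sum]
    have key : ∀ ij ∈ Finset.HasAntidiagonal.antidiagonal (n + 1),
        ((n + 1 : ℕ) : k) • (dividedIterate D ij.1 a * dividedIterate D ij.2 b) =
          ((ij.1 : k) • dividedIterate D ij.1 a) * dividedIterate D ij.2 b +
          dividedIterate D ij.1 a * ((ij.2 : k) • dividedIterate D ij.2 b) := by
      intro ij hij
      rw [Finset.HasAntidiagonal.mem_antidiagonal] at hij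
      rw [← hij, smul_mul_assoc, mul_smul_comm, ← add_smul, Nat.cast_add]
    rw [Finset.sum_congr rfl key, Finset.sum_add_distrib]
    have hA := Finset.Nat.sum_antidiagonal_succ (n := n) (f := fun ij : ℕ × ℕ =>
      ((ij.1 : k) • dividedIterate D ij.1 a) * dividedIterate D ij.2 b)
    have hB := Finset.Nat.sum_antidiagonal_succ' (n := n) (f := fun ij : ℕ × ℕ =>
      dividedIterate D ij.1 a * ((ij.2 : k) • dividedIterate D ij.2 b))
    simp only at hA hB
    rw [hA, hB]
    simp only [Nat.cast_zero, zero_smul, zero_mul, mul_zero, zero_add,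
      succ_smul_dividedIterate]
    rw [← Finset.sum_add_distrib]
    refine Finset.sum_congr rfl fun ij _ => ?_
    rw [D.leibniz, smul_eq_mul, smul_eq_mul]
    ring

/-- For `a` in the locally nilpotent part of `D`, the polynomial `exp (X D) a`. -/
noncomputable def expPoly (D : Derivation k B B) (a : nilpotentPart D) : B[X] :=
  ∑ n ∈ Finset.range a.2.choose, monomial n (dividedIterate D n a)

theorem coeff_expPoly (D : Derivation k B B) (a : nilpotentPart D) (n : ℕ) :
    (expPoly D a).coeff n = dividedIterate D n a := by
  simp only [expPoly, finsetSum_coeff, coeff_monomial]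
  rw [Finset.sum_ite_eq']
  split_ifs with h
  · rfl
  · rw [Finset.mem_range, not_lt] at h
    rw [dividedIterate, iterate_eq_zero_of_le D h a.2.choose_spec, smul_zero]

/-- The exponential `a ↦ exp (X D) a` as a ring homomorphism. -/
noncomputable def expHom [CharZero k] (D : Derivation k B B) : nilpotentPart D →+* B[X] where
  toFun := expPoly D
  map_one' := by
    ext n
    rw [coeff_expPoly, coeff_one]
    cases n with
    | zero => simp [dividedIterate_zero]
    | succ n =>
      simp [dividedIterate, Function.iterate_succ_apply]
  map_zero' := by
    ext n
    simp [coeff_expPoly, dividedIterate]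
  map_add' a b := by
    ext n
    simp [coeff_expPoly, dividedIterate]
  map_mul' a b := by
    ext n
    simp [coeff_expPoly, coeff_mul, dividedIterate_mul]

/-- An element is a constant of `D` exactly if its exponential is a constant polynomial. -/
theorem natDegree_expHom_eq_zero_iff [CharZero k] (D : Derivation k B B) (a : nilpotentPart D) :
    (expHom D a).natDegree = 0 ↔ D a = 0 := by
  constructor
  · intro h
    have := coeff_expPoly D a 1
    rw [dividedIterate_one] at this
    rw [← this]
    exact coeff_eq_zero_of_natDegree_lt (by change (expHom D a).natDegree < 1; omega)
  · intro h
    rw [← Nat.le_zero]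
    refine natDegree_le_iff_coeff_eq_zero.mpr fun n hn => ?_
    obtain ⟨n, rfl⟩ := Nat.exists_eq_succ_of_ne_zero hn.ne'
    refine (coeff_expPoly D a _).trans ?_
    rw [dividedIterate, Function.iterate_succ_apply, h, iterate_map_zero, smul_zero]

/-- The exponential of `D` with coefficients in a field containing `B`. -/
theorem exists_expHom [CharZero k] (D : Derivation k B B) (K : Type*) [Field K] [Algebra B K]
    (hK : Function.Injective (algebraMap B K)) :
    ∃ φ : nilpotentPart D →+* K[X], (∀ a, (φ a).coeff 0 = algebraMap B K a) ∧
      ∀ a, (φ a).natDegree = 0 ↔ D a = 0 := by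
  refine ⟨(mapRingHom (algebraMap B K)).comp (expHom D), fun a => ?_, fun a => ?_⟩
  · have := coeff_expPoly D a 0
    rw [dividedIterate_zero] at this
    simp only [RingHom.comp_apply, coe_mapRingHom, coeff_map]
    exact congrArg _ this
  · rw [← natDegree_expHom_eq_zero_iff]
    simp only [RingHom.comp_apply, coe_mapRingHom]
    rw [natDegree_map_eq_of_injective hK]

theorem iterate_mul_of_apply_eq_zero (D : Derivation k B B) {f : B} (hf : D f = 0) (a : B)
    (n : ℕ) : D^[n] (f * a) = f * D^[n] a := by
  induction n generalizing a with
  | zero => rfl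
  | succ n ih =>
    rw [Function.iterate_succ_apply, D.leibniz, hf, smul_zero, add_zero, smul_eq_mul, ih,
      Function.iterate_succ_apply]

theorem iterate_pow_slice (D : Derivation k B B) {s : B} (hs : D (D s) = 0) (n : ℕ) :
    D^[n] (s ^ n) = (n.factorial : B) * D s ^ n := by
  induction n with
  | zero => simp
  | succ n ih =>
    have h0 : D (((n + 1 : ℕ) : B) * D s) = 0 := by
      rw [D.leibniz, hs, D.map_natCast]
      simp
    rw [Function.iterate_succ_apply, D.leibniz_pow, Nat.add_sub_cancel, nsmul_eq_mul,
      smul_eq_mul, mul_comm (s ^ n), ← mul_assoc, iterate_mul_of_apply_eq_zero D h0, ih,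
      Nat.factorial_succ]
    push_cast
    ring

/-- A derivation that is nilpotent at a non-constant element has a local slice: the last iterate
of that element that is not a constant. -/
theorem exists_slice (D : Derivation k B B) {A : Set B} (hA : ∀ a ∈ A, D a ∈ A)
    {a : B} (ha : a ∈ A) (hn : a ∈ nilpotentPart D) (h : D a ≠ 0) :
    ∃ s ∈ A, D s ≠ 0 ∧ D (D s) = 0 := by
  obtain ⟨N, hN⟩ := hn
  induction N generalizing a with
  | zero =>
    have : a = 0 := hN
    rw [this, map_zero] at h
    exact absurd rfl h
  | succ N ih =>
    by_cases h2 : D (D a) = 0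
    · exact ⟨a, ha, h, h2⟩
    · exact ih (hA a ha) h2 hN

variable [IsDomain B]

/-- Every element becomes a polynomial in a local slice over the ring of constants, after
multiplication by a nonzero constant. -/
theorem exists_mul_mem_adjoin_slice [CharZero k] (D : Derivation k B B) (A : Subalgebra k B)
    (hA : ∀ a ∈ A, D a ∈ A) {s : B} (hsA : s ∈ A) (hs : D s ≠ 0) (hs2 : D (D s) = 0)
    {a : B} (ha : a ∈ A) (hn : a ∈ nilpotentPart D) :
    ∃ u ∈ A, D u = 0 ∧ u ≠ 0 ∧ u * a ∈ Algebra.adjoin k ({f | f ∈ A ∧ D f = 0} ∪ {s}) := by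
  have hchar : CharZero B := charZero_of_injective_algebraMap (algebraMap k B).injective
  obtain ⟨N, hN⟩ := hn
  have hiter : ∀ (n : ℕ) (a : B), a ∈ A → D^[n] a ∈ A := by
    intro n
    induction n with
    | zero => intro a ha; exact ha
    | succ n ih => intro a ha; exact ih _ (hA a ha)
  induction N generalizing a with
  | zero =>
    have : a = 0 := hN
    subst this
    exact ⟨1, one_mem _, by simp, one_ne_zero, by simp⟩
  | succ n ih =>
    set v : B := (n.factorial : B) * D s ^ n with hv
    have hDv : D v = 0 := by
      rw [hv, D.leibniz, D.leibniz_pow, hs2, D.map_natCast]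
      simp
    have hvA : v ∈ A := mul_mem (natCast_mem A _) (pow_mem (hA s hsA) n)
    have hv0 : v ≠ 0 := mul_ne_zero (Nat.cast_ne_zero.mpr n.factorial_ne_zero) (pow_ne_zero _ hs)
    have hc : D (D^[n] a) = 0 := by
      rw [← Function.iterate_succ_apply' D]
      exact hN
    have hcA : D^[n] a ∈ A := hiter n a ha
    -- The iterate `D ^ n` takes the same value on `v * a` and on `D ^ n a * s ^ n`, so that their
    -- difference is annihilated by a lower iterate than `a`.
    obtain ⟨u, huA, hu, hu0, hmem⟩ := ih (a := v * a - D^[n] a * s ^ n)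
      (sub_mem (mul_mem hvA ha) (mul_mem hcA (pow_mem hsA n))) (by
        rw [iterate_map_sub, iterate_mul_of_apply_eq_zero D hDv,
          iterate_mul_of_apply_eq_zero D hc, iterate_pow_slice D hs2, hv]
        ring)
    refine ⟨u * v, mul_mem huA hvA, ?_, mul_ne_zero hu0 hv0, ?_⟩
    · rw [D.leibniz, hu, hDv]; simp
    · have e : u * v * a = u * (v * a - D^[n] a * s ^ n) + u * (D^[n] a * s ^ n) := by ring
      rw [e]
      refine add_mem hmem (mul_mem (Algebra.subset_adjoin (Or.inl ⟨huA, hu⟩))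
        (mul_mem (Algebra.subset_adjoin (Or.inl ⟨hcA, hc⟩)) (pow_mem ?_ n)))
      exact Algebra.subset_adjoin (Or.inr rfl)

/-- The constants of a derivation are algebraically closed: an equation of minimal degree for `a`
has a nonvanishing derivative at `a`. -/
theorem apply_eq_zero_of_isAlgebraic [CharZero k] (D : Derivation k B B) (S : Subalgebra k B)
    (hS : ∀ a ∈ S, D a = 0) {a : B} (ha : IsAlgebraic S a) : D a = 0 := by
  have hchar : CharZero B := charZero_of_injective_algebraMap (algebraMap k B).injective
  let D' : Derivation S B B := Derivation.mk'
    { toFun := D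
      map_add' := map_add D
      map_smul' := fun c b => by
        rw [Algebra.smul_def, D.leibniz]
        change (c : B) • D b + b • D (c : B) = (c : B) * D b
        rw [hS c c.2, smul_zero, add_zero, smul_eq_mul] } (fun a b => D.leibniz a b)
  obtain ⟨P, hP0, hP⟩ := ha
  induction hd : P.natDegree using Nat.strong_induction_on generalizing P with
  | _ d ih =>
    by_cases h0 : aeval a (derivative P) = 0
    · by_cases hP' : derivative P = 0
      · have := (derivative_eq_zero.mp hP')
        rw [eq_C_of_natDegree_eq_zero this, aeval_C] at hP
        have h2 : P.coeff 0 = 0 := Subtype.ext hP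
        rw [eq_C_of_natDegree_eq_zero this, h2, C_0] at hP0
        exact absurd rfl hP0
      · refine ih _ ?_ (derivative P) hP' h0 rfl
        rw [← hd]
        refine natDegree_derivative_lt fun h => hP' ?_
        exact derivative_of_natDegree_zero h
    · have h1 : D' (aeval a P) = aeval a (derivative P) • D' a := D'.map_aeval P a
      rw [hP, map_zero, smul_eq_mul, eq_comm, mul_eq_zero] at h1
      exact h1.resolve_left h0

end Derivations

/-! ### Polynomial solutions of a Fermat-type equation -/

/-- The inequality of Mason and Stothers in the case at hand: if `c P ^ a + d Q ^ b` is a nonzero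
constant with `a, b ≥ 2`, then `P` and `Q` are constant. -/
theorem natDegree_eq_zero_of_pow_add_pow {K : Type*} [Field K] [CharZero K] {a b : ℕ}
    (ha : 2 ≤ a) (hb : 2 ≤ b) {c d e : K} (hc : c ≠ 0) (hd : d ≠ 0) (he : e ≠ 0) {P Q : K[X]}
    (h : C c * P ^ a + C d * Q ^ b = C e) : P.natDegree = 0 ∧ Q.natDegree = 0 := by
  have hcop : IsCoprime P Q := by
    have h1 : IsCoprime (P ^ a) (Q ^ b) := by
      refine ⟨C (e⁻¹ * c), C (e⁻¹ * d), ?_⟩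
      calc C (e⁻¹ * c) * P ^ a + C (e⁻¹ * d) * Q ^ b
          = C e⁻¹ * (C c * P ^ a + C d * Q ^ b) := by simp only [C_mul]; ring
        _ = 1 := by rw [h, ← C_mul, inv_mul_cancel₀ he, C_1]
    exact (IsCoprime.pow_iff (by omega) (by omega)).mp h1
  -- As `P` and `Q` are coprime, the derivative of the equation shows that `P ^ (a - 1)` divides
  -- the derivative of `Q`, and that `Q ^ (b - 1)` divides the derivative of `P`.
  have hder : C (c * a) * P ^ (a - 1) * derivative P +
      C (d * b) * Q ^ (b - 1) * derivative Q = 0 := by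
    have := congrArg derivative h
    simp only [derivative_add, derivative_C_mul, derivative_C, derivative_pow] at this
    rw [← this]
    simp only [C_mul, map_natCast]
    ring
  have hca : c * a ≠ 0 := mul_ne_zero hc (Nat.cast_ne_zero.mpr (by omega))
  have hdb : d * b ≠ 0 := mul_ne_zero hd (Nat.cast_ne_zero.mpr (by omega))
  have hPQ : P ^ (a - 1) ∣ derivative Q := by
    have h1 : P ^ (a - 1) ∣ C (d * b) * Q ^ (b - 1) * derivative Q := by
      refine ⟨-(C (c * a) * derivative P), ?_⟩
      linear_combination hder
    have h2 : IsCoprime (P ^ (a - 1)) (C (d * b) * Q ^ (b - 1)) := by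
      exact (isCoprime_mul_unit_left_right (isUnit_C.mpr hdb.isUnit) _ _).mpr hcop.pow
    exact h2.dvd_of_dvd_mul_left h1
  have hQP : Q ^ (b - 1) ∣ derivative P := by
    have h1 : Q ^ (b - 1) ∣ C (c * a) * P ^ (a - 1) * derivative P := by
      refine ⟨-(C (d * b) * derivative Q), ?_⟩
      linear_combination hder
    have h2 : IsCoprime (Q ^ (b - 1)) (C (c * a) * P ^ (a - 1)) := by
      exact (isCoprime_mul_unit_left_right (isUnit_C.mpr hca.isUnit) _ _).mpr hcop.symm.pow
    exact h2.dvd_of_dvd_mul_left h1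
  have key : ∀ (l : ℕ) (P Q : K[X]), 1 ≤ l → P ^ l ∣ derivative Q → Q.natDegree ≠ 0 →
      P.natDegree < Q.natDegree := by
    intro l P Q hl hdvd hQ
    have hQ' : derivative Q ≠ 0 := fun h0 => hQ ((derivative_eq_zero.mp h0))
    have h1 := natDegree_le_of_dvd hdvd hQ'
    have h2 := natDegree_derivative_lt hQ
    rw [natDegree_pow] at h1
    nlinarith
  have hPQ0 : P.natDegree = 0 → Q.natDegree = 0 := by
    intro hP
    by_contra hQ
    have hQ' : derivative Q ≠ 0 := fun h0 => hQ (derivative_eq_zero.mp h0)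
    rw [derivative_of_natDegree_zero hP, mul_zero, zero_add] at hder
    have hQ0 : Q ≠ 0 := fun h0 => hQ (by rw [h0, natDegree_zero])
    exact (mul_ne_zero (mul_ne_zero (C_ne_zero.mpr hdb) (pow_ne_zero _ hQ0)) hQ') hder
  have hQP0 : Q.natDegree = 0 → P.natDegree = 0 := by
    intro hQ
    by_contra hP
    have hP' : derivative P ≠ 0 := fun h0 => hP (derivative_eq_zero.mp h0)
    rw [derivative_of_natDegree_zero hQ, mul_zero, add_zero] at hder
    have hP0 : P ≠ 0 := fun h0 => hP (by rw [h0, natDegree_zero])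
    exact (mul_ne_zero (mul_ne_zero (C_ne_zero.mpr hca) (pow_ne_zero _ hP0)) hP') hder
  by_cases hP : P.natDegree = 0
  · exact ⟨hP, hPQ0 hP⟩
  · have h1 := key (b - 1) Q P (by omega) hQP hP
    have h2 := key (a - 1) P Q (by omega) hPQ (fun h => hP (hQP0 h))
    omega

/-! ### Leading components in group algebras -/

section Weights

variable {k G Γ : Type*} [Field k] [AddCommGroup G] [AddCommGroup Γ] [LinearOrder Γ]

/-- The elements of the group algebra all of whose terms have weight at most `γ`. -/
noncomputable def lowPart (k : Type*) [Field k] (ω : G →+ Γ) (γ : Γ) :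
    Submodule k (AddMonoidAlgebra k G) :=
  AddMonoidAlgebra.supported k k {g | ω g ≤ γ}

/-- The sum of the terms of weight `γ`. -/
noncomputable def component (ω : G →+ Γ) (γ : Γ) :
    AddMonoidAlgebra k G →ₗ[k] AddMonoidAlgebra k G where
  toFun f := AddMonoidAlgebra.ofCoeff (f.coeff.filter fun g => ω g = γ)
  map_add' f f' := by
    rw [AddMonoidAlgebra.coeff_add, Finsupp.filter_add, AddMonoidAlgebra.ofCoeff_add]
  map_smul' c f := by
    rw [AddMonoidAlgebra.coeff_smul, Finsupp.filter_smul, AddMonoidAlgebra.ofCoeff_smul,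
      RingHom.id_apply]

theorem coeff_component (ω : G →+ Γ) (γ : Γ) (f : AddMonoidAlgebra k G) :
    (component ω γ f).coeff = f.coeff.filter fun g => ω g = γ := rfl

theorem component_single_of_eq {ω : G →+ Γ} {γ : Γ} {g : G} (h : ω g = γ) (r : k) :
    component ω γ (AddMonoidAlgebra.single g r) = AddMonoidAlgebra.single g r := by
  apply AddMonoidAlgebra.coeff_injective
  rw [coeff_component, AddMonoidAlgebra.coeff_single]
  exact Finsupp.filter_single_of_pos _ h

theorem component_single_of_ne {ω : G →+ Γ} {γ : Γ} {g : G} (h : ω g ≠ γ) (r : k) :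
    component ω γ (AddMonoidAlgebra.single g r) = 0 := by
  apply AddMonoidAlgebra.coeff_injective
  rw [coeff_component, AddMonoidAlgebra.coeff_single]
  exact Finsupp.filter_single_of_neg _ h

theorem mem_lowPart {ω : G →+ Γ} {γ : Γ} {f : AddMonoidAlgebra k G} :
    f ∈ lowPart k ω γ ↔ ∀ g, f.coeff g ≠ 0 → ω g ≤ γ := by
  rw [lowPart, AddMonoidAlgebra.mem_supported]
  exact ⟨fun h g hg => h (Finsupp.mem_support_iff.mpr hg),
    fun h g hg => h g (Finsupp.mem_support_iff.mp hg)⟩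

theorem single_mem_lowPart {ω : G →+ Γ} {γ : Γ} {g : G} (h : ω g ≤ γ) (r : k) :
    AddMonoidAlgebra.single g r ∈ lowPart k ω γ := by
  rw [mem_lowPart]
  intro g' hg'
  rw [AddMonoidAlgebra.coeff_single] at hg'
  rw [← (Finsupp.single_apply_ne_zero.mp hg').1] at h
  exact h

theorem lowPart_induction {ω : G →+ Γ} {γ : Γ} {P : AddMonoidAlgebra k G → Prop} (h0 : P 0)
    (hadd : ∀ f f', P f → P f' → P (f + f'))
    (hs : ∀ g r, ω g ≤ γ → P (AddMonoidAlgebra.single g r)) {f : AddMonoidAlgebra k G}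
    (hf : f ∈ lowPart k ω γ) : P f := by
  rw [← AddMonoidAlgebra.sum_coeff_single f, Finsupp.sum]
  rw [mem_lowPart] at hf
  exact Finset.sum_induction _ P (fun a b => hadd a b) h0
    fun g hg => hs g _ (hf g (Finsupp.mem_support_iff.mp hg))

theorem lowPart_mono (ω : G →+ Γ) {γ γ' : Γ} (h : γ ≤ γ') : lowPart k ω γ ≤ lowPart k ω γ' := by
  intro f hf
  rw [mem_lowPart] at hf ⊢
  exact fun g hg => (hf g hg).trans h

theorem component_eq_zero_of_lt {ω : G →+ Γ} {γ γ' : Γ} (h : γ < γ') {f : AddMonoidAlgebra k G}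
    (hf : f ∈ lowPart k ω γ) : component ω γ' f = 0 := by
  refine lowPart_induction (P := fun f => component ω γ' f = 0) (map_zero _)
    (fun f f' h1 h2 => by rw [map_add, h1, h2, add_zero])
    (fun g r hg => component_single_of_ne (hg.trans_lt h).ne r) hf

theorem component_component (ω : G →+ Γ) (γ : Γ) (f : AddMonoidAlgebra k G) :
    component ω γ (component ω γ f) = component ω γ f := by
  induction f using AddMonoidAlgebra.induction_linear with
  | zero => simp
  | add f f' h1 h2 => rw [map_add, map_add, h1, h2]
  | single g r =>
    by_cases h : ω g = γ
    · rw [component_single_of_eq h, component_single_of_eq h]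
    · rw [component_single_of_ne h, map_zero]

/-- A nonzero element has a leading component. -/
theorem exists_leading (ω : G →+ Γ) {f : AddMonoidAlgebra k G} (hf : f ≠ 0) :
    ∃ γ, f ∈ lowPart k ω γ ∧ component ω γ f ≠ 0 := by
  have hne : f.coeff.support.Nonempty := by
    rw [Finsupp.support_nonempty_iff, Ne, AddMonoidAlgebra.coeff_eq_zero]
    exact hf
  obtain ⟨g, hg, hmax⟩ := f.coeff.support.exists_max_image ω hne
  refine ⟨ω g, ?_, fun h => ?_⟩
  · rw [mem_lowPart]
    exact fun g' hg' => hmax g' (Finsupp.mem_support_iff.mpr hg')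
  · have h1 : (component ω (ω g) f).coeff g = f.coeff g := by
      rw [coeff_component, Finsupp.filter_apply, if_pos rfl]
    rw [h] at h1
    exact (Finsupp.mem_support_iff.mp hg) h1.symm

theorem mem_of_component_mem (ω : G →+ Γ) {M : Submodule k (AddMonoidAlgebra k G)}
    {f : AddMonoidAlgebra k G} (h : ∀ γ, component ω γ f ∈ M) : f ∈ M := by
  have key : f = ∑ γ ∈ f.coeff.support.image ω, component ω γ f := by
    apply AddMonoidAlgebra.coeff_injective
    rw [AddMonoidAlgebra.coeff_sum]
    ext g
    rw [Finsupp.finsetSum_apply]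
    simp only [coeff_component, Finsupp.filter_apply]
    rw [Finset.sum_ite_eq]
    split_ifs with hg
    · rfl
    · by_contra h0
      exact hg (Finset.mem_image_of_mem _ (Finsupp.mem_support_iff.mpr h0))
  rw [key]
  exact M.sum_mem fun γ _ => h γ

variable [IsOrderedAddMonoid Γ]

theorem mul_mem_lowPart {ω : G →+ Γ} {γ γ' : Γ} {f f' : AddMonoidAlgebra k G}
    (hf : f ∈ lowPart k ω γ) (hf' : f' ∈ lowPart k ω γ') : f * f' ∈ lowPart k ω (γ + γ') := by
  refine lowPart_induction (P := fun f => f * f' ∈ lowPart k ω (γ + γ')) (by simp)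
    (fun f g h1 h2 => by rw [add_mul]; exact add_mem h1 h2) (fun g r hg => ?_) hf
  refine lowPart_induction (P := fun f' => AddMonoidAlgebra.single g r * f' ∈
    lowPart k ω (γ + γ')) (by simp)
    (fun f g h1 h2 => by rw [mul_add]; exact add_mem h1 h2) (fun g' r' hg' => ?_) hf'
  rw [AddMonoidAlgebra.single_mul_single]
  refine single_mem_lowPart ?_ _
  rw [map_add]
  exact add_le_add hg hg'

theorem component_mul {ω : G →+ Γ} {γ γ' : Γ} {f f' : AddMonoidAlgebra k G}
    (hf : f ∈ lowPart k ω γ) (hf' : f' ∈ lowPart k ω γ') :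
    component ω (γ + γ') (f * f') = component ω γ f * component ω γ' f' := by
  refine lowPart_induction (P := fun f => component ω (γ + γ') (f * f') =
    component ω γ f * component ω γ' f') (by simp)
    (fun f g h1 h2 => by rw [add_mul, map_add, map_add, h1, h2, add_mul]) (fun g r hg => ?_) hf
  refine lowPart_induction (P := fun f' => component ω (γ + γ') (AddMonoidAlgebra.single g r * f')
    = component ω γ (AddMonoidAlgebra.single g r) * component ω γ' f') (by simp)
    (fun f g h1 h2 => by rw [mul_add, map_add, map_add, h1, h2, mul_add]) (fun g' r' hg' => ?_) hf'
  rw [AddMonoidAlgebra.single_mul_single]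
  by_cases h1 : ω g = γ
  · by_cases h2 : ω g' = γ'
    · rw [component_single_of_eq h1, component_single_of_eq h2, component_single_of_eq,
        AddMonoidAlgebra.single_mul_single]
      rw [map_add, h1, h2]
    · rw [component_single_of_ne h2, mul_zero, component_single_of_ne]
      rw [map_add, h1]
      exact fun h => h2 (add_left_cancel h)
  · rw [component_single_of_ne h1, zero_mul, component_single_of_ne]
    rw [map_add]
    exact (add_lt_add_of_lt_of_le (lt_of_le_of_ne hg h1) hg').ne

end Weights

/-! ### Derivations of group algebras -/

section LogDerivations

variable {k G Γ : Type*} [Field k] [AddCommGroup G]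

/-- The derivation of the group algebra with logarithmic derivative `c` on the group elements:
it sends `χ ^ g` to `χ ^ g * c g`. -/
noncomputable def logDer (c : G →+ AddMonoidAlgebra k G) :
    Derivation k (AddMonoidAlgebra k G) (AddMonoidAlgebra k G) :=
  Derivation.mk' ((AddMonoidAlgebra.basis G k).constr k
      fun g => AddMonoidAlgebra.single g 1 * c g) (by
    have hs : ∀ (g : G) (r : k), (AddMonoidAlgebra.basis G k).constr k
        (fun g => AddMonoidAlgebra.single g 1 * c g) (AddMonoidAlgebra.single g r) =
          AddMonoidAlgebra.single g r * c g := by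
      intro g r
      have h1 : AddMonoidAlgebra.single g r = r • (AddMonoidAlgebra.basis G k) g := by
        rw [AddMonoidAlgebra.basis_apply, AddMonoidAlgebra.smul_single', mul_one]
      rw [h1, map_smul, Module.Basis.constr_basis, AddMonoidAlgebra.basis_apply, smul_mul_assoc]
    intro f f'
    induction f using AddMonoidAlgebra.induction_linear with
    | zero => simp
    | add f g h1 h2 => rw [add_mul, map_add, h1, h2, map_add]; simp only [smul_eq_mul]; ring
    | single g r =>
      induction f' using AddMonoidAlgebra.induction_linear with
      | zero => simp
      | add f g h1 h2 => rw [mul_add, map_add, h1, h2, map_add]; simp only [smul_eq_mul]; ring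
      | single g' r' =>
        rw [AddMonoidAlgebra.single_mul_single, hs, hs, hs, map_add,
          ← AddMonoidAlgebra.single_mul_single]
        simp only [smul_eq_mul]
        ring)

theorem logDer_single (c : G →+ AddMonoidAlgebra k G) (g : G) (r : k) :
    logDer c (AddMonoidAlgebra.single g r) = AddMonoidAlgebra.single g r * c g := by
  have h1 : AddMonoidAlgebra.single g r = r • (AddMonoidAlgebra.basis G k) g := by
    rw [AddMonoidAlgebra.basis_apply, AddMonoidAlgebra.smul_single', mul_one]
  rw [h1, Derivation.map_smul]
  change r • (AddMonoidAlgebra.basis G k).constr k _ _ = _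
  rw [Module.Basis.constr_basis, AddMonoidAlgebra.basis_apply, smul_mul_assoc]

variable [AddCommGroup Γ] [LinearOrder Γ]

/-- The part of degree `δ`, for the weight `ω`, of the derivation `logDer c`. -/
noncomputable def derComponent (ω : G →+ Γ) (δ : Γ) (c : G →+ AddMonoidAlgebra k G) :
    Derivation k (AddMonoidAlgebra k G) (AddMonoidAlgebra k G) :=
  logDer ((component ω δ).toAddMonoidHom.comp c)

theorem derComponent_single (ω : G →+ Γ) (δ : Γ) (c : G →+ AddMonoidAlgebra k G) (g : G) (r : k) :
    derComponent ω δ c (AddMonoidAlgebra.single g r) =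
      AddMonoidAlgebra.single g r * component ω δ (c g) := logDer_single _ _ _

theorem component_single_mul {ω : G →+ Γ} {γ γ' : Γ} {g : G} (hg : ω g = γ) (r : k)
    (f : AddMonoidAlgebra k G) :
    component ω (γ + γ') (AddMonoidAlgebra.single g r * f) =
      AddMonoidAlgebra.single g r * component ω γ' f := by
  induction f using AddMonoidAlgebra.induction_linear with
  | zero => simp
  | add f f' h1 h2 => rw [mul_add, map_add, h1, h2, map_add, mul_add]
  | single g' r' =>
    rw [AddMonoidAlgebra.single_mul_single]
    by_cases h : ω g' = γ'
    · rw [component_single_of_eq h, component_single_of_eq,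
        AddMonoidAlgebra.single_mul_single]
      rw [map_add, hg, h]
    · rw [component_single_of_ne h, mul_zero, component_single_of_ne]
      rw [map_add, hg]
      exact fun h' => h (add_left_cancel h')

/-- `derComponent ω δ c` is homogeneous of degree `δ`. -/
theorem derComponent_component (ω : G →+ Γ) (δ γ : Γ) (c : G →+ AddMonoidAlgebra k G)
    (f : AddMonoidAlgebra k G) :
    derComponent ω δ c (component ω γ f) = component ω (γ + δ) (derComponent ω δ c f) := by
  induction f using AddMonoidAlgebra.induction_linear with
  | zero => simp
  | add f f' h1 h2 => simp only [map_add, h1, h2]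
  | single g r =>
    rw [derComponent_single]
    by_cases h : ω g = γ
    · rw [component_single_of_eq h, derComponent_single, component_single_mul h,
        component_component]
    · rw [component_single_of_ne h, map_zero]
      have h2 : γ + δ = ω g + (γ - ω g + δ) := by abel
      rw [h2, component_single_mul rfl]
      have h3 : component ω (γ - ω g + δ) (component ω δ (c g)) = 0 := by
        apply AddMonoidAlgebra.coeff_injective
        ext g'
        rw [coeff_component, coeff_component, Finsupp.filter_apply, Finsupp.filter_apply]
        split_ifs with h4 h5
        · refine absurd ?_ h
          rw [h5] at h4
          have h6 : γ - ω g = 0 := by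
            have := congrArg (· - δ) h4
            simpa using this.symm
          exact (sub_eq_zero.mp h6).symm
        · rfl
        · rfl
      rw [h3, mul_zero]

variable [IsOrderedAddMonoid Γ]

theorem logDer_mem_lowPart {ω : G →+ Γ} {γ δ : Γ} {c : G →+ AddMonoidAlgebra k G}
    (hc : ∀ g, c g ∈ lowPart k ω δ) {f : AddMonoidAlgebra k G} (hf : f ∈ lowPart k ω γ) :
    logDer c f ∈ lowPart k ω (γ + δ) := by
  refine lowPart_induction (P := fun f => logDer c f ∈ lowPart k ω (γ + δ)) (by simp)
    (fun f g h1 h2 => by rw [map_add]; exact add_mem h1 h2) (fun g r hg => ?_) hf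
  rw [logDer_single]
  exact mul_mem_lowPart (single_mem_lowPart hg r) (hc g)

/-- The leading component of a derivation acts on leading components. -/
theorem component_logDer {ω : G →+ Γ} {γ δ : Γ} {c : G →+ AddMonoidAlgebra k G}
    (hc : ∀ g, c g ∈ lowPart k ω δ) {f : AddMonoidAlgebra k G} (hf : f ∈ lowPart k ω γ) :
    component ω (γ + δ) (logDer c f) = derComponent ω δ c (component ω γ f) := by
  refine lowPart_induction (P := fun f => component ω (γ + δ) (logDer c f) =
    derComponent ω δ c (component ω γ f)) (by simp)
    (fun f g h1 h2 => by simp only [map_add, h1, h2]) (fun g r hg => ?_) hf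
  rw [logDer_single, component_mul (single_mem_lowPart hg r) (hc g)]
  by_cases h : ω g = γ
  · rw [component_single_of_eq h, derComponent_single]
  · rw [component_single_of_ne h, zero_mul, map_zero]

theorem component_iterate_logDer {ω : G →+ Γ} {δ : Γ} {c : G →+ AddMonoidAlgebra k G}
    (hc : ∀ g, c g ∈ lowPart k ω δ) (N : ℕ) {γ : Γ} {f : AddMonoidAlgebra k G}
    (hf : f ∈ lowPart k ω γ) :
    component ω (γ + N • δ) ((logDer c)^[N] f) = (derComponent ω δ c)^[N] (component ω γ f) := by
  induction N generalizing γ f with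
  | zero => simp
  | succ N ih =>
    rw [Function.iterate_succ_apply, Function.iterate_succ_apply, ← component_logDer hc hf,
      ← ih (logDer_mem_lowPart hc hf), succ_nsmul']
    congr 2
    abel

theorem component_mem_nilpotentPart {ω : G →+ Γ} {γ δ : Γ} {c : G →+ AddMonoidAlgebra k G}
    (hc : ∀ g, c g ∈ lowPart k ω δ) {f : AddMonoidAlgebra k G} (hf : f ∈ lowPart k ω γ)
    (hn : f ∈ nilpotentPart (logDer c)) :
    component ω γ f ∈ nilpotentPart (derComponent ω δ c) := by
  obtain ⟨N, hN⟩ := hn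
  refine ⟨N, ?_⟩
  rw [← component_iterate_logDer hc N hf, hN, map_zero]

end LogDerivations

/-! ### The Laurent polynomial ring containing the coordinate ring -/

section Laurent

/-- Exponents of Laurent monomials in `x_0, …, x_m`, `z`, `t`. -/
abbrev Exponent (m : ℕ) : Type := (Fin (m + 1) → ℤ) × ℤ × ℤ

/-- Laurent polynomials in `x_0, …, x_m`, `z`, `t`. -/
abbrev Laurent (k : Type*) [Field k] (m : ℕ) : Type _ := AddMonoidAlgebra k (Exponent m)

variable (k : Type*) [Field k] {m : ℕ}

/-- The Laurent monomial `x ^ a`. -/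
noncomputable def xMon (a : Fin (m + 1) → ℤ) : Laurent k m := AddMonoidAlgebra.single (a, 0, 0) 1

/-- The monomial `z ^ b * t ^ c`. -/
noncomputable def ztMon (b c : ℤ) : Laurent k m := AddMonoidAlgebra.single (0, b, c) 1

variable (m) in
/-- The variable `z`. -/
noncomputable abbrev zL : Laurent k m := ztMon k 1 0

variable (m) in
/-- The variable `t`. -/
noncomputable abbrev tL : Laurent k m := ztMon k 0 1

/-- The variable `x_i`. -/
noncomputable abbrev xL (i : Fin (m + 1)) : Laurent k m := xMon k (Pi.single i 1)

theorem xMon_mul (a a' : Fin (m + 1) → ℤ) : xMon k a * xMon k a' = xMon k (a + a') := by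
  simp [xMon, AddMonoidAlgebra.single_mul_single]

theorem ztMon_mul (b c b' c' : ℤ) :
    ztMon k (m := m) b c * ztMon k b' c' = ztMon k (b + b') (c + c') := by
  simp [ztMon, AddMonoidAlgebra.single_mul_single]

theorem xMon_mul_ztMon (a : Fin (m + 1) → ℤ) (b c : ℤ) :
    xMon k a * ztMon k b c = AddMonoidAlgebra.single (a, b, c) 1 := by
  simp [xMon, ztMon, AddMonoidAlgebra.single_mul_single]

theorem xMon_zero : xMon k (0 : Fin (m + 1) → ℤ) = 1 := rfl

theorem ztMon_zero : ztMon k (m := m) 0 0 = 1 := rfl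

theorem xMon_ne_zero (a : Fin (m + 1) → ℤ) : xMon k a ≠ 0 :=
  AddMonoidAlgebra.single_ne_zero.mpr one_ne_zero

theorem ztMon_ne_zero (b c : ℤ) : ztMon k (m := m) b c ≠ 0 :=
  AddMonoidAlgebra.single_ne_zero.mpr one_ne_zero

theorem ztMon_natCast (b c : ℕ) : ztMon k (m := m) b c = zL k m ^ b * tL k m ^ c := by
  simp only [zL, tL, ztMon, AddMonoidAlgebra.single_pow, AddMonoidAlgebra.single_mul_single]
  simp

theorem xL_pow (i : Fin (m + 1)) (b : ℕ) : xL k i ^ b = xMon k (Pi.single i (b : ℤ)) := by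
  simp only [xMon, AddMonoidAlgebra.single_pow]
  congr 1
  · ext i' <;> simp [Pi.single_apply]
  · simp

theorem prod_xL_pow (a : Fin (m + 1) → ℕ) : ∏ i, xL k i ^ a i = xMon k fun i => (a i : ℤ) := by
  have h : ∀ s : Finset (Fin (m + 1)), ∏ i ∈ s, xL k i ^ a i =
      xMon k (∑ i ∈ s, Pi.single i (a i : ℤ)) := by
    intro s
    induction s using Finset.induction_on with
    | empty => simp [xMon_zero]
    | insert i s hi ih => rw [Finset.prod_insert hi, Finset.sum_insert hi, ih, xL_pow, xMon_mul]
  rw [h]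
  congr 1
  ext i
  rw [Finset.sum_apply]
  simp [Pi.single_apply]

variable {k} (q r : ℕ) (n : Fin (m + 1) → ℕ) (p : Polynomial k)

/-- The image of `x_0 * p(∏ x_i)` in the Laurent polynomial ring. -/
noncomputable def pL : Laurent k m := xL k 0 * aeval (∏ i, xL k i) p

/-- The Laurent polynomial expressing `y` through the other variables. -/
noncomputable def yL : Laurent k m :=
  -(xMon k (fun i => -(n i : ℤ)) * (zL k m ^ q + tL k m ^ r + pL p))

variable (k) in
/-- The leading part `-(z ^ q + t ^ r) / ∏ x_i ^ n_i` of `y`. -/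
noncomputable def yTop : Laurent k m :=
  -(xMon k (fun i => -(n i : ℤ)) * (zL k m ^ q + tL k m ^ r))

theorem xMon_mul_yL :
    xMon k (fun i => (n i : ℤ)) * yL q r n p = -(zL k m ^ q + tL k m ^ r + pL p) := by
  rw [yL, mul_neg, ← mul_assoc, xMon_mul]
  have : (fun i => (n i : ℤ)) + (fun i => -(n i : ℤ)) = 0 := by ext i; simp
  rw [this, xMon_zero, one_mul]

variable (k) in
theorem xMon_mul_yTop :
    xMon k (fun i => (n i : ℤ)) * yTop k q r n = -(zL k m ^ q + tL k m ^ r) := by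
  rw [yTop, mul_neg, ← mul_assoc, xMon_mul]
  have : (fun i => (n i : ℤ)) + (fun i => -(n i : ℤ)) = 0 := by ext i; simp
  rw [this, xMon_zero, one_mul]

variable (k) in
theorem zL_pow_add_tL_pow_ne_zero {q r : ℕ} (hq : q ≠ 0) :
    zL k m ^ q + tL k m ^ r ≠ 0 := by
  intro h
  have h1 : zL k m ^ q = ztMon k q 0 := by
    have := ztMon_natCast k (m := m) q 0
    simpa using this.symm
  have h2 : tL k m ^ r = ztMon k 0 r := by
    have := ztMon_natCast k (m := m) 0 r
    simpa using this.symm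
  rw [h1, h2] at h
  have h3 := congrArg (fun f => f.coeff ((0, (q : ℤ), 0) : Exponent m)) h
  have h4 : ((0, 0, (r : ℤ)) : Exponent m) ≠ (0, (q : ℤ), 0) := by
    intro h5
    rw [Prod.mk.injEq, Prod.mk.injEq] at h5
    exact hq (by exact_mod_cast h5.2.1.symm)
  simp only [ztMon, AddMonoidAlgebra.coeff_add, AddMonoidAlgebra.coeff_single, Finsupp.add_apply,
    Finsupp.single_eq_same, AddMonoidAlgebra.coeff_zero, Finsupp.zero_apply] at h3
  rw [Finsupp.single_eq_of_ne h4.symm, add_zero] at h3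
  exact one_ne_zero h3

variable (k) in
theorem yTop_ne_zero {q r : ℕ} (hq : q ≠ 0) : yTop k q r n ≠ 0 :=
  neg_ne_zero.mpr (mul_ne_zero (xMon_ne_zero k _) (zL_pow_add_tL_pow_ne_zero k hq))

/-- The images of the variables in the Laurent polynomial ring. -/
noncomputable def varL : Var m → Laurent k m
  | .x i => xL k i
  | .y => yL q r n p
  | .z => zL k m
  | .t => tL k m

/-- The homomorphism from the coordinate ring to the Laurent polynomial ring. -/
noncomputable def toLaurent : R q r m n p →ₐ[k] Laurent k m :=
  Ideal.Quotient.liftₐ _ (MvPolynomial.aeval (varL q r n p)) (by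
    intro a ha
    have h0 : MvPolynomial.aeval (varL q r n p) (equation q r m n p) = 0 := by
      simp only [equation, map_add, map_mul, map_prod, map_pow, MvPolynomial.aeval_X, varL,
        ← Polynomial.aeval_algHom_apply]
      rw [prod_xL_pow, xMon_mul_yL, pL]
      ring
    obtain ⟨b, rfl⟩ := Ideal.mem_span_singleton.mp ha
    rw [map_mul, h0, zero_mul])

theorem toLaurent_coord (v : Var m) : toLaurent q r n p (coord q r m n p v) = varL q r n p v := by
  have : toLaurent q r n p (coord q r m n p v) =
    MvPolynomial.aeval (varL q r n p) (MvPolynomial.X v) := rfl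
  rw [this, MvPolynomial.aeval_X]

end Laurent

/-! ### Normal forms in the coordinate ring -/

section NormalForm

variable {k : Type*} [Field k] (q r : ℕ) {m : ℕ} (n : Fin (m + 1) → ℕ) (p : Polynomial k)

/-- Exponents `(a, j, b, c)` of monomials `x ^ a * y ^ j * z ^ b * t ^ c`. -/
abbrev MonIndex (m : ℕ) : Type := (Fin (m + 1) → ℕ) × ℕ × ℕ × ℕ

/-- The class of `x ^ a * y ^ j * z ^ b * t ^ c` in the coordinate ring. -/
noncomputable def monR (ν : MonIndex m) : R q r m n p :=
  (∏ i, coord q r m n p (.x i) ^ ν.1 i) * coord q r m n p .y ^ ν.2.1 *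
    (coord q r m n p .z ^ ν.2.2.1 * coord q r m n p .t ^ ν.2.2.2)

/-- A monomial is normal if it is not divisible by `(∏ x_i ^ n_i) * y`. -/
def IsNormal (ν : MonIndex m) : Prop := ν.2.1 = 0 ∨ ∃ i, ν.1 i < n i

theorem coord_relation : (∏ i, coord q r m n p (.x i) ^ n i) * coord q r m n p .y =
    -(coord q r m n p .z ^ q + coord q r m n p .t ^ r +
      coord q r m n p (.x 0) * aeval (∏ i, coord q r m n p (.x i)) p) := by
  have h : Ideal.Quotient.mkₐ k (Ideal.span {equation q r m n p}) (equation q r m n p) = 0 :=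
    Ideal.Quotient.eq_zero_iff_mem.mpr (Ideal.subset_span rfl)
  rw [equation] at h
  simp only [map_add, map_mul, map_prod, map_pow, ← Polynomial.aeval_algHom_apply] at h
  change (∏ i, coord q r m n p (.x i) ^ n i) * coord q r m n p .y
    + coord q r m n p .z ^ q + coord q r m n p .t ^ r +
      coord q r m n p (.x 0) * aeval (∏ i, coord q r m n p (.x i)) p = 0 at h
  linear_combination h

theorem monR_mul (ν ν' : MonIndex m) :
    monR q r n p ν * monR q r n p ν' = monR q r n p (ν + ν') := by
  simp only [monR, Prod.fst_add, Prod.snd_add, Pi.add_apply, pow_add, Finset.prod_mul_distrib]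
  ring

theorem monR_x (i : Fin (m + 1)) :
    monR q r n p (Pi.single i 1, 0, 0, 0) = coord q r m n p (.x i) := by
  have : ∏ i', coord q r m n p (.x i') ^ (Pi.single i 1 : Fin (m + 1) → ℕ) i' =
      coord q r m n p (.x i) := by
    rw [Finset.prod_eq_single i]
    · simp
    · intro b _ hb; simp [hb]
    · simp
  simp [monR, this]

theorem monR_y : monR q r n p (0, 1, 0, 0) = coord q r m n p .y := by simp [monR]

theorem monR_z : monR q r n p (0, 0, 1, 0) = coord q r m n p .z := by simp [monR]

theorem monR_t : monR q r n p (0, 0, 0, 1) = coord q r m n p .t := by simp [monR]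

theorem span_monR : Submodule.span k (Set.range (monR q r n p)) = ⊤ := by
  rw [eq_top_iff]
  rintro s -
  obtain ⟨P, rfl⟩ := Ideal.Quotient.mk_surjective s
  induction P using MvPolynomial.induction_on with
  | C c =>
    have h1 : monR q r n p 0 = 1 := by simp [monR]
    have : Ideal.Quotient.mk (Ideal.span {equation q r m n p}) (MvPolynomial.C c) =
        c • monR q r n p 0 := by
      rw [h1, ← Algebra.algebraMap_eq_smul_one]
      rfl
    rw [this]
    exact Submodule.smul_mem _ _ (Submodule.subset_span ⟨0, rfl⟩)
  | add P Q hP hQ => rw [map_add]; exact add_mem hP hQ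
  | mul_X P v hP =>
    rw [map_mul]
    change _ * coord q r m n p v ∈ _
    have hv : ∃ ν, coord q r m n p v = monR q r n p ν := by
      cases v with
      | x i => exact ⟨_, (monR_x q r n p i).symm⟩
      | y => exact ⟨_, (monR_y q r n p).symm⟩
      | z => exact ⟨_, (monR_z q r n p).symm⟩
      | t => exact ⟨_, (monR_t q r n p).symm⟩
    obtain ⟨ν, hν⟩ := hv
    rw [hν]
    refine Submodule.span_induction ?_ (by simp) (fun a b _ _ h1 h2 => ?_) (fun c a _ h1 => ?_) hP
    · rintro _ ⟨ν', rfl⟩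
      rw [monR_mul]
      exact Submodule.subset_span ⟨_, rfl⟩
    · rw [add_mul]; exact add_mem h1 h2
    · rw [smul_mul_assoc]; exact Submodule.smul_mem _ _ h1

/-- The equation rewrites `(∏ x_i ^ n_i) * y` in terms of monomials with fewer factors `y`. -/
theorem span_monR_normal :
    Submodule.span k (monR q r n p '' {ν | IsNormal n ν}) = ⊤ := by
  rw [eq_top_iff, ← span_monR q r n p, Submodule.span_le]
  rintro _ ⟨⟨a, j, b, c⟩, rfl⟩
  induction j generalizing a b c with
  | zero => exact Submodule.subset_span ⟨_, Or.inl rfl, rfl⟩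
  | succ j ih =>
    by_cases hn : IsNormal n (a, j + 1, b, c)
    · exact Submodule.subset_span ⟨_, hn, rfl⟩
    · have ha : ∀ i, n i ≤ a i := fun i => by
        by_contra h
        exact hn (Or.inr ⟨i, not_le.mp h⟩)
      obtain ⟨a', rfl⟩ : ∃ a', a = a' + n := ⟨a - n, by ext i; simp [ha i]⟩
      have h1 : monR q r n p (a' + n, j + 1, b, c) =
          monR q r n p (a', j, b, c) * ((∏ i, coord q r m n p (.x i) ^ n i) *
            coord q r m n p .y) := by
        simp only [monR, Pi.add_apply, pow_add, Finset.prod_mul_distrib, pow_one]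
        ring
      have hz : monR q r n p (a', j, b, c) * coord q r m n p .z ^ q =
          monR q r n p (a', j, b + q, c) := by simp only [monR, pow_add]; ring
      have ht : monR q r n p (a', j, b, c) * coord q r m n p .t ^ r =
          monR q r n p (a', j, b, c + r) := by simp only [monR, pow_add]; ring
      have hx : ∀ l : ℕ, monR q r n p (a', j, b, c) * (coord q r m n p (.x 0) *
          (∏ i, coord q r m n p (.x i)) ^ l) =
            monR q r n p (a' + (Pi.single 0 1 + fun _ => l), j, b, c) := by
        intro l
        have h2 : (∏ i, coord q r m n p (.x i)) ^ l = monR q r n p ((fun _ => l), 0, 0, 0) := by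
          simp [monR, Finset.prod_pow]
        rw [h2, ← monR_x, monR_mul, monR_mul]
        congr 1
      have hmul : ∀ u v w x : R q r m n p, x * -(u + v + w) = -(x * u + x * v + x * w) :=
        fun u v w x => by ring
      rw [h1, coord_relation, aeval_eq_sum_range, Finset.mul_sum, hmul, hz, ht, Finset.mul_sum]
      refine neg_mem (add_mem (add_mem (ih _ _ _) (ih _ _ _)) (sum_mem fun l _ => ?_))
      rw [mul_smul_comm, mul_smul_comm, hx]
      exact Submodule.smul_mem _ _ (ih _ _ _)

/-- Every element of the coordinate ring is a combination of normal monomials. -/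
theorem exists_normalForm (s : R q r m n p) : ∃ c : MonIndex m →₀ k,
    (∀ ν ∈ c.support, IsNormal n ν) ∧ s = ∑ ν ∈ c.support, c ν • monR q r n p ν := by
  have hs : s ∈ Submodule.span k (monR q r n p '' {ν | IsNormal n ν}) := by
    rw [span_monR_normal]; trivial
  obtain ⟨c, hc, rfl⟩ := (Finsupp.mem_span_image_iff_linearCombination k).mp hs
  refine ⟨c, fun ν hν => hc hν, ?_⟩
  rw [Finsupp.linearCombination_apply, Finsupp.sum]

end NormalForm

/-! ### Leading components of elements of the coordinate ring -/

section Leading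

variable {k Γ : Type*} [Field k] [AddCommGroup Γ] [LinearOrder Γ] {m : ℕ}

/-- `f` has weight at most `γ`, and `f'` is its component of weight `γ`. -/
def HasLeading {G : Type*} [AddCommGroup G] (ω : G →+ Γ) (γ : Γ)
    (f f' : AddMonoidAlgebra k G) : Prop := f ∈ lowPart k ω γ ∧ component ω γ f = f'

section General

variable {G : Type*} [AddCommGroup G] {ω : G →+ Γ}

theorem hasLeading_single {γ : Γ} {g : G} (h : ω g = γ) (c : k) :
    HasLeading ω γ (AddMonoidAlgebra.single g c) (AddMonoidAlgebra.single g c) :=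
  ⟨single_mem_lowPart h.le c, component_single_of_eq h c⟩

theorem HasLeading.add {γ : Γ} {f f' g g' : AddMonoidAlgebra k G} (hf : HasLeading ω γ f f')
    (hg : HasLeading ω γ g g') : HasLeading ω γ (f + g) (f' + g') :=
  ⟨add_mem hf.1 hg.1, by rw [map_add, hf.2, hg.2]⟩

theorem HasLeading.neg {γ : Γ} {f f' : AddMonoidAlgebra k G} (hf : HasLeading ω γ f f') :
    HasLeading ω γ (-f) (-f') :=
  ⟨neg_mem hf.1, by rw [map_neg, hf.2]⟩

theorem hasLeading_of_lt {γ γ' : Γ} {f : AddMonoidAlgebra k G} (hf : f ∈ lowPart k ω γ)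
    (h : γ < γ') : HasLeading ω γ' f 0 :=
  ⟨lowPart_mono ω h.le hf, component_eq_zero_of_lt h hf⟩

variable [IsOrderedAddMonoid Γ]

theorem HasLeading.mul {γ γ' : Γ} {f f' g g' : AddMonoidAlgebra k G} (hf : HasLeading ω γ f f')
    (hg : HasLeading ω γ' g g') : HasLeading ω (γ + γ') (f * g) (f' * g') :=
  ⟨mul_mem_lowPart hf.1 hg.1, by rw [component_mul hf.1 hg.1, hf.2, hg.2]⟩

theorem HasLeading.pow {γ : Γ} {f f' : AddMonoidAlgebra k G} (hf : HasLeading ω γ f f')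
    (j : ℕ) : HasLeading ω (j • γ) (f ^ j) (f' ^ j) := by
  induction j with
  | zero =>
    rw [zero_nsmul, pow_zero, pow_zero]
    exact hasLeading_single (map_zero ω) 1
  | succ j ih =>
    rw [succ_nsmul, pow_succ, pow_succ]
    exact ih.mul hf

end General

/-- The weights used to degenerate the coordinate ring to `∏ x_i ^ n_i * y + z ^ q + t ^ r = 0`.
The weight of a monomial determines the exponents of the `x_i` and the degree in `z` and `t`, where
`z` counts `r` and `t` counts `q`; `z ^ q` and `t ^ r` have the same nonnegative weight; and the
`x_i` have negative weight, so that `x_0 * p(∏ x_i)` is lighter than `z ^ q`. -/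
structure IsAdmissible (ω : Exponent m →+ Γ) (q r : ℕ) : Prop where
  separates : ∀ g g', ω g = ω g' →
    g.1 = g'.1 ∧ (r : ℤ) * g.2.1 + q * g.2.2 = r * g'.2.1 + q * g'.2.2
  balanced : ω (0, q, 0) = ω (0, 0, r)
  nonneg : 0 ≤ ω (0, q, 0)
  neg : ∀ i, ω (Pi.single i 1, 0, 0) < 0

variable (k m) in
/-- Forms in `z` and `t` that are homogeneous of degree `w` when `z` has degree `r` and `t` has
degree `q`. -/
noncomputable def ztForms (q r w : ℕ) : Submodule k (Laurent k m) :=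
  Submodule.span k ((fun bc : ℕ × ℕ => ztMon k bc.1 bc.2) '' {bc | r * bc.1 + q * bc.2 = w})

variable [IsOrderedAddMonoid Γ]

theorem pL_mem_lowPart {ω : Exponent m →+ Γ} (h : ∀ i, ω (Pi.single i 1, 0, 0) ≤ 0)
    (p : Polynomial k) : pL p ∈ lowPart k ω (ω (Pi.single 0 1, 0, 0)) := by
  have hx : ∀ i, xL k i ∈ lowPart k ω 0 := fun i => single_mem_lowPart (h i) 1
  have h1 : (1 : Laurent k m) ∈ lowPart k ω 0 := single_mem_lowPart (map_zero ω).le 1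
  have hprod : ∏ i, xL k i ∈ lowPart k ω 0 :=
    Finset.prod_induction _ (· ∈ lowPart k ω 0)
      (fun a b ha hb => by simpa using mul_mem_lowPart ha hb) h1 fun i _ => hx i
  have hpow : ∀ l : ℕ, (∏ i, xL k i) ^ l ∈ lowPart k ω 0 := by
    intro l
    induction l with
    | zero => simpa using h1
    | succ l ih =>
      rw [pow_succ]
      simpa using mul_mem_lowPart ih hprod
  rw [pL, aeval_eq_sum_range, ← add_zero (ω (Pi.single 0 1, 0, 0))]
  refine mul_mem_lowPart (single_mem_lowPart le_rfl 1) (sum_mem fun l _ =>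
    Submodule.smul_mem _ _ (hpow l))

theorem zL_pow_eq (b : ℕ) : zL k m ^ b = ztMon k b 0 := by
  simpa using (ztMon_natCast k (m := m) b 0).symm

theorem tL_pow_eq (c : ℕ) : tL k m ^ c = ztMon k 0 c := by
  simpa using (ztMon_natCast k (m := m) 0 c).symm

variable {ω : Exponent m →+ Γ} {q r : ℕ} (n : Fin (m + 1) → ℕ) (p : Polynomial k)

theorem IsAdmissible.hasLeading_yL (hω : IsAdmissible ω q r) :
    HasLeading ω (ω ((fun i => -(n i : ℤ)), (q : ℤ), 0)) (yL q r n p) (yTop k q r n) := by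
  have h1 : ω ((fun i => -(n i : ℤ)), (q : ℤ), 0) =
      ω ((fun i => -(n i : ℤ)), 0, 0) + ω (0, (q : ℤ), 0) := by
    rw [← map_add]; simp
  rw [h1, yL, yTop]
  refine ((hasLeading_single rfl 1).mul ?_).neg
  have h2 : HasLeading ω (ω (0, (q : ℤ), 0)) (pL p) 0 :=
    hasLeading_of_lt (pL_mem_lowPart (fun i => (hω.neg i).le) p) ((hω.neg 0).trans_le hω.nonneg)
  rw [zL_pow_eq, tL_pow_eq]
  have h3 := ((hasLeading_single (k := k) (ω := ω) (g := (0, (q : ℤ), 0)) rfl 1).add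
    (hasLeading_single (g := (0, 0, (r : ℤ))) hω.balanced.symm 1)).add h2
  rw [add_zero] at h3
  exact h3

/-- The exponent of the leading terms of `x ^ a * y ^ j * z ^ b * t ^ c`. -/
def topExponent (q : ℕ) (ν : MonIndex m) : Exponent m :=
  (fun i => (ν.1 i : ℤ) - ν.2.1 * n i, ν.2.2.1 + q * ν.2.1, ν.2.2.2)

theorem toLaurent_monR (q r : ℕ) (ν : MonIndex m) : toLaurent q r n p (monR q r n p ν) =
    xMon k (fun i => (ν.1 i : ℤ)) * yL q r n p ^ ν.2.1 * ztMon k ν.2.2.1 ν.2.2.2 := by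
  rw [ztMon_natCast, ← prod_xL_pow]
  simp only [monR, map_mul, map_prod, map_pow, toLaurent_coord, varL]

theorem IsAdmissible.hasLeading_monR (hω : IsAdmissible ω q r) (ν : MonIndex m) :
    HasLeading ω (ω (topExponent n q ν)) (toLaurent q r n p (monR q r n p ν))
      (xMon k (fun i => (ν.1 i : ℤ)) * yTop k q r n ^ ν.2.1 * ztMon k ν.2.2.1 ν.2.2.2) := by
  rw [toLaurent_monR]
  have h1 : ω (topExponent n q ν) = ω ((fun i => (ν.1 i : ℤ)), 0, 0) +
      ν.2.1 • ω ((fun i => -(n i : ℤ)), (q : ℤ), 0) + ω (0, (ν.2.2.1 : ℤ), (ν.2.2.2 : ℤ)) := by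
    rw [← map_nsmul, ← map_add, ← map_add]
    congr 1
    refine Prod.ext ?_ (Prod.ext ?_ ?_)
    · ext i; simp [topExponent]; ring
    · simp [topExponent]; ring
    · simp [topExponent]
  rw [h1]
  exact ((hasLeading_single rfl 1).mul ((hω.hasLeading_yL n p).pow _)).mul (hasLeading_single rfl 1)

/-- The leading terms of a normal monomial determine the exponents of the `x_i` and of `y` in it. -/
theorem eq_of_topExponent_eq {ν ν' : MonIndex m} (hν : IsNormal n ν) (hν' : IsNormal n ν')
    (h : (topExponent n q ν).1 = (topExponent n q ν').1) : ν.1 = ν'.1 ∧ ν.2.1 = ν'.2.1 := by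
  have key : ∀ {ν ν' : MonIndex m}, IsNormal n ν →
      (topExponent n q ν).1 = (topExponent n q ν').1 → ν.2.1 ≤ ν'.2.1 := by
    intro ν ν' hν h
    by_contra hlt
    rw [not_le] at hlt
    obtain h0 | ⟨i, hi⟩ := hν
    · omega
    · have hi' : (ν.1 i : ℤ) - ν.2.1 * n i = (ν'.1 i : ℤ) - ν'.2.1 * n i := congrFun h i
      zify at hlt hi
      nlinarith
  have hj : ν.2.1 = ν'.2.1 := le_antisymm (key hν h) (key hν' h.symm)
  refine ⟨?_, hj⟩
  ext i
  have hi' : (ν.1 i : ℤ) - ν.2.1 * n i = (ν'.1 i : ℤ) - ν'.2.1 * n i := congrFun h i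
  rw [hj] at hi'
  omega

/-- The leading component of a nonzero element of the coordinate ring is
`x ^ a * yTop ^ j * h` with `h` a weighted form in `z` and `t`. -/
theorem IsAdmissible.exists_leading_normalForm (hω : IsAdmissible ω q r) {c : MonIndex m →₀ k}
    (hc : ∀ ν ∈ c.support, IsNormal n ν) (hc0 : c ≠ 0) :
    ∃ ν₀ ∈ c.support, (∀ ν ∈ c.support, ω (topExponent n q ν) ≤ ω (topExponent n q ν₀)) ∧
      ∃ w, ∃ h ∈ ztForms k m q r w, h ≠ 0 ∧ HasLeading ω (ω (topExponent n q ν₀))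
        (toLaurent q r n p (∑ ν ∈ c.support, c ν • monR q r n p ν))
        (xMon k (fun i => (ν₀.1 i : ℤ)) * yTop k q r n ^ ν₀.2.1 * h) := by
  classical
  obtain ⟨ν₀, hν₀, hmax⟩ := c.support.exists_max_image (fun ν => ω (topExponent n q ν))
    (Finsupp.support_nonempty_iff.mpr hc0)
  set γ := ω (topExponent n q ν₀) with hγ
  set T := c.support.filter fun ν => ω (topExponent n q ν) = γ with hT
  have hTν : ∀ ν ∈ T, ν.1 = ν₀.1 ∧ ν.2.1 = ν₀.2.1 ∧
      r * ν.2.2.1 + q * ν.2.2.2 = r * ν₀.2.2.1 + q * ν₀.2.2.2 := by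
    intro ν hν
    rw [hT, Finset.mem_filter] at hν
    obtain ⟨h1, h2⟩ := hω.separates _ _ hν.2
    obtain ⟨h3, h4⟩ := eq_of_topExponent_eq n (hc ν hν.1) (hc ν₀ hν₀) h1
    refine ⟨h3, h4, ?_⟩
    simp only [topExponent, h4] at h2
    zify
    linear_combination h2
  refine ⟨ν₀, hν₀, hmax, r * ν₀.2.2.1 + q * ν₀.2.2.2,
    ∑ ν ∈ T, c ν • ztMon k ν.2.2.1 ν.2.2.2, ?_, ?_, ?_, ?_⟩
  · exact sum_mem fun ν hν => Submodule.smul_mem _ _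
      (Submodule.subset_span ⟨(ν.2.2.1, ν.2.2.2), (hTν ν hν).2.2, rfl⟩)
  · intro h0
    have h1 := congrArg (fun f => f.coeff ((0, (ν₀.2.2.1 : ℤ), (ν₀.2.2.2 : ℤ)) : Exponent m)) h0
    simp only [AddMonoidAlgebra.coeff_sum, AddMonoidAlgebra.coeff_smul, Finsupp.finsetSum_apply,
      Finsupp.smul_apply, ztMon, AddMonoidAlgebra.coeff_single, AddMonoidAlgebra.coeff_zero,
      Finsupp.zero_apply] at h1
    rw [Finset.sum_eq_single ν₀] at h1
    · rw [Finsupp.single_eq_same, smul_eq_mul, mul_one] at h1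
      exact (Finsupp.mem_support_iff.mp hν₀) h1
    · intro ν hν hne
      rw [Finsupp.single_eq_of_ne, smul_zero]
      intro heq
      rw [Prod.mk.injEq, Prod.mk.injEq, Nat.cast_inj, Nat.cast_inj] at heq
      obtain ⟨h3, h4, -⟩ := hTν ν hν
      exact hne (Prod.ext h3 (Prod.ext h4 (Prod.ext heq.2.1.symm heq.2.2.symm)))
    · intro h
      exact absurd (by rw [hT, Finset.mem_filter]; exact ⟨hν₀, rfl⟩) h
  · rw [map_sum]
    refine sum_mem fun ν hν => ?_
    rw [map_smul]
    exact Submodule.smul_mem _ _ (lowPart_mono ω (hmax ν hν) (hω.hasLeading_monR n p ν).1)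
  · rw [map_sum, map_sum, hT, Finset.sum_filter, Finset.mul_sum]
    refine Finset.sum_congr rfl fun ν hν => ?_
    rw [map_smul, map_smul, ← hγ]
    split_ifs with h
    · have h1 := (hω.hasLeading_monR n p ν).2
      obtain ⟨h3, h4, -⟩ := hTν ν (by rw [hT, Finset.mem_filter]; exact ⟨hν, h⟩)
      rw [h] at h1
      rw [h1, h3, h4, mul_smul_comm]
    · rw [component_eq_zero_of_lt (lt_of_le_of_ne (hmax ν hν) h) (hω.hasLeading_monR n p ν).1,
        smul_zero, mul_zero]

/-- The coordinate ring of the leading part of the equation, inside the Laurent polynomials. -/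
noncomputable def leadingRing (k : Type*) [Field k] {m : ℕ} (q r : ℕ) (n : Fin (m + 1) → ℕ) :
    Subalgebra k (Laurent k m) :=
  Algebra.adjoin k (Set.range (xL k) ∪ {yTop k q r n, zL k m, tL k m})

theorem xL_mem_leadingRing (q r : ℕ) (i : Fin (m + 1)) : xL k i ∈ leadingRing k q r n :=
  Algebra.subset_adjoin (Or.inl ⟨i, rfl⟩)

theorem xMon_mem_leadingRing (q r : ℕ) (a : Fin (m + 1) → ℕ) :
    xMon k (fun i => (a i : ℤ)) ∈ leadingRing k q r n := by
  rw [← prod_xL_pow]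
  exact prod_mem fun i _ => pow_mem (xL_mem_leadingRing n q r i) _

theorem yTop_mem_leadingRing (q r : ℕ) : yTop k q r n ∈ leadingRing k q r n :=
  Algebra.subset_adjoin (Or.inr (by simp))

theorem zL_mem_leadingRing (q r : ℕ) : zL k m ∈ leadingRing k q r n :=
  Algebra.subset_adjoin (Or.inr (by simp))

theorem tL_mem_leadingRing (q r : ℕ) : tL k m ∈ leadingRing k q r n :=
  Algebra.subset_adjoin (Or.inr (by simp))

theorem ztMon_mem_leadingRing (q r b c : ℕ) :
    ztMon k (b : ℤ) (c : ℤ) ∈ leadingRing k q r n := by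
  rw [ztMon_natCast]
  exact mul_mem (pow_mem (zL_mem_leadingRing n q r) _) (pow_mem (tL_mem_leadingRing n q r) _)

theorem ztForms_le_leadingRing (q r w : ℕ) :
    ztForms k m q r w ≤ Subalgebra.toSubmodule (leadingRing k q r n) := by
  rw [ztForms, Submodule.span_le]
  rintro _ ⟨bc, -, rfl⟩
  exact ztMon_mem_leadingRing n q r _ _

theorem IsAdmissible.exists_leading (hω : IsAdmissible ω q r) (hq : q ≠ 0)
    {s : R q r m n p} (hs : s ≠ 0) :
    ∃ γ f, HasLeading ω γ (toLaurent q r n p s) f ∧ f ≠ 0 ∧ f ∈ leadingRing k q r n := by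
  obtain ⟨c, hc, rfl⟩ := exists_normalForm q r n p s
  have hc0 : c ≠ 0 := by rintro rfl; simp at hs
  obtain ⟨ν, -, -, w, h, hh, h0, hL⟩ := hω.exists_leading_normalForm n p hc hc0
  refine ⟨_, _, hL, ?_, ?_⟩
  · exact mul_ne_zero (mul_ne_zero (xMon_ne_zero k _) (pow_ne_zero _ (yTop_ne_zero k n hq))) h0
  · exact mul_mem (mul_mem (xMon_mem_leadingRing n q r _) (pow_mem (yTop_mem_leadingRing n q r) _))
      (ztForms_le_leadingRing n q r w hh)

end Leading

/-! ### The leading derivation -/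

section LeadingDerivation

variable {k Γ : Type*} [Field k] [AddCommGroup Γ] [LinearOrder Γ] {m : ℕ}

theorem component_component_of_ne {G : Type*} [AddCommGroup G] (ω : G →+ Γ) {γ γ' : Γ}
    (h : γ ≠ γ') (f : AddMonoidAlgebra k G) : component ω γ (component ω γ' f) = 0 := by
  apply AddMonoidAlgebra.coeff_injective
  ext g
  rw [coeff_component, coeff_component, Finsupp.filter_apply, Finsupp.filter_apply]
  split_ifs with h1 h2
  · exact absurd (h1.symm.trans h2) h
  · rfl
  · rfl

theorem exponent_eq_sum (g : Exponent m) :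
    g = ∑ i, g.1 i • ((Pi.single i 1, 0, 0) : Exponent m) + g.2.1 • ((0, 1, 0) : Exponent m) +
      g.2.2 • ((0, 0, 1) : Exponent m) := by
  refine Prod.ext ?_ (Prod.ext ?_ ?_)
  · ext i
    simp [Prod.fst_sum, Finset.sum_apply, Pi.single_apply]
  · simp [Prod.snd_sum]
  · simp [Prod.snd_sum]

/-- A nonzero derivation of the Laurent polynomial ring has a leading degree. -/
theorem exists_leading_degree (ω : Exponent m →+ Γ) {c : Exponent m →+ Laurent k m} (hc : c ≠ 0) :
    ∃ δ, (∀ g, c g ∈ lowPart k ω δ) ∧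
      ((∃ i, component ω δ (c (Pi.single i 1, 0, 0)) ≠ 0) ∨
        component ω δ (c (0, 1, 0)) ≠ 0 ∨ component ω δ (c (0, 0, 1)) ≠ 0) := by
  classical
  let S : Finset (Exponent m) :=
    (Finset.univ.biUnion fun i => (c (Pi.single i 1, 0, 0)).coeff.support) ∪
      ((c (0, 1, 0)).coeff.support ∪ (c (0, 0, 1)).coeff.support)
  have hS : ∀ g, g ∈ S ↔ (∃ i, (c (Pi.single i 1, 0, 0)).coeff g ≠ 0) ∨
      (c (0, 1, 0)).coeff g ≠ 0 ∨ (c (0, 0, 1)).coeff g ≠ 0 := by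
    intro g
    simp [S]
  have hne : S.Nonempty := by
    by_contra h
    rw [Finset.not_nonempty_iff_eq_empty] at h
    have h0 : ∀ g, ¬ (_ ∨ _) := fun g hg => Finset.notMem_empty g (h ▸ (hS g).mpr hg)
    push Not at h0
    refine hc (AddMonoidHom.ext fun g => ?_)
    have hx : ∀ i, c (Pi.single i 1, 0, 0) = 0 := fun i =>
      AddMonoidAlgebra.coeff_injective (Finsupp.ext fun g => (h0 g).1 i)
    have hz : c (0, 1, 0) = 0 :=
      AddMonoidAlgebra.coeff_injective (Finsupp.ext fun g => (h0 g).2.1)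
    have ht : c (0, 0, 1) = 0 :=
      AddMonoidAlgebra.coeff_injective (Finsupp.ext fun g => (h0 g).2.2)
    rw [exponent_eq_sum g, map_add, map_add, map_sum]
    simp only [map_zsmul, hx, hz, ht, smul_zero, Finset.sum_const_zero, add_zero]
    rfl
  obtain ⟨g₀, hg₀, hmax⟩ := S.exists_max_image ω hne
  have hcomp : ∀ f : Laurent k m, f.coeff g₀ ≠ 0 → component ω (ω g₀) f ≠ 0 := by
    intro f hf h
    have h1 : (component ω (ω g₀) f).coeff g₀ = f.coeff g₀ := by
      rw [coeff_component, Finsupp.filter_apply, if_pos rfl]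
    rw [h] at h1
    exact hf h1.symm
  refine ⟨ω g₀, fun g => ?_, ?_⟩
  · rw [exponent_eq_sum g, map_add, map_add, map_sum]
    simp only [map_zsmul]
    refine add_mem (add_mem (sum_mem fun i _ => zsmul_mem ?_ _) (zsmul_mem ?_ _)) (zsmul_mem ?_ _)
    · exact mem_lowPart.mpr fun g hg => hmax g ((hS g).mpr (Or.inl ⟨i, hg⟩))
    · exact mem_lowPart.mpr fun g hg => hmax g ((hS g).mpr (Or.inr (Or.inl hg)))
    · exact mem_lowPart.mpr fun g hg => hmax g ((hS g).mpr (Or.inr (Or.inr hg)))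
  · rcases (hS g₀).mp hg₀ with ⟨i, hi⟩ | h | h
    · exact Or.inl ⟨i, hcomp _ hi⟩
    · exact Or.inr (Or.inl (hcomp _ h))
    · exact Or.inr (Or.inr (hcomp _ h))

variable [IsOrderedAddMonoid Γ] {ω : Exponent m →+ Γ} {q r : ℕ} (n : Fin (m + 1) → ℕ)

theorem yL_zero : yL q r n (0 : Polynomial k) = yTop k q r n := by
  simp [yL, yTop, pL]

/-- The leading ring is the image of the coordinate ring for `p = 0`, so that it has normal forms
too. -/
theorem mem_range_toLaurent_of_mem_leadingRing {f : Laurent k m} (hf : f ∈ leadingRing k q r n) :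
    ∃ s, toLaurent q r n (0 : Polynomial k) s = f := by
  have hle : leadingRing k q r n ≤ (toLaurent q r n (0 : Polynomial k)).range := by
    rw [leadingRing, Algebra.adjoin_le_iff]
    rintro _ (⟨i, rfl⟩ | rfl | rfl | rfl)
    · exact ⟨_, toLaurent_coord q r n 0 (.x i)⟩
    · exact ⟨_, (toLaurent_coord q r n 0 .y).trans (yL_zero n)⟩
    · exact ⟨_, toLaurent_coord q r n 0 .z⟩
    · exact ⟨_, toLaurent_coord q r n 0 .t⟩
  exact hle hf

theorem IsAdmissible.component_mem_leadingRing (hω : IsAdmissible ω q r) {f : Laurent k m}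
    (hf : f ∈ leadingRing k q r n) (γ : Γ) : component ω γ f ∈ leadingRing k q r n := by
  obtain ⟨s, rfl⟩ := mem_range_toLaurent_of_mem_leadingRing n hf
  obtain ⟨c, -, rfl⟩ := exists_normalForm q r n 0 s
  rw [map_sum, map_sum]
  refine sum_mem fun ν _ => ?_
  rw [map_smul, map_smul]
  refine Subalgebra.smul_mem _ ?_ _
  have h1 := hω.hasLeading_monR (k := k) n 0 ν
  have h2 : component ω (ω (topExponent n q ν)) (toLaurent q r n 0 (monR q r n (0 : k[X]) ν)) =
      toLaurent q r n 0 (monR q r n (0 : k[X]) ν) := by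
    rw [h1.2, toLaurent_monR, yL_zero]
  by_cases h : γ = ω (topExponent n q ν)
  · rw [h, h1.2]
    exact mul_mem (mul_mem (xMon_mem_leadingRing n q r _) (pow_mem (yTop_mem_leadingRing n q r) _))
      (ztMon_mem_leadingRing n q r _ _)
  · rw [← h2, component_component_of_ne ω h]
    exact zero_mem _

/-- Homogeneous elements of the leading ring are monomials in the `x_i` and `yTop` times a
weighted form in `z` and `t`. -/
theorem IsAdmissible.eq_mul_of_component_eq (hω : IsAdmissible ω q r) (hq : q ≠ 0)
    {f : Laurent k m}
    (hf : f ∈ leadingRing k q r n) {γ : Γ} (hγ : component ω γ f = f) (hf0 : f ≠ 0) :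
    ∃ (a : Fin (m + 1) → ℕ) (j w : ℕ), ∃ h ∈ ztForms k m q r w,
      f = xMon k (fun i => (a i : ℤ)) * yTop k q r n ^ j * h := by
  obtain ⟨s, rfl⟩ := mem_range_toLaurent_of_mem_leadingRing n hf
  obtain ⟨c, hc, rfl⟩ := exists_normalForm q r n 0 s
  have hc0 : c ≠ 0 := by rintro rfl; simp at hf0
  obtain ⟨ν, -, -, w, h, hh, h0, hL⟩ := hω.exists_leading_normalForm n 0 hc hc0
  refine ⟨ν.1, ν.2.1, w, h, hh, ?_⟩
  rw [← hL.2]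
  by_cases hν : ω (topExponent n q ν) = γ
  · rw [hν, hγ]
  · have hq0 := component_component_of_ne ω hν (toLaurent q r n 0
      (∑ ν ∈ c.support, c ν • monR q r n (0 : k[X]) ν))
    rw [hγ, hL.2] at hq0
    exact absurd hq0 (mul_ne_zero (mul_ne_zero (xMon_ne_zero k _)
      (pow_ne_zero _ (yTop_ne_zero k n hq))) h0)

/-- The leading component of an element of the coordinate ring lies in the leading ring. -/
theorem IsAdmissible.component_toLaurent_mem (hω : IsAdmissible ω q r) (hq : q ≠ 0)
    (p : Polynomial k) {γ : Γ} (s : R q r m n p)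
    (hs : toLaurent q r n p s ∈ lowPart k ω γ) :
    component ω γ (toLaurent q r n p s) ∈ leadingRing k q r n := by
  by_cases hs0 : s = 0
  · rw [hs0, map_zero, map_zero]; exact zero_mem _
  · obtain ⟨γ', f, hL, hf0, hf⟩ := hω.exists_leading n p hq hs0
    rcases lt_trichotomy γ γ' with h | h | h
    · exact absurd (hL.2.symm.trans (component_eq_zero_of_lt h hs)) hf0
    · rw [h, hL.2]; exact hf
    · rw [component_eq_zero_of_lt h hL.1]; exact zero_mem _

/-- A locally nilpotent derivation of the coordinate ring, extended to Laurent polynomials as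
`logDer c`, has a nonzero homogeneous leading part, which is locally nilpotent on the leading
ring. -/
theorem IsAdmissible.exists_leadingDerivation (hω : IsAdmissible ω q r) (hq : q ≠ 0)
    (p : Polynomial k) {c : Exponent m →+ Laurent k m} (hc : c ≠ 0)
    (hmap : ∀ f ∈ (toLaurent q r n p).range, logDer c f ∈ (toLaurent q r n p).range)
    (hnil : (toLaurent q r n p).range ≤ nilpotentPart (logDer c)) :
    ∃ (δ : Γ) (D : Derivation k (Laurent k m) (Laurent k m)),
      (∀ γ f, D (component ω γ f) = component ω (γ + δ) (D f)) ∧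
      (∀ f ∈ leadingRing k q r n, D f ∈ leadingRing k q r n) ∧
      leadingRing k q r n ≤ nilpotentPart D ∧
      (∃ f ∈ leadingRing k q r n, D f ≠ 0) ∧
      ∀ γ f, logDer c f = 0 → f ∈ lowPart k ω γ → D (component ω γ f) = 0 := by
  obtain ⟨δ, hδ, hne⟩ := exists_leading_degree ω hc
  have hgen : ∀ v : Var m, ∃ γ, HasLeading ω γ (varL q r n p v) (varL q r n 0 v) := by
    intro v
    cases v with
    | x i => exact ⟨_, hasLeading_single rfl 1⟩
    | y => exact ⟨_, by rw [varL, varL, yL_zero]; exact hω.hasLeading_yL n p⟩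
    | z => exact ⟨_, hasLeading_single rfl 1⟩
    | t => exact ⟨_, hasLeading_single rfl 1⟩
  have hrange : ∀ v, varL q r n p v ∈ (toLaurent q r n p).range :=
    fun v => ⟨_, toLaurent_coord q r n p v⟩
  have hadj : leadingRing k q r n = Algebra.adjoin k (Set.range (varL q r n (0 : k[X]))) := by
    rw [leadingRing]
    congr 1
    ext f
    constructor
    · rintro (⟨i, rfl⟩ | rfl | rfl | rfl)
      · exact ⟨.x i, rfl⟩
      · exact ⟨.y, yL_zero n⟩
      · exact ⟨.z, rfl⟩
      · exact ⟨.t, rfl⟩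
    · rintro ⟨v, rfl⟩
      cases v with
      | x i => exact Or.inl ⟨i, rfl⟩
      | y => exact Or.inr (Or.inl (yL_zero n))
      | z => exact Or.inr (Or.inr (Or.inl rfl))
      | t => exact Or.inr (Or.inr (Or.inr rfl))
  refine ⟨δ, derComponent ω δ c, fun γ f => derComponent_component ω δ γ c f, ?_, ?_, ?_, ?_⟩
  · intro f hf
    have hf' := hf
    rw [hadj] at hf'
    clear hf
    induction hf' using Algebra.adjoin_induction with
    | mem f hv =>
      obtain ⟨v, rfl⟩ := hv
      obtain ⟨γ, h1⟩ := hgen v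
      rw [← h1.2, ← component_logDer hδ h1.1]
      obtain ⟨s, hs⟩ := hmap _ (hrange v)
      have h2 := logDer_mem_lowPart hδ h1.1
      rw [← hs] at h2 ⊢
      exact hω.component_toLaurent_mem n hq p s h2
    | algebraMap a => rw [Derivation.map_algebraMap]; exact zero_mem _
    | add f g hf hg h1 h2 =>
      rw [map_add]
      exact add_mem h1 h2
    | mul f g hf hg h1 h2 =>
      rw [← hadj] at hf hg
      rw [Derivation.leibniz]
      exact add_mem (mul_mem hf h2) (mul_mem hg h1)
  · rw [hadj, Algebra.adjoin_le_iff]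
    rintro _ ⟨v, rfl⟩
    obtain ⟨γ, h1⟩ := hgen v
    rw [← h1.2]
    exact component_mem_nilpotentPart hδ h1.1 (hnil (hrange v))
  · rcases hne with ⟨i, h⟩ | h | h
    · refine ⟨xL k i, xL_mem_leadingRing n q r i, ?_⟩
      change derComponent ω δ c (AddMonoidAlgebra.single _ 1) ≠ 0
      rw [derComponent_single]
      exact mul_ne_zero (xMon_ne_zero k _) h
    · refine ⟨zL k m, zL_mem_leadingRing n q r, ?_⟩
      change derComponent ω δ c (AddMonoidAlgebra.single _ 1) ≠ 0
      rw [derComponent_single]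
      exact mul_ne_zero (ztMon_ne_zero k _ _) h
    · refine ⟨tL k m, tL_mem_leadingRing n q r, ?_⟩
      change derComponent ω δ c (AddMonoidAlgebra.single _ 1) ≠ 0
      rw [derComponent_single]
      exact mul_ne_zero (ztMon_ne_zero k _ _) h
  · intro γ f hf hγ
    rw [← component_logDer hδ hγ, hf, map_zero]

end LeadingDerivation

/-! ### Constants of locally nilpotent derivations -/

section Constants

variable {k B : Type*} [Field k] [CharZero k] [CommRing B] [IsDomain B] [Algebra k B]

omit [CharZero k] [Algebra k B] in
theorem algebraMap_algClosure_injective :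
    Function.Injective (algebraMap B (AlgebraicClosure (FractionRing B))) := by
  rw [IsScalarTower.algebraMap_eq B (FractionRing B) (AlgebraicClosure (FractionRing B))]
  exact (algebraMap (FractionRing B) (AlgebraicClosure (FractionRing B))).injective.comp
    (IsFractionRing.injective B (FractionRing B))

/-- The exponential of a derivation, with coefficients in an algebraically closed field. -/
theorem exists_expHom_algClosed (D : Derivation k B B) :
    ∃ φ : nilpotentPart D →+* (AlgebraicClosure (FractionRing B))[X],
      (∀ a, (φ a).coeff 0 = algebraMap B (AlgebraicClosure (FractionRing B)) a) ∧
      (∀ a, (φ a).natDegree = 0 ↔ D a = 0) ∧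
      ∀ a : nilpotentPart D, D a = 0 →
        φ a = C (algebraMap B (AlgebraicClosure (FractionRing B)) a) := by
  obtain ⟨φ, h0, h1⟩ := exists_expHom D (AlgebraicClosure (FractionRing B))
    (algebraMap_algClosure_injective)
  refine ⟨φ, h0, h1, fun a ha => ?_⟩
  rw [eq_C_of_natDegree_eq_zero ((h1 a).mpr ha), h0]

/-- The ring of constants is factorially closed, because degrees of exponentials add up. -/
theorem apply_eq_zero_of_mul (D : Derivation k B B) {a b : B} (ha : a ∈ nilpotentPart D)
    (hb : b ∈ nilpotentPart D) (hab : a * b ≠ 0) (h : D (a * b) = 0) : D a = 0 ∧ D b = 0 := by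
  obtain ⟨φ, h0, h1, -⟩ := exists_expHom_algClosed D
  have hne : ∀ c : nilpotentPart D, (c : B) ≠ 0 → φ c ≠ 0 := by
    intro c hc hφ
    have := h0 c
    rw [hφ, coeff_zero, eq_comm, map_eq_zero_iff _ (algebraMap_algClosure_injective)] at this
    exact hc this
  have hd := (h1 (⟨a, ha⟩ * ⟨b, hb⟩)).mpr h
  rw [map_mul, natDegree_mul (hne _ (left_ne_zero_of_mul hab)) (hne _ (right_ne_zero_of_mul hab))]
    at hd
  exact ⟨(h1 ⟨a, ha⟩).mp (by omega), (h1 ⟨b, hb⟩).mp (by omega)⟩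

theorem apply_eq_zero_of_pow (D : Derivation k B B) {a : B} (ha : a ∈ nilpotentPart D) (h0 : a ≠ 0)
    {l : ℕ} (hl : l ≠ 0) (h : D (a ^ l) = 0) : D a = 0 := by
  obtain ⟨l, rfl⟩ := Nat.exists_eq_succ_of_ne_zero hl
  rw [Nat.succ_eq_add_one, pow_succ'] at h
  exact (apply_eq_zero_of_mul D ha (pow_mem ha l) (mul_ne_zero h0 (pow_ne_zero _ h0)) h).1

omit [CharZero k] [IsDomain B] in
theorem apply_mul_eq_zero {D : Derivation k B B} {a b : B} (ha : D a = 0) (hb : D b = 0) :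
    D (a * b) = 0 := by rw [D.leibniz, ha, hb]; simp

omit [CharZero k] [IsDomain B] in
theorem apply_pow_eq_zero {D : Derivation k B B} {a : B} (ha : D a = 0) (l : ℕ) :
    D (a ^ l) = 0 := by rw [D.leibniz_pow, ha]; simp

/-- If `c * a ^ i + d * b ^ j` is a nonzero constant with constants `c`, `d` and `i, j ≥ 2`, then
`a` and `b` are constants. -/
theorem apply_eq_zero_of_pow_add_pow (D : Derivation k B B) {a b c d : B}
    (ha : a ∈ nilpotentPart D) (hb : b ∈ nilpotentPart D) (hc : D c = 0) (hd : D d = 0)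
    (hc0 : c ≠ 0) (hd0 : d ≠ 0) {i j : ℕ} (hi : 2 ≤ i) (hj : 2 ≤ j)
    (h : D (c * a ^ i + d * b ^ j) = 0) (hne : c * a ^ i + d * b ^ j ≠ 0) :
    D a = 0 ∧ D b = 0 := by
  have hchar : CharZero B := charZero_of_injective_algebraMap (algebraMap k B).injective
  have hinj : Function.Injective (algebraMap B (AlgebraicClosure (FractionRing B))) :=
    algebraMap_algClosure_injective
  have hchar' : CharZero (AlgebraicClosure (FractionRing B)) :=
    charZero_of_injective_algebraMap hinj
  have hz : ∀ x : B, x ≠ 0 → algebraMap B (AlgebraicClosure (FractionRing B)) x ≠ 0 :=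
    fun x hx => (map_ne_zero_iff _ hinj).mpr hx
  obtain ⟨φ, h0, h1, h2⟩ := exists_expHom_algClosed D
  have hc' := mem_nilpotentPart_of_apply_eq_zero hc
  have hd' := mem_nilpotentPart_of_apply_eq_zero hd
  have key := h2 (⟨c, hc'⟩ * ⟨a, ha⟩ ^ i + ⟨d, hd'⟩ * ⟨b, hb⟩ ^ j) h
  rw [map_add, map_mul, map_mul, map_pow, map_pow, h2 ⟨c, hc'⟩ hc, h2 ⟨d, hd'⟩ hd] at key
  obtain ⟨h3, h4⟩ := natDegree_eq_zero_of_pow_add_pow hi hj (hz _ hc0) (hz _ hd0) (hz _ hne) key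
  exact ⟨(h1 _).mp h3, (h1 _).mp h4⟩

omit [CharZero k] in
/-- A root `ρ` of `P` gives the linear factor `U - ρ * V` of the binary form of `P`. -/
theorem sub_dvd_aeval_homogenize {P : k[X]} {l : ℕ} (hl : P.natDegree ≤ l) (hP : P ≠ 0) {ρ : k}
    (hρ : P.IsRoot ρ) (U V : k[X]) :
    U - C ρ * V ∣ MvPolynomial.aeval ![U, V] (P.homogenize l) := by
  obtain ⟨Q, rfl⟩ := dvd_iff_isRoot.mpr hρ
  have hQ : Q ≠ 0 := right_ne_zero_of_mul hP
  rw [natDegree_mul (X_sub_C_ne_zero ρ) hQ, natDegree_X_sub_C] at hl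
  obtain ⟨l, rfl⟩ := Nat.exists_eq_add_of_le (le_trans (Nat.le_add_right 1 _) hl)
  rw [homogenize_mul _ _ (natDegree_X_sub_C_le ρ) (by omega), map_mul]
  refine dvd_mul_of_dvd_left (dvd_of_eq ?_) _
  rw [sub_eq_add_neg (Polynomial.X : k[X]), ← C_neg, homogenize_add, homogenize_X one_ne_zero,
    homogenize_C]
  simp [sub_eq_add_neg]

/-- If a binary form in `z ^ q` and `t ^ r` is a nonzero constant of `D` while `z` and `t` are not
both constants of `D`, then the form is a monomial: a factor `z ^ q - ρ * t ^ r` with `ρ ≠ 0` has a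
constant exponential, hence `z` and `t` have constant exponentials. -/
theorem eq_C_mul_X_pow_of_apply_homogenize (D : Derivation k B B) {z t : B}
    (hz : z ∈ nilpotentPart D) (ht : t ∈ nilpotentPart D) (hzt : ¬ (D z = 0 ∧ D t = 0))
    {q r : ℕ} (hq : 2 ≤ q) (hr : 2 ≤ r) {P : k[X]} {l : ℕ} (hl : P.natDegree ≤ l)
    (h : D (MvPolynomial.aeval ![z ^ q, t ^ r] (P.homogenize l)) = 0)
    (hne : MvPolynomial.aeval ![z ^ q, t ^ r] (P.homogenize l) ≠ 0) :
    ∃ c : k, ∃ e ≤ l, P = C c * Polynomial.X ^ e := by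
  have hP0 : P ≠ 0 := by rintro rfl; simp at hne
  have hinj : Function.Injective (algebraMap B (AlgebraicClosure (FractionRing B))) :=
    algebraMap_algClosure_injective
  obtain ⟨Q, hPQ, hQ⟩ := exists_eq_pow_rootMultiplicity_mul_and_not_dvd P hP0 0
  rw [C_0, sub_zero] at hPQ hQ
  set e := P.rootMultiplicity 0
  have hQ0 : Q ≠ 0 := by rintro rfl; simp at hQ
  by_cases hdeg : Q.natDegree = 0
  · refine ⟨Q.coeff 0, e, ?_, ?_⟩
    · rw [hPQ, natDegree_mul (pow_ne_zero _ X_ne_zero) hQ0, natDegree_X_pow] at hl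
      omega
    · rw [← eq_C_of_natDegree_eq_zero hdeg, mul_comm]
      exact hPQ
  · -- Otherwise the form has such a factor over an algebraically closed field.
    exfalso
    set κ : k →+* AlgebraicClosure (FractionRing B) :=
      (algebraMap B (AlgebraicClosure (FractionRing B))).comp (algebraMap k B) with hκ
    obtain ⟨φ, h0, h1, h2⟩ := exists_expHom_algClosed D
    obtain ⟨ρ, hρ⟩ := IsAlgClosed.exists_root (Q.map κ) (by
      rw [degree_map]
      exact fun h => hdeg (natDegree_eq_of_degree_eq_some h))
    have hρ0 : ρ ≠ 0 := by
      rintro rfl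
      rw [IsRoot.def, ← coeff_zero_eq_eval_zero, coeff_map, map_eq_zero] at hρ
      exact hQ (X_dvd_iff.mpr hρ)
    have hρP : (P.map κ).IsRoot ρ := by
      rw [hPQ, Polynomial.map_mul, IsRoot.def, eval_mul, hρ.eq_zero, mul_zero]
    have hdvd := sub_dvd_aeval_homogenize (l := l) (by rw [natDegree_map]; exact hl)
      ((Polynomial.map_ne_zero_iff κ.injective).mpr hP0) hρP (φ ⟨z, hz⟩ ^ q) (φ ⟨t, ht⟩ ^ r)
    set f : nilpotentPart D := MvPolynomial.aeval ![⟨z, hz⟩ ^ q, ⟨t, ht⟩ ^ r] (P.homogenize l)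
      with hf
    have hfval : (f : B) = MvPolynomial.aeval ![z ^ q, t ^ r] (P.homogenize l) := by
      have h3 := MvPolynomial.map_aeval (![⟨z, hz⟩ ^ q, ⟨t, ht⟩ ^ r] : Fin 2 → nilpotentPart D)
        (nilpotentPart D).val.toRingHom (P.homogenize l)
      rw [hf]
      refine h3.trans ?_
      rw [MvPolynomial.aeval_def]
      change MvPolynomial.eval₂ _ _ _ = MvPolynomial.eval₂ _ _ _
      congr 1
      funext i
      fin_cases i <;> rfl
    have hφf : φ f = MvPolynomial.aeval ![φ ⟨z, hz⟩ ^ q, φ ⟨t, ht⟩ ^ r]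
        ((P.map κ).homogenize l) := by
      rw [hf, homogenize_map, MvPolynomial.map_aeval, MvPolynomial.aeval_def,
        MvPolynomial.eval₂_map]
      change MvPolynomial.eval₂ _ _ _ = MvPolynomial.eval₂ _ _ _
      congr 1
      · ext c : 1
        exact h2 (algebraMap k _ c) (D.map_algebraMap c)
      · ext i : 1
        fin_cases i
        · exact map_pow φ ⟨z, hz⟩ q
        · exact map_pow φ ⟨t, ht⟩ r
    rw [← hφf, h2 f (by rw [hfval]; exact h)] at hdvd
    have hu : IsUnit (φ ⟨z, hz⟩ ^ q - C ρ * φ ⟨t, ht⟩ ^ r) := by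
      refine isUnit_of_dvd_unit hdvd (isUnit_C.mpr (IsUnit.mk0 _ ?_))
      rw [map_ne_zero_iff _ hinj, hfval]
      exact hne
    obtain ⟨ε, hε, hεeq⟩ := Polynomial.isUnit_iff.mp hu
    have hchar : CharZero B := charZero_of_injective_algebraMap (algebraMap k B).injective
    have hchar' : CharZero (AlgebraicClosure (FractionRing B)) :=
      charZero_of_injective_algebraMap hinj
    obtain ⟨h3, h4⟩ := natDegree_eq_zero_of_pow_add_pow (P := φ ⟨z, hz⟩) (Q := φ ⟨t, ht⟩) hq hr
      (one_ne_zero' (AlgebraicClosure (FractionRing B))) (neg_ne_zero.mpr hρ0)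
      hε.ne_zero (by rw [hεeq, C_1, C_neg]; ring)
    exact hzt ⟨(h1 _).mp h3, (h1 _).mp h4⟩

end Constants

/-! ### Transcendence degree of the ring of constants -/

section Rank

variable (k : Type*) [Field k] (m : ℕ)

/-- The family `x_0, …, x_m, z, t`. -/
noncomputable def xztL : Fin (m + 1) ⊕ Fin 2 → Laurent k m := Sum.elim (xL k) ![zL k m, tL k m]

theorem aeval_xztL_monomial (s : Fin (m + 1) ⊕ Fin 2 →₀ ℕ) (c : k) :
    MvPolynomial.aeval (xztL k m) (MvPolynomial.monomial s c) =
      AddMonoidAlgebra.single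
        ((fun i => (s (.inl i) : ℤ)), (s (.inr 0) : ℤ), (s (.inr 1) : ℤ)) c := by
  rw [MvPolynomial.aeval_monomial, Finsupp.prod_fintype _ _ (fun _ => pow_zero _),
    Fintype.prod_sum_type]
  simp only [xztL, Sum.elim_inl, Sum.elim_inr, Fin.prod_univ_two, Matrix.cons_val_zero,
    Matrix.cons_val_one]
  rw [prod_xL_pow, ← ztMon_natCast, xMon_mul_ztMon, ← Algebra.smul_def,
    AddMonoidAlgebra.smul_single', mul_one]

theorem algebraicIndependent_xztL : AlgebraicIndependent k (xztL k m) := by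
  rw [algebraicIndependent_iff_injective_aeval, injective_iff_map_eq_zero]
  intro P hP
  by_contra h0
  obtain ⟨s₀, hs₀⟩ := MvPolynomial.ne_zero_iff.mp h0
  rw [P.as_sum, map_sum] at hP
  have h1 := congrArg (fun f => f.coeff
    ((fun i => (s₀ (.inl i) : ℤ)), (s₀ (.inr 0) : ℤ), (s₀ (.inr 1) : ℤ))) hP
  simp only [aeval_xztL_monomial, AddMonoidAlgebra.coeff_sum, Finsupp.finsetSum_apply,
    AddMonoidAlgebra.coeff_single, AddMonoidAlgebra.coeff_zero, Finsupp.zero_apply] at h1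
  rw [Finset.sum_eq_single s₀] at h1
  · rw [Finsupp.single_eq_same] at h1
    exact hs₀ h1
  · intro s _ hne
    refine Finsupp.single_eq_of_ne fun h => hne ?_
    rw [Prod.mk.injEq, Prod.mk.injEq, Nat.cast_inj, Nat.cast_inj] at h
    ext (i | i)
    · exact_mod_cast (congrFun h.1 i).symm
    · fin_cases i
      · exact h.2.1.symm
      · exact h.2.2.symm
  · intro h
    exact absurd (MvPolynomial.mem_support_iff.mpr hs₀) h

theorem le_encard_of_subset_closure {E : Set (Laurent k m)}
    (h : Set.range (xztL k m) ⊆ (AlgebraicIndependent.matroid k (Laurent k m)).closure E) :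
    ((m + 3 : ℕ) : ℕ∞) ≤ E.encard := by
  have hind : (AlgebraicIndependent.matroid k (Laurent k m)).Indep (Set.range (xztL k m)) := by
    rw [AlgebraicIndependent.matroid_indep_iff]
    exact AlgebraicIndependent.coe_range (algebraicIndependent_xztL k m)
  have h1 := hind.encard_le_eRk_of_subset h
  rw [Matroid.eRk_closure_eq] at h1
  have h2 : (Set.range (xztL k m)).encard = ((m + 3 : ℕ) : ℕ∞) := by
    rw [← Set.image_univ, (algebraicIndependent_xztL k m).injective.encard_image,
      Set.encard_univ, ENat.card_eq_coe_fintype_card]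
    simp
    ring
  rw [← h2]
  exact h1.trans (Matroid.eRk_le_encard _ _)

variable {k m} [CharZero k]

/-- If a ring `A` containing `x_0, …, x_m, z, t` has a nonzero locally nilpotent derivation with
constants in `k[T]`, then `T` together with a local slice has full transcendence degree `m + 3`.
The set `T` is bounded by a set `I` of indices of variables `x_i` and a set `E` of further
elements. -/
theorem le_card_of_constants_le_adjoin (D : Derivation k (Laurent k m) (Laurent k m))
    {A : Subalgebra k (Laurent k m)} (hgen : ∀ v, xztL k m v ∈ A) (hmap : ∀ f ∈ A, D f ∈ A)
    (hnil : A ≤ nilpotentPart D) (hne : ∃ f ∈ A, D f ≠ 0) {T : Set (Laurent k m)}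
    (hT : ∀ f ∈ A, D f = 0 → f ∈ Algebra.adjoin k T) (I : Finset (Fin (m + 1)))
    (E : Finset (Laurent k m)) (hTE : T ⊆ xL k '' I ∪ E) : m + 2 ≤ I.card + E.card := by
  classical
  obtain ⟨f, hf, hDf⟩ := hne
  obtain ⟨s, hsA, hs, hs2⟩ := exists_slice D hmap hf (hnil hf) hDf
  have hcl : Set.range (xztL k m) ⊆
      (AlgebraicIndependent.matroid k (Laurent k m)).closure (T ∪ {s}) := by
    rintro _ ⟨v, rfl⟩
    rw [AlgebraicIndependent.matroid_closure_eq, SetLike.mem_coe,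
      Subalgebra.mem_algebraicClosure]
    obtain ⟨u, huA, hu, hu0, hmem⟩ := exists_mul_mem_adjoin_slice D A hmap hsA hs hs2 (hgen v)
      (hnil (hgen v))
    have hle : Algebra.adjoin k ({f | f ∈ A ∧ D f = 0} ∪ {s}) ≤ Algebra.adjoin k (T ∪ {s}) := by
      rw [Algebra.adjoin_le_iff]
      rintro g (⟨hgA, hg⟩ | rfl)
      · exact Algebra.adjoin_mono Set.subset_union_left (hT g hgA hg)
      · exact Algebra.subset_adjoin (Or.inr rfl)
    have hmem' := hle hmem
    have hu' : u ∈ Algebra.adjoin k (T ∪ {s}) :=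
      Algebra.adjoin_mono Set.subset_union_left (hT u huA hu)
    exact IsAlgebraic.of_mul (mem_nonZeroDivisors_of_ne_zero hu0)
      (isAlgebraic_algebraMap (⟨u, hu'⟩ : Algebra.adjoin k (T ∪ {s})))
      (isAlgebraic_algebraMap (⟨_, hmem'⟩ : Algebra.adjoin k (T ∪ {s})))
  have h1 := le_encard_of_subset_closure k m hcl
  have h2 : (T ∪ {s}).encard ≤ ((I.card + E.card + 1 : ℕ) : ℕ∞) := by
    have h3 : T ∪ {s} ⊆
        ((I.image (xL k) ∪ E ∪ {s} : Finset (Laurent k m)) : Set (Laurent k m)) := by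
      rw [Finset.coe_union, Finset.coe_union, Finset.coe_image, Finset.coe_singleton]
      exact Set.union_subset_union_left _ hTE
    refine (Set.encard_le_encard h3).trans ?_
    rw [Set.encard_coe_eq_coe_finsetCard]
    refine Nat.cast_le.mpr ?_
    refine (Finset.card_union_le _ _).trans ?_
    rw [Finset.card_singleton]
    have h4 := Finset.card_union_le (I.image (xL k)) E
    have h5 : (I.image (xL k)).card ≤ I.card := Finset.card_image_le
    omega
  have h6 := h1.trans h2
  rw [Nat.cast_le] at h6
  omega

end Rank

/-! ### The leading derivation does not annihilate the leading part of `y` -/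

section Core

variable {k Γ : Type*} [Field k] [AddCommGroup Γ] [LinearOrder Γ] {m : ℕ}

/-- As `q` and `r` are coprime, a weighted form in `z` and `t` is a monomial times a binary form in
`z ^ q` and `t ^ r`. -/
theorem exists_homogenize_of_mem_ztForms {q r : ℕ} (hq : q ≠ 0) (hr : r ≠ 0)
    (hqr : Nat.Coprime q r) {w : ℕ} {h : Laurent k m} (hh : h ∈ ztForms k m q r w) :
    ∃ (b c l : ℕ) (P : k[X]), P.natDegree ≤ l ∧ h = zL k m ^ b * tL k m ^ c *
      MvPolynomial.aeval ![zL k m ^ q, tL k m ^ r] (P.homogenize l) := by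
  by_cases hw : ∃ b c, r * b + q * c = w
  · obtain ⟨b₁, c₁, hbc⟩ := hw
    -- All exponents of `z` in the form are congruent modulo `q`, and `b` is the least possible one.
    set b := b₁ % q with hb
    set C := c₁ + r * (b₁ / q) with hC
    have hw2 : r * b + q * C = w := by
      have := Nat.mod_add_div b₁ q
      rw [← hbc, hC, hb]
      nth_rewrite 3 [← this]
      ring
    have hCr := Nat.mod_add_div C r
    refine ⟨b, C % r, C / r, ?_⟩
    refine Submodule.span_induction ?_ ?_ ?_ ?_ hh
    · rintro _ ⟨⟨b', c'⟩, hbc', rfl⟩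
      change r * b' + q * c' = w at hbc'
      have hblt : b < q := Nat.mod_lt _ (Nat.pos_of_ne_zero hq)
      have hclt : C % r < r := Nat.mod_lt _ (Nat.pos_of_ne_zero hr)
      have hmod : b' ≡ b [MOD q] := by
        have h1 : r * b' ≡ r * b [MOD q] := by
          have h2 : r * b' + q * c' ≡ r * b + q * C [MOD q] := by rw [hbc', hw2]
          simpa [Nat.ModEq, Nat.add_mul_mod_self_left] using h2
        exact Nat.ModEq.cancel_left_of_coprime hqr h1
      have hble : b ≤ b' := by
        have h3 : b' % q = b := by
          rw [hmod, Nat.mod_eq_of_lt hblt]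
        rw [← h3]
        exact Nat.mod_le _ _
      obtain ⟨j, hj⟩ := (Nat.modEq_iff_dvd' hble).mp hmod.symm
      have hb' : b' = b + q * j := by omega
      have hc' : c' + r * j = C := by
        have h4 : q * (c' + r * j) = q * C := by
          have h5 : r * (b + q * j) + q * c' = r * b + q * C := by rw [← hb', hbc', hw2]
          nlinarith
        exact Nat.eq_of_mul_eq_mul_left (Nat.pos_of_ne_zero hq) h4
      have hjl : j ≤ C / r := by
        rw [Nat.le_div_iff_mul_le (Nat.pos_of_ne_zero hr)]
        nlinarith
      have hc'' : c' = C % r + r * (C / r - j) := by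
        obtain ⟨i, hi⟩ := Nat.exists_eq_add_of_le hjl
        rw [hi] at hCr ⊢
        rw [Nat.add_sub_cancel_left]
        nlinarith
      refine ⟨Polynomial.X ^ j, (natDegree_X_pow_le j).trans hjl, ?_⟩
      rw [homogenize_X_pow hjl, map_mul, map_pow, map_pow, MvPolynomial.aeval_X,
        MvPolynomial.aeval_X]
      simp only [Matrix.cons_val_zero, Matrix.cons_val_one]
      rw [ztMon_natCast, hb', hc'']
      ring
    · exact ⟨0, by simp, by simp⟩
    · rintro x y - - ⟨P, hP, rfl⟩ ⟨Q, hQ, rfl⟩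
      exact ⟨P + Q, (natDegree_add_le _ _).trans (max_le hP hQ), by
        rw [homogenize_add, map_add, mul_add]⟩
    · rintro a x - ⟨P, hP, rfl⟩
      exact ⟨a • P, (natDegree_smul_le _ _).trans hP, by
        rw [homogenize_smul, map_smul, mul_smul_comm]⟩
  · refine ⟨0, 0, 0, 0, by simp, ?_⟩
    have : {bc : ℕ × ℕ | r * bc.1 + q * bc.2 = w} = ∅ := by
      ext bc
      exact iff_of_false (fun h => hw ⟨_, _, h⟩) id
    rw [ztForms, this, Set.image_empty, Submodule.span_empty] at hh
    rw [(Submodule.mem_bot k).mp hh]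
    simp

variable [IsOrderedAddMonoid Γ] {ω : Exponent m →+ Γ} {q r : ℕ} {n : Fin (m + 1) → ℕ} [CharZero k]

/-- If a nonzero derivation `D` is homogeneous and locally nilpotent on the leading ring and
annihilates `yTop`, then its constants are generated by the variables that it annihilates, since
all factors of a homogeneous constant are constants. -/
theorem constants_le_adjoin (hω : IsAdmissible ω q r) (hq : 2 ≤ q) (hr : 2 ≤ r)
    (hqr : Nat.Coprime q r) {δ : Γ} {D : Derivation k (Laurent k m) (Laurent k m)}
    (hhom : ∀ γ f, D (component ω γ f) = component ω (γ + δ) (D f))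
    (hnil : leadingRing k q r n ≤ nilpotentPart D)
    (hy : D (yTop k q r n) = 0) (hzt : ¬ (D (zL k m) = 0 ∧ D (tL k m) = 0))
    {f : Laurent k m} (hf : f ∈ leadingRing k q r n) (hDf : D f = 0) :
    f ∈ Algebra.adjoin k
      {g | g ∈ Set.range (xL k) ∪ {yTop k q r n, zL k m, tL k m} ∧ D g = 0} := by
  set T := {g | g ∈ Set.range (xL k) ∪ {yTop k q r n, zL k m, tL k m} ∧ D g = 0}
  have hT : ∀ g, g ∈ Set.range (xL k) ∪ {yTop k q r n, zL k m, tL k m} → D g = 0 →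
      g ∈ Algebra.adjoin k T := fun g h1 h2 => Algebra.subset_adjoin ⟨h1, h2⟩
  have hzn := hnil (zL_mem_leadingRing n q r)
  have htn := hnil (tL_mem_leadingRing n q r)
  refine mem_of_component_mem ω (M := Subalgebra.toSubmodule (Algebra.adjoin k T)) fun γ => ?_
  rw [Subalgebra.mem_toSubmodule]
  have hg := hω.component_mem_leadingRing n hf γ
  have hDg : D (component ω γ f) = 0 := by rw [hhom, hDf, map_zero]
  have hgc := component_component ω γ f
  generalize component ω γ f = g at hg hDg hgc
  by_cases hg0 : g = 0
  · rw [hg0]; exact zero_mem _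
  obtain ⟨a, j, w, h, hh, rfl⟩ := hω.eq_mul_of_component_eq n (by omega) hg hgc hg0
  have hhn := hnil (ztForms_le_leadingRing n q r w hh)
  obtain ⟨hDxy, hDh⟩ := apply_eq_zero_of_mul D
    (hnil (mul_mem (xMon_mem_leadingRing n q r a) (pow_mem (yTop_mem_leadingRing n q r) j)))
    hhn hg0 hDg
  obtain ⟨hDx, -⟩ := apply_eq_zero_of_mul D (hnil (xMon_mem_leadingRing n q r a))
    (hnil (pow_mem (yTop_mem_leadingRing n q r) j)) (left_ne_zero_of_mul hg0) hDxy
  have hz0 : zL k m ≠ 0 := ztMon_ne_zero k _ _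
  have ht0 : tL k m ≠ 0 := ztMon_ne_zero k _ _
  have hpow : ∀ (u : Laurent k m) (e : ℕ), u ∈ Set.range (xL k) ∪ {yTop k q r n, zL k m, tL k m} →
      u ∈ nilpotentPart D → u ≠ 0 → D (u ^ e) = 0 → u ^ e ∈ Algebra.adjoin k T := by
    intro u e hu hun hu0 hue
    by_cases he : e = 0
    · rw [he, pow_zero]; exact one_mem _
    · exact pow_mem (hT u hu (apply_eq_zero_of_pow D hun hu0 he hue)) e
  refine mul_mem (mul_mem ?_ (pow_mem (hT _ (Or.inr (by simp)) hy) j)) ?_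
  · rw [← prod_xL_pow] at hDx ⊢
    refine prod_mem fun i hi => hpow _ _ (Or.inl ⟨i, rfl⟩) (hnil (xL_mem_leadingRing n q r i))
      (xMon_ne_zero k _) ?_
    rw [← Finset.mul_prod_erase _ _ hi] at hDx
    refine (apply_eq_zero_of_mul D (pow_mem (hnil (xL_mem_leadingRing n q r i)) _)
      (prod_mem fun i' _ => pow_mem (hnil (xL_mem_leadingRing n q r i')) _)
      (mul_ne_zero (pow_ne_zero _ (xMon_ne_zero k _))
        (Finset.prod_ne_zero_iff.mpr fun i' _ => pow_ne_zero _ (xMon_ne_zero k _))) hDx).1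
  · obtain ⟨b, c, l, P, hP, rfl⟩ := exists_homogenize_of_mem_ztForms (by omega) (by omega) hqr hh
    have h0 := right_ne_zero_of_mul hg0
    have haev : ∀ Q : k[X], MvPolynomial.aeval ![zL k m ^ q, tL k m ^ r] (Q.homogenize l) ∈
        nilpotentPart D := by
      intro Q
      rw [MvPolynomial.aeval_def, MvPolynomial.eval₂_eq]
      refine sum_mem fun d _ => mul_mem (Subalgebra.algebraMap_mem _ _) (prod_mem fun i _ =>
        pow_mem ?_ _)
      fin_cases i
      · exact pow_mem hzn q
      · exact pow_mem htn r
    obtain ⟨hD1, hD2⟩ := apply_eq_zero_of_mul D (mul_mem (pow_mem hzn b) (pow_mem htn c))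
      (haev P) h0 hDh
    obtain ⟨hD3, hD4⟩ := apply_eq_zero_of_mul D (pow_mem hzn b) (pow_mem htn c)
      (left_ne_zero_of_mul h0) hD1
    refine mul_mem (mul_mem (hpow _ _ (Or.inr (by simp)) hzn hz0 hD3)
      (hpow _ _ (Or.inr (by simp)) htn ht0 hD4)) ?_
    obtain ⟨a, e, he, rfl⟩ := eq_C_mul_X_pow_of_apply_homogenize D hzn htn hzt hq hr hP hD2
      (right_ne_zero_of_mul h0)
    have hev : MvPolynomial.aeval ![zL k m ^ q, tL k m ^ r]
        ((C a * Polynomial.X ^ e).homogenize l) =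
          a • ((zL k m) ^ (q * e) * (tL k m) ^ (r * (l - e))) := by
      rw [homogenize_C_mul, homogenize_X_pow he, map_mul, map_mul, map_pow, map_pow,
        MvPolynomial.aeval_X, MvPolynomial.aeval_X, MvPolynomial.aeval_C, Algebra.smul_def]
      simp only [Matrix.cons_val_zero, Matrix.cons_val_one]
      ring
    have ha : a ≠ 0 := by
      rintro rfl
      refine right_ne_zero_of_mul h0 ?_
      rw [hev, zero_smul]
    rw [hev] at hD2 ⊢
    rw [D.map_smul, smul_eq_zero_iff_right ha] at hD2
    obtain ⟨hD5, hD6⟩ := apply_eq_zero_of_mul D (pow_mem hzn _) (pow_mem htn _)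
      (mul_ne_zero (pow_ne_zero _ hz0) (pow_ne_zero _ ht0)) hD2
    exact Subalgebra.smul_mem _ (mul_mem (hpow _ _ (Or.inr (by simp)) hzn hz0 hD5)
      (hpow _ _ (Or.inr (by simp)) htn ht0 hD6)) a

end Core

section Core

variable {k Γ : Type*} [Field k] [AddCommGroup Γ] [LinearOrder Γ] {m : ℕ}
  [IsOrderedAddMonoid Γ] {ω : Exponent m →+ Γ} {q r : ℕ} {n : Fin (m + 1) → ℕ} [CharZero k]

theorem apply_xL_eq_zero_of_apply_xMon {D : Derivation k (Laurent k m) (Laurent k m)}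
    (hx : ∀ i, xL k i ∈ nilpotentPart D) {a : Fin (m + 1) → ℕ}
    (h : D (xMon k fun i => (a i : ℤ)) = 0) {i : Fin (m + 1)} (hi : a i ≠ 0) : D (xL k i) = 0 := by
  rw [← prod_xL_pow, ← Finset.mul_prod_erase _ _ (Finset.mem_univ i)] at h
  refine apply_eq_zero_of_pow D (hx i) (xMon_ne_zero k _) hi (apply_eq_zero_of_mul D
    (pow_mem (hx i) _) (prod_mem fun i' _ => pow_mem (hx i') _) (mul_ne_zero
      (pow_ne_zero _ (xMon_ne_zero k _)) (Finset.prod_ne_zero_iff.mpr fun i' _ =>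
        pow_ne_zero _ (xMon_ne_zero k _))) h).1

omit [CharZero k] in
theorem apply_eq_zero_of_mem_leadingRing {D : Derivation k (Laurent k m) (Laurent k m)}
    (hx : ∀ i, D (xL k i) = 0) (hy : D (yTop k q r n) = 0) (hz : D (zL k m) = 0)
    (ht : D (tL k m) = 0) {f : Laurent k m} (hf : f ∈ leadingRing k q r n) : D f = 0 := by
  have hle : leadingRing k q r n ≤ derivationKernel D := by
    rw [leadingRing, Algebra.adjoin_le_iff]
    rintro _ (⟨i, rfl⟩ | rfl | rfl | rfl)
    · exact hx i
    · exact hy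
    · exact hz
    · exact ht
  exact hle hf

/-- A nonzero homogeneous locally nilpotent derivation of the leading ring does not annihilate
`yTop`. Otherwise its constants are generated by those of `x_0, …, x_m, yTop, z, t` that are
constant. By transcendence degree, at most one `x_i` is not constant, and none if neither `z` nor
`t` is constant. In each case the equation `x ^ n * yTop + z ^ q + t ^ r = 0` has a shape that
forces too many of the variables to be constant. -/
theorem apply_yTop_ne_zero (hω : IsAdmissible ω q r) (hq : 2 ≤ q) (hr : 2 ≤ r)
    (hqr : Nat.Coprime q r) (hn : ∀ i, 1 < n i) {δ : Γ}
    {D : Derivation k (Laurent k m) (Laurent k m)}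
    (hhom : ∀ γ f, D (component ω γ f) = component ω (γ + δ) (D f))
    (hmap : ∀ f ∈ leadingRing k q r n, D f ∈ leadingRing k q r n)
    (hnil : leadingRing k q r n ≤ nilpotentPart D) (hne : ∃ f ∈ leadingRing k q r n, D f ≠ 0) :
    D (yTop k q r n) ≠ 0 := by
  classical
  intro hy
  have hxn : ∀ i, xL k i ∈ nilpotentPart D := fun i => hnil (xL_mem_leadingRing n q r i)
  have hyn := hnil (yTop_mem_leadingRing n q r)
  have hzn := hnil (zL_mem_leadingRing n q r)
  have htn := hnil (tL_mem_leadingRing n q r)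
  have hz0 : zL k m ≠ 0 := ztMon_ne_zero k _ _
  have ht0 : tL k m ≠ 0 := ztMon_ne_zero k _ _
  have hy0 : yTop k q r n ≠ 0 := yTop_ne_zero k n (by omega)
  have hrel := xMon_mul_yTop k q r n
  have hsum0 : zL k m ^ q + tL k m ^ r ≠ 0 := zL_pow_add_tL_pow_ne_zero k (by omega)
  -- If `z` and `t` are constants, then so is `x ^ n * yTop`, and with it all variables.
  have hzt : ¬ (D (zL k m) = 0 ∧ D (tL k m) = 0) := by
    rintro ⟨hz, ht⟩
    have h1 : D (xMon k (fun i => (n i : ℤ)) * yTop k q r n) = 0 := by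
      rw [hrel, map_neg, map_add, apply_pow_eq_zero hz, apply_pow_eq_zero ht, add_zero, neg_zero]
    have h2 := (apply_eq_zero_of_mul D (hnil (xMon_mem_leadingRing n q r n)) hyn
      (mul_ne_zero (xMon_ne_zero k _) hy0) h1).1
    obtain ⟨f, hf, hDf⟩ := hne
    exact hDf (apply_eq_zero_of_mem_leadingRing (fun i => apply_xL_eq_zero_of_apply_xMon hxn h2
      (by have := hn i; omega)) hy hz ht hf)
  have hcount := fun I E => le_card_of_constants_le_adjoin D (A := leadingRing k q r n)
    (by
      rintro (i | i)
      · exact xL_mem_leadingRing n q r i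
      · fin_cases i
        · exact zL_mem_leadingRing n q r
        · exact tL_mem_leadingRing n q r) hmap hnil hne
    (fun f hf hDf => constants_le_adjoin hω hq hr hqr hhom hnil hy hzt hf hDf) I E
  -- If all `x_i` are constants, then so is `z ^ q + t ^ r`.
  have hex : ∃ i, D (xL k i) ≠ 0 := by
    by_contra! hall
    have hxn0 : D (xMon k fun i => (n i : ℤ)) = 0 := by
      rw [← prod_xL_pow]
      exact Finset.prod_induction _ (fun f => D f = 0) (fun a b => apply_mul_eq_zero)
        D.map_one_eq_zero fun i _ => apply_pow_eq_zero (hall i) _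
    have h1 : D (1 * zL k m ^ q + 1 * tL k m ^ r) = 0 := by
      rw [one_mul, one_mul, ← neg_neg (zL k m ^ q + tL k m ^ r), ← hrel, map_neg,
        apply_mul_eq_zero hxn0 hy, neg_zero]
    exact hzt (apply_eq_zero_of_pow_add_pow D hzn htn D.map_one_eq_zero D.map_one_eq_zero
      one_ne_zero one_ne_zero hq hr h1 (by rw [one_mul, one_mul]; exact hsum0))
  obtain ⟨i, hi⟩ := hex
  -- If `v` is one of `z`, `t`, only `x_i` is not constant, and the equation reads
  -- `c * x_i ^ n_i + u ^ e = - v ^ l` with `u` the other one.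
  have hcase : ∀ (v u : Laurent k m) (l e : ℕ), D v = 0 → v ≠ 0 → u ∈ nilpotentPart D → 2 ≤ e →
      xMon k (fun i => (n i : ℤ)) * yTop k q r n = -(v ^ l + u ^ e) →
      (∀ i', i' ≠ i → D (xL k i') = 0) → False := by
    intro v u l e hv hv0 hu he hvu hall
    set c := (∏ i' ∈ Finset.univ.erase i, xL k i' ^ n i') * yTop k q r n with hc
    have hDc : D c = 0 := by
      refine apply_mul_eq_zero ?_ hy
      exact Finset.prod_induction _ (fun f => D f = 0) (fun a b => apply_mul_eq_zero)
        D.map_one_eq_zero fun i' hi' => apply_pow_eq_zero (hall i' (Finset.ne_of_mem_erase hi')) _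
    have hc0 : c ≠ 0 := mul_ne_zero (Finset.prod_ne_zero_iff.mpr fun i' _ =>
        pow_ne_zero _ (xMon_ne_zero k _)) hy0
    have heq : c * xL k i ^ n i + 1 * u ^ e = -v ^ l := by
      rw [← prod_xL_pow, ← Finset.mul_prod_erase _ _ (Finset.mem_univ i)] at hvu
      rw [hc]
      linear_combination hvu
    have := apply_eq_zero_of_pow_add_pow D (hxn i) hu hDc D.map_one_eq_zero hc0 one_ne_zero
      (hn i) he (by rw [heq, map_neg, apply_pow_eq_zero hv, neg_zero])
      (by rw [heq]; exact neg_ne_zero.mpr (pow_ne_zero _ hv0))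
    exact hi this.1
  -- If only one of `z`, `t` is constant, then all but one of the `x_i` are constants.
  have hothers : ∀ v : Laurent k m,
      (∀ g, g ∈ ({zL k m, tL k m} : Set (Laurent k m)) → D g = 0 → g = v) →
      ∀ i', i' ≠ i → D (xL k i') = 0 := by
    intro v hv i' hi'
    by_contra h0
    have := hcount ((Finset.univ.erase i).erase i') {yTop k q r n, v} (by
      rintro g ⟨⟨i'', rfl⟩ | hg, hDg⟩
      · refine Or.inl ⟨i'', ?_, rfl⟩
        rw [Finset.mem_coe, Finset.mem_erase, Finset.mem_erase]
        refine ⟨?_, ?_, Finset.mem_univ _⟩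
        · rintro rfl; exact h0 hDg
        · rintro rfl; exact hi hDg
      · refine Or.inr ?_
        rw [Finset.mem_coe, Finset.mem_insert, Finset.mem_singleton]
        rcases hg with hg | hg
        · exact Or.inl hg
        · exact Or.inr (hv g hg hDg))
    rw [Finset.card_erase_of_mem (Finset.mem_erase.mpr ⟨hi', Finset.mem_univ _⟩),
      Finset.card_erase_of_mem (Finset.mem_univ _), Finset.card_univ, Fintype.card_fin] at this
    have h2 : ({yTop k q r n, v} : Finset (Laurent k m)).card ≤ 2 := Finset.card_le_two
    have h3 : 0 < m := by
      by_contra h4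
      have h5 := i.2
      have h6 := i'.2
      exact hi' (Fin.ext (by omega))
    omega
  by_cases hz : D (zL k m) = 0
  · have ht : D (tL k m) ≠ 0 := fun ht => hzt ⟨hz, ht⟩
    refine hcase (zL k m) (tL k m) q r hz hz0 htn hr hrel (hothers (zL k m) ?_)
    rintro g (rfl | rfl) hg
    · rfl
    · exact absurd hg ht
  · by_cases ht : D (tL k m) = 0
    · refine hcase (tL k m) (zL k m) r q ht ht0 hzn hq (by rw [hrel, add_comm])
        (hothers (tL k m) ?_)
      rintro g (rfl | rfl) hg
      · exact absurd hg hz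
      · rfl
    · -- The constants are generated by `yTop` and at most `m` variables, which are too few.
      have := hcount (Finset.univ.erase i) {yTop k q r n} (by
        rintro g ⟨⟨i'', rfl⟩ | hg, hDg⟩
        · refine Or.inl ⟨i'', ?_, rfl⟩
          rw [Finset.mem_coe, Finset.mem_erase]
          refine ⟨?_, Finset.mem_univ _⟩
          rintro rfl; exact hi hDg
        · refine Or.inr ?_
          rw [Finset.mem_coe, Finset.mem_singleton]
          rcases hg with hg | rfl | rfl
          · exact hg
          · exact absurd hDg hz
          · exact absurd hDg ht)
      rw [Finset.card_erase_of_mem (Finset.mem_univ _), Finset.card_univ, Fintype.card_fin,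
        Finset.card_singleton] at this
      omega

end Core

/-! ### Extension of derivations to the Laurent polynomial ring -/

section CoordinateRing

variable {k : Type*} [Field k] {m : ℕ} (q r : ℕ) (n : Fin (m + 1) → ℕ) (p : Polynomial k)

/-- The lexicographically ordered group of the values of `lexWeight`. -/
abbrev LexWeight (m : ℕ) : Type := ℤ ×ₗ (Lex (Fin (m + 1) → ℤ) ×ₗ ℤ)

/-- An admissible weight that compares the exponents of `x_i` first, then those of the other `x_j`,
larger exponents being lighter, and finally the degrees in `z` and `t`. -/
def lexWeight (i : Fin (m + 1)) : Exponent m →+ LexWeight m where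
  toFun g := toLex (-g.1 i, toLex (toLex (-g.1), (r : ℤ) * g.2.1 + q * g.2.2))
  map_zero' := by
    simp only [Prod.fst_zero, Prod.snd_zero, Pi.zero_apply, neg_zero, mul_zero, add_zero]
    rfl
  map_add' g g' := by
    simp only [Prod.fst_add, Prod.snd_add, Pi.add_apply, neg_add, mul_add]
    rw [add_add_add_comm]
    rfl

theorem le_of_lexWeight_le {i : Fin (m + 1)} {g g' : Exponent m}
    (h : lexWeight q r i g ≤ lexWeight q r i g') : g'.1 i ≤ g.1 i := by
  have h1 : (lexWeight q r i g).1 ≤ (lexWeight q r i g').1 := by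
    rcases (Prod.Lex.le_iff).mp h with h | h
    · exact h.le
    · exact h.1.le
  exact neg_le_neg_iff.mp h1

theorem isAdmissible_lexWeight (i : Fin (m + 1)) : IsAdmissible (lexWeight q r i) q r where
  separates g g' h := by
    have h1 := congrArg (fun w : LexWeight m => ofLex (ofLex w).2) h
    have h2 : ((toLex (-g.1), (r : ℤ) * g.2.1 + q * g.2.2) : Lex (Fin (m + 1) → ℤ) × ℤ) =
      (toLex (-g'.1), (r : ℤ) * g'.2.1 + q * g'.2.2) := h1
    rw [Prod.mk.injEq] at h2
    exact ⟨neg_injective (toLex.injective h2.1), h2.2⟩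
  balanced := by
    simp only [lexWeight, AddMonoidHom.coe_mk, ZeroHom.coe_mk, mul_zero, add_zero, zero_add,
      mul_comm]
  nonneg := by
    refine (Prod.Lex.le_iff).mpr (Or.inr ⟨by simp [lexWeight], ?_⟩)
    refine (Prod.Lex.le_iff).mpr (Or.inr ⟨?_, ?_⟩)
    · change (0 : Lex (Fin (m + 1) → ℤ)) = toLex (-0)
      rw [neg_zero]; rfl
    · change (0 : ℤ) ≤ (r : ℤ) * q + q * 0
      positivity
  neg i' := by
    by_cases h : i' = i
    · subst h
      refine (Prod.Lex.lt_iff).mpr (Or.inl ?_)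
      change -(Pi.single i' 1 : Fin (m + 1) → ℤ) i' < 0
      simp
    · refine (Prod.Lex.lt_iff).mpr (Or.inr ⟨?_, ?_⟩)
      · change -(Pi.single i' 1 : Fin (m + 1) → ℤ) i = 0
        simp [Ne.symm h]
      · refine (Prod.Lex.lt_iff).mpr (Or.inl ?_)
        change toLex (-(Pi.single i' 1 : Fin (m + 1) → ℤ)) < toLex 0
        refine Pi.toLex_strictMono ?_
        rw [neg_lt_zero]
        exact Pi.single_pos.mpr one_pos

/-- Nonzero combinations of normal monomials have nonzero leading components. -/
theorem toLaurent_injective (hq : q ≠ 0) : Function.Injective (toLaurent q r n p) := by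
  rw [injective_iff_map_eq_zero]
  intro s hs
  by_contra h0
  obtain ⟨γ, f, hL, hf, -⟩ :=
    (isAdmissible_lexWeight q r (0 : Fin (m + 1))).exists_leading n p hq h0
  rw [hs] at hL
  exact hf (hL.2.symm.trans (map_zero _))

/-- Every derivation of the coordinate ring extends to the Laurent polynomial ring. -/
theorem exists_logDer (d : Derivation k (R q r m n p) (R q r m n p)) :
    ∃ c : Exponent m →+ Laurent k m,
      ∀ s, logDer c (toLaurent q r n p s) = toLaurent q r n p (d s) := by
  set ψ := toLaurent q r n p with hψ
  let c : Exponent m →+ Laurent k m :=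
    { toFun := fun g => (∑ i, g.1 i • (xMon k (-Pi.single i 1) * ψ (d (coord q r m n p (.x i))))) +
        g.2.1 • (ztMon k (-1) 0 * ψ (d (coord q r m n p .z))) +
        g.2.2 • (ztMon k 0 (-1) * ψ (d (coord q r m n p .t)))
      map_zero' := by simp
      map_add' := fun g g' => by
        simp only [Prod.fst_add, Prod.snd_add, Pi.add_apply, add_smul, Finset.sum_add_distrib]
        abel }
  refine ⟨c, ?_⟩
  -- The elements on which the two derivations agree form a subalgebra that contains the variables.
  let good : Subalgebra k (R q r m n p) :=
    { carrier := {s | logDer c (ψ s) = ψ (d s)}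
      mul_mem' := fun {a b} ha hb => by
        change logDer c (ψ a) = ψ (d a) at ha
        change logDer c (ψ b) = ψ (d b) at hb
        change logDer c (ψ (a * b)) = ψ (d (a * b))
        rw [map_mul, Derivation.leibniz, Derivation.leibniz, ha, hb]
        simp only [smul_eq_mul, map_add, map_mul]
      add_mem' := fun {a b} ha hb => by
        change logDer c (ψ a) = ψ (d a) at ha
        change logDer c (ψ b) = ψ (d b) at hb
        change logDer c (ψ (a + b)) = ψ (d (a + b))
        rw [map_add, map_add, map_add, map_add, ha, hb]
      algebraMap_mem' := fun a => by
        change logDer c (ψ (algebraMap k _ a)) = ψ (d (algebraMap k _ a))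
        rw [AlgHom.commutes, Derivation.map_algebraMap, Derivation.map_algebraMap, map_zero] }
  have hx : ∀ i, coord q r m n p (.x i) ∈ good := by
    intro i
    change logDer c (ψ (coord q r m n p (.x i))) = ψ (d (coord q r m n p (.x i)))
    rw [hψ, toLaurent_coord, ← hψ]
    change logDer c (AddMonoidAlgebra.single _ 1) = _
    rw [logDer_single]
    change xL k i * ((∑ i', (Pi.single i 1 : Fin (m + 1) → ℤ) i' • _) +
      (0 : ℤ) • _ + (0 : ℤ) • _) = _
    rw [Finset.sum_eq_single i, Pi.single_eq_same, one_smul, zero_smul, zero_smul, add_zero,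
      add_zero, ← mul_assoc, xMon_mul, add_neg_cancel, xMon_zero, one_mul]
    · intro i' _ hi'
      rw [Pi.single_eq_of_ne hi', zero_smul]
    · intro h; exact absurd (Finset.mem_univ i) h
  have hz : coord q r m n p .z ∈ good := by
    change logDer c (ψ (coord q r m n p .z)) = ψ (d (coord q r m n p .z))
    rw [hψ, toLaurent_coord, ← hψ]
    change logDer c (AddMonoidAlgebra.single _ 1) = _
    rw [logDer_single]
    change zL k m * ((∑ i', (0 : ℤ) • _) + (1 : ℤ) • _ + (0 : ℤ) • _) = _
    simp only [zero_smul, Finset.sum_const_zero, one_smul, zero_add, add_zero]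
    rw [← mul_assoc, ztMon_mul, add_neg_cancel, add_zero, ztMon_zero, one_mul]
  have ht : coord q r m n p .t ∈ good := by
    change logDer c (ψ (coord q r m n p .t)) = ψ (d (coord q r m n p .t))
    rw [hψ, toLaurent_coord, ← hψ]
    change logDer c (AddMonoidAlgebra.single _ 1) = _
    rw [logDer_single]
    change tL k m * ((∑ i', (0 : ℤ) • _) + (0 : ℤ) • _ + (1 : ℤ) • _) = _
    simp only [zero_smul, Finset.sum_const_zero, one_smul, zero_add]
    rw [← mul_assoc, ztMon_mul, add_neg_cancel, add_zero, ztMon_zero, one_mul]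
  have hy : coord q r m n p .y ∈ good := by
    have hxn : ∏ i, coord q r m n p (.x i) ^ n i ∈ good := prod_mem fun i _ => pow_mem (hx i) _
    have hxy : (∏ i, coord q r m n p (.x i) ^ n i) * coord q r m n p .y ∈ good := by
      rw [coord_relation, aeval_eq_sum_range]
      exact neg_mem (add_mem (add_mem (pow_mem hz _) (pow_mem ht _)) (mul_mem (hx 0)
        (sum_mem fun l _ => Subalgebra.smul_mem _ (pow_mem (prod_mem fun i _ => hx i) _) _)))
    have h1 : logDer c (ψ _) = ψ (d _) := hxn
    have h2 : logDer c (ψ _) = ψ (d _) := hxy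
    rw [map_mul, Derivation.leibniz, Derivation.leibniz, map_add, h1] at h2
    simp only [smul_eq_mul, map_mul] at h2
    have hne : ψ (∏ i, coord q r m n p (.x i) ^ n i) ≠ 0 := by
      rw [map_prod]
      refine Finset.prod_ne_zero_iff.mpr fun i _ => ?_
      rw [map_pow, hψ, toLaurent_coord]
      exact pow_ne_zero _ (xMon_ne_zero k _)
    exact mul_left_cancel₀ hne (add_right_cancel h2)
  intro s
  have hs : s ∈ good := by
    obtain ⟨P, rfl⟩ := Ideal.Quotient.mk_surjective s
    induction P using MvPolynomial.induction_on with
    | C a => exact good.algebraMap_mem a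
    | add P Q hP hQ => rw [map_add]; exact add_mem hP hQ
    | mul_X P v hP =>
      rw [map_mul]
      refine mul_mem hP ?_
      cases v with
      | x i => exact hx i
      | y => exact hy
      | z => exact hz
      | t => exact ht
  exact hs

end CoordinateRing

/-! ### Constants of locally nilpotent derivations of the coordinate ring -/

section Kernel

variable {k : Type*} [Field k] {m : ℕ} {q r : ℕ} {n : Fin (m + 1) → ℕ} {p : Polynomial k}

/-- The subalgebra generated by `x_0, …, x_m, z, t`. -/
noncomputable def xztSubalgebra (q r : ℕ) (n : Fin (m + 1) → ℕ) (p : Polynomial k) :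
    Subalgebra k (R q r m n p) :=
  Algebra.adjoin k ((Set.range fun i : Fin (m + 1) => coord q r m n p (Var.x i)) ∪
    {coord q r m n p Var.z, coord q r m n p Var.t})

theorem coord_x_mem_xztSubalgebra (i : Fin (m + 1)) :
    coord q r m n p (.x i) ∈ xztSubalgebra q r n p :=
  Algebra.subset_adjoin (Or.inl ⟨i, rfl⟩)

theorem coord_z_mem_xztSubalgebra : coord q r m n p .z ∈ xztSubalgebra q r n p :=
  Algebra.subset_adjoin (Or.inr (Or.inl rfl))

theorem coord_t_mem_xztSubalgebra : coord q r m n p .t ∈ xztSubalgebra q r n p :=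
  Algebra.subset_adjoin (Or.inr (Or.inr rfl))

theorem monR_mem_xztSubalgebra {ν : MonIndex m} (hν : ν.2.1 = 0) :
    monR q r n p ν ∈ xztSubalgebra q r n p := by
  rw [monR, hν, pow_zero, mul_one]
  exact mul_mem (prod_mem fun i _ => pow_mem (coord_x_mem_xztSubalgebra i) _)
    (mul_mem (pow_mem coord_z_mem_xztSubalgebra _) (pow_mem coord_t_mem_xztSubalgebra _))

theorem logDer_iterate_toLaurent {d : Derivation k (R q r m n p) (R q r m n p)}
    {c : Exponent m →+ Laurent k m}
    (hc : ∀ s, logDer c (toLaurent q r n p s) = toLaurent q r n p (d s)) (N : ℕ)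
    (s : R q r m n p) :
    (logDer c)^[N] (toLaurent q r n p s) = toLaurent q r n p (d^[N] s) := by
  induction N generalizing s with
  | zero => rfl
  | succ N ih => rw [Function.iterate_succ_apply, hc, ih, Function.iterate_succ_apply]

theorem range_toLaurent_le_nilpotentPart {d : Derivation k (R q r m n p) (R q r m n p)}
    (hd : IsLocallyNilpotentDerivation d) {c : Exponent m →+ Laurent k m}
    (hc : ∀ s, logDer c (toLaurent q r n p s) = toLaurent q r n p (d s)) :
    (toLaurent q r n p).range ≤ nilpotentPart (logDer c) := by
  rintro _ ⟨s, rfl⟩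
  obtain ⟨N, hN⟩ := hd s
  exact ⟨N, (logDer_iterate_toLaurent hc N s).trans (by rw [hN, map_zero])⟩

theorem logDer_mem_range_toLaurent {d : Derivation k (R q r m n p) (R q r m n p)}
    {c : Exponent m →+ Laurent k m}
    (hc : ∀ s, logDer c (toLaurent q r n p s) = toLaurent q r n p (d s)) :
    ∀ f ∈ (toLaurent q r n p).range, logDer c f ∈ (toLaurent q r n p).range := by
  rintro _ ⟨s, rfl⟩
  exact ⟨d s, (hc s).symm⟩

theorem logDer_ne_zero {d : Derivation k (R q r m n p) (R q r m n p)} (hd : d ≠ 0) (hq : q ≠ 0)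
    {c : Exponent m →+ Laurent k m}
    (hc : ∀ s, logDer c (toLaurent q r n p s) = toLaurent q r n p (d s)) : c ≠ 0 := by
  rintro rfl
  refine hd (Derivation.ext fun s => toLaurent_injective q r n p hq ?_)
  rw [← hc, Derivation.zero_apply, map_zero]
  have h : ∀ f : Laurent k m, logDer (0 : Exponent m →+ Laurent k m) f = 0 := by
    intro f
    induction f using AddMonoidAlgebra.induction_linear with
    | zero => simp
    | add f g h1 h2 => rw [map_add, h1, h2, add_zero]
    | single g a => rw [logDer_single, AddMonoidHom.zero_apply, mul_zero]
  exact h _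

/-- The constants of a nonzero locally nilpotent derivation do not involve `y`. Otherwise the
leading component of such a constant, for a suitable weight, is divisible by `yTop`, so that the
leading derivation annihilates `yTop`. -/
theorem mem_xztSubalgebra_of_apply_eq_zero [CharZero k] (hq : 2 ≤ q) (hr : 2 ≤ r)
    (hqr : Nat.Coprime q r) (hn : ∀ i, 1 < n i) {d : Derivation k (R q r m n p) (R q r m n p)}
    (hd : IsLocallyNilpotentDerivation d) (hd0 : d ≠ 0) {s : R q r m n p} (hs : d s = 0) :
    s ∈ xztSubalgebra q r n p := by
  obtain ⟨c, hc⟩ := exists_logDer q r n p d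
  obtain ⟨e, he, rfl⟩ := exists_normalForm q r n p s
  refine sum_mem fun ν hν => Subalgebra.smul_mem _ (monR_mem_xztSubalgebra ?_) _
  by_contra hj
  obtain h0 | ⟨i, hi⟩ := he ν hν
  · exact hj h0
  -- The leading terms of this monomial have a negative exponent of `x_i`. Hence so have those of
  -- the whole sum for the weight `lexWeight q r i`, and `y` occurs in the leading monomial `ν₀`.
  have hω := isAdmissible_lexWeight q r i
  obtain ⟨ν₀, hν₀, hmax, w, h, hh, hh0, hL⟩ := hω.exists_leading_normalForm n p he
    (by rintro rfl; simp at hν)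
  have hle := le_of_lexWeight_le q r (hmax ν hν)
  have hj₀ : ν₀.2.1 ≠ 0 := by
    intro h0
    simp only [topExponent, h0] at hle
    have h1 : (ν.1 i : ℤ) < n i := by exact_mod_cast hi
    have h2 : (1 : ℤ) ≤ ν.2.1 := by exact_mod_cast Nat.one_le_iff_ne_zero.mpr hj
    have h3 : (0 : ℤ) ≤ ν₀.1 i := by positivity
    have h4 : (0 : ℤ) ≤ n i := by positivity
    push_cast at hle
    nlinarith
  obtain ⟨δ, D, hhom, hmap, hnil, hne, hker⟩ := hω.exists_leadingDerivation n (by omega) p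
    (logDer_ne_zero hd0 (by omega) hc) (logDer_mem_range_toLaurent hc)
    (range_toLaurent_le_nilpotentPart hd hc)
  have hD := hker _ _ (by rw [hc, hs, map_zero]) hL.1
  rw [hL.2] at hD
  have hy0 : yTop k q r n ≠ 0 := yTop_ne_zero k n (by omega)
  have hyn := hnil (yTop_mem_leadingRing n q r)
  have hxn := hnil (xMon_mem_leadingRing n q r ν₀.1)
  have h1 := (apply_eq_zero_of_mul D (mul_mem hxn (pow_mem hyn _))
    (hnil (ztForms_le_leadingRing n q r w hh))
    (mul_ne_zero (mul_ne_zero (xMon_ne_zero k _) (pow_ne_zero _ hy0)) hh0) hD).1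
  have h2 := (apply_eq_zero_of_mul D hxn (pow_mem hyn _)
    (mul_ne_zero (xMon_ne_zero k _) (pow_ne_zero _ hy0)) h1).2
  exact apply_yTop_ne_zero hω hq hr hqr hn hhom hmap hnil hne
    (apply_eq_zero_of_pow D hyn hy0 hj₀ h2)

/-! ### The variables `x_i` are annihilated by all locally nilpotent derivations -/

/-- Minus the exponent of `x_i`. -/
def xWeight (i : Fin (m + 1)) : Exponent m →+ ℤ where
  toFun g := -g.1 i
  map_zero' := by simp
  map_add' g g' := by simp [add_comm]

/-- The exponent of `z`. -/
def zWeight (m : ℕ) : Exponent m →+ ℤ where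
  toFun g := g.2.1
  map_zero' := rfl
  map_add' _ _ := rfl

variable (k m) in
/-- The polynomial ring `k[x_0, …, x_m, z, t]` inside the Laurent polynomials. -/
noncomputable def polyRing : Subalgebra k (Laurent k m) :=
  Algebra.adjoin k (Set.range (xL k) ∪ {zL k m, tL k m})

/-- The polynomials that do not involve `x_i`. -/
noncomputable def polyRingWithout (k : Type*) [Field k] {m : ℕ} (i : Fin (m + 1)) :
    Subalgebra k (Laurent k m) :=
  Algebra.adjoin k (xL k '' {i' | i' ≠ i} ∪ {zL k m, tL k m})

theorem polyRingWithout_le (i : Fin (m + 1)) : polyRingWithout k i ≤ polyRing k m :=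
  Algebra.adjoin_mono (Set.union_subset_union_left _ (Set.image_subset_range _ _))

theorem hasLeading_xWeight_self {i : Fin (m + 1)} {g : Exponent m} (hg : g.1 i = 0) (a : k) :
    HasLeading (xWeight i) 0 (AddMonoidAlgebra.single g a) (AddMonoidAlgebra.single g a) :=
  hasLeading_single (by change -g.1 i = 0; rw [hg, neg_zero]) a

theorem hasLeading_of_mem_polyRingWithout {i : Fin (m + 1)} {f : Laurent k m}
    (hf : f ∈ xL k '' {i' | i' ≠ i} ∪ {zL k m, tL k m}) : HasLeading (xWeight i) 0 f f := by
  rcases hf with ⟨i', hi', rfl⟩ | rfl | rfl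
  · exact hasLeading_xWeight_self (by simp [Ne.symm hi']) 1
  · exact hasLeading_xWeight_self rfl 1
  · exact hasLeading_xWeight_self rfl 1

/-- Division with remainder of a polynomial by `x_i`. -/
theorem exists_eq_component_add (i : Fin (m + 1)) {f : Laurent k m} (hf : f ∈ polyRing k m) :
    f ∈ lowPart k (xWeight i) 0 ∧ component (xWeight i) 0 f ∈ polyRingWithout k i ∧
      ∃ f' ∈ polyRing k m, f = component (xWeight i) 0 f + xL k i * f' := by
  have hgen : ∀ g ∈ xL k '' {i' | i' ≠ i} ∪ {zL k m, tL k m}, g ∈ lowPart k (xWeight i) 0 ∧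
      component (xWeight i) 0 g ∈ polyRingWithout k i ∧
      ∃ g' ∈ polyRing k m, g = component (xWeight i) 0 g + xL k i * g' := by
    intro g hg
    have h := hasLeading_of_mem_polyRingWithout hg
    refine ⟨h.1, ?_, 0, zero_mem _, ?_⟩
    · rw [h.2]; exact Algebra.subset_adjoin hg
    · rw [h.2, mul_zero, add_zero]
  induction hf using Algebra.adjoin_induction with
  | mem f hv =>
    rcases hv with ⟨i', rfl⟩ | hv
    · by_cases h : i' = i
      · subst h
        have hw : xWeight i' ((Pi.single i' 1, 0, 0) : Exponent m) = -1 := by simp [xWeight]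
        have h0 : component (xWeight i') 0 (xL k i') = 0 :=
          component_single_of_ne (by rw [hw]; norm_num) 1
        refine ⟨single_mem_lowPart (by rw [hw]; norm_num) 1, ?_, 1, one_mem _, ?_⟩
        · rw [h0]; exact zero_mem _
        · rw [h0, zero_add, mul_one]
      · exact hgen _ (Or.inl ⟨i', h, rfl⟩)
    · exact hgen _ (Or.inr hv)
  | algebraMap a =>
    have h : HasLeading (xWeight i) 0 (algebraMap k (Laurent k m) a)
        (algebraMap k (Laurent k m) a) := hasLeading_xWeight_self rfl a
    refine ⟨h.1, ?_, 0, zero_mem _, ?_⟩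
    · rw [h.2]; exact Subalgebra.algebraMap_mem _ a
    · rw [h.2, mul_zero, add_zero]
  | add f g hf hg h1 h2 =>
    obtain ⟨hf1, hf2, f', hf', hf3⟩ := h1
    obtain ⟨hg1, hg2, g', hg', hg3⟩ := h2
    refine ⟨add_mem hf1 hg1, ?_, f' + g', add_mem hf' hg', ?_⟩
    · rw [map_add]; exact add_mem hf2 hg2
    · rw [map_add]
      linear_combination hf3 + hg3
  | mul f g hf hg h1 h2 =>
    obtain ⟨hf1, hf2, f', hf', hf3⟩ := h1
    obtain ⟨hg1, hg2, g', hg', hg3⟩ := h2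
    have h3 : component (xWeight i) 0 (f * g) =
        component (xWeight i) 0 f * component (xWeight i) 0 g := by
      have := component_mul hf1 hg1
      rwa [add_zero] at this
    refine ⟨by simpa using mul_mem_lowPart hf1 hg1, ?_,
      component (xWeight i) 0 f * g' + f' * g, add_mem (mul_mem (polyRingWithout_le i hf2) hg')
        (mul_mem hf' hg), ?_⟩
    · rw [h3]; exact mul_mem hf2 hg2
    · rw [h3]
      linear_combination g * hf3 + component (xWeight i) 0 f * hg3

theorem polyRing_le_range_toLaurent : polyRing k m ≤ (toLaurent q r n p).range := by
  rw [polyRing, Algebra.adjoin_le_iff]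
  rintro _ (⟨i, rfl⟩ | rfl | rfl)
  · exact ⟨_, toLaurent_coord q r n p (.x i)⟩
  · exact ⟨_, toLaurent_coord q r n p .z⟩
  · exact ⟨_, toLaurent_coord q r n p .t⟩

theorem toLaurent_mem_polyRing {s : R q r m n p} (hs : s ∈ xztSubalgebra q r n p) :
    toLaurent q r n p s ∈ polyRing k m := by
  have hle : xztSubalgebra q r n p ≤ (polyRing k m).comap (toLaurent q r n p) := by
    rw [xztSubalgebra, Algebra.adjoin_le_iff]
    rintro _ (⟨i, rfl⟩ | rfl | rfl)
    · change toLaurent q r n p (coord q r m n p (.x i)) ∈ polyRing k m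
      rw [toLaurent_coord]
      exact Algebra.subset_adjoin (Or.inl ⟨i, rfl⟩)
    · change toLaurent q r n p (coord q r m n p .z) ∈ polyRing k m
      rw [toLaurent_coord]
      exact Algebra.subset_adjoin (Or.inr (Or.inl rfl))
    · change toLaurent q r n p (coord q r m n p .t) ∈ polyRing k m
      rw [toLaurent_coord]
      exact Algebra.subset_adjoin (Or.inr (Or.inr rfl))
  exact hle hs

theorem pL_mem_polyRing (p : Polynomial k) : pL p ∈ polyRing k m := by
  have hx : ∀ i, xL k i ∈ polyRing k m := fun i => Algebra.subset_adjoin (Or.inl ⟨i, rfl⟩)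
  rw [pL, aeval_eq_sum_range]
  exact mul_mem (hx 0) (sum_mem fun l _ => Subalgebra.smul_mem _
    (pow_mem (prod_mem fun i _ => hx i) _) _)

/-- The remainder of `z ^ q + t ^ r + x_0 * p(∏ x_i)` modulo `x_i` is nonzero. -/
theorem component_equation_ne_zero (hq : q ≠ 0) (i : Fin (m + 1)) (p : Polynomial k) :
    component (xWeight i) 0 (zL k m ^ q + tL k m ^ r + pL p) ≠ 0 := by
  intro h0
  have h1 := congrArg (fun f => f.coeff ((0, (q : ℤ), 0) : Exponent m)) h0
  have h2 : (pL p).coeff ((0, (q : ℤ), 0) : Exponent m) = 0 := by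
    by_contra h
    have h3 := pL_mem_lowPart (ω := zWeight m) (fun i => le_refl (0 : ℤ)) p
    have h4 : (q : ℤ) ≤ 0 := mem_lowPart.mp h3 _ h
    omega
  have h5 : ((0, (q : ℤ), 0) : Exponent m) ≠ (0, 0, (r : ℤ)) := by
    intro h5
    rw [Prod.mk.injEq, Prod.mk.injEq] at h5
    exact hq (by exact_mod_cast h5.2.1)
  have h6 : xWeight i ((0, (q : ℤ), 0) : Exponent m) = 0 := by simp [xWeight]
  simp only [coeff_component] at h1
  rw [Finsupp.filter_apply, if_pos h6, zL_pow_eq, tL_pow_eq] at h1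
  simp only [ztMon, AddMonoidAlgebra.coeff_add, AddMonoidAlgebra.coeff_single, Finsupp.add_apply,
    Finsupp.single_eq_same, AddMonoidAlgebra.coeff_zero, Finsupp.zero_apply, h2] at h1
  rw [Finsupp.single_eq_of_ne h5, add_zero, add_zero] at h1
  exact one_ne_zero h1

end Kernel

section Exchange

variable {k B : Type*} [Field k] [CommRing B] [IsDomain B] [Algebra k B]

/-- If all elements of a stable subalgebra `A` are annihilated by an iterate of `D`, then `A` has
transcendence degree at most one over the constants `F` of `D` in `A`, so that it is algebraic over
`F[g]` for every non-constant `g ∈ A`. -/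
theorem isAlgebraic_adjoin_of_apply_ne_zero [CharZero k] (D : Derivation k B B)
    {A F : Subalgebra k B} (hA : ∀ a ∈ A, D a ∈ A) (hnil : A ≤ nilpotentPart D)
    (hF : ∀ f, f ∈ F ↔ f ∈ A ∧ D f = 0) {x g : B} (hx : x ∈ A) (hg : g ∈ A) (hDg : D g ≠ 0) :
    IsAlgebraic (Algebra.adjoin F {g}) x := by
  obtain ⟨s, hs, hs1, hs2⟩ := exists_slice D (A := (A : Set B)) hA hg (hnil hg) hDg
  have hinj : Function.Injective (algebraMap F B) := Subtype.val_injective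
  have : FaithfulSMul F B := (faithfulSMul_iff_algebraMap_injective F B).mpr hinj
  have hcl : ∀ a ∈ A, a ∈ (AlgebraicIndependent.matroid F B).closure {s} := by
    intro a ha
    rw [AlgebraicIndependent.matroid_closure_eq]
    obtain ⟨u, huA, hu, hu0, hmem⟩ := exists_mul_mem_adjoin_slice D A hA hs hs1 hs2 ha (hnil ha)
    generalize hS : ({s} : Set B) = S at hmem ⊢
    have hFS : ∀ f ∈ A, D f = 0 → f ∈ Algebra.adjoin F S := by
      intro f hf hDf
      have h := Subalgebra.algebraMap_mem (Algebra.adjoin F S) (⟨f, (hF f).mpr ⟨hf, hDf⟩⟩ : F)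
      exact h
    have hle : ∀ f ∈ Algebra.adjoin k ({f | f ∈ A ∧ D f = 0} ∪ S), f ∈ Algebra.adjoin F S := by
      intro f hf
      induction hf using Algebra.adjoin_induction with
      | mem f hf =>
        rcases hf with hf | hf
        · exact hFS f hf.1 hf.2
        · exact Algebra.subset_adjoin hf
      | algebraMap c => exact hFS _ (A.algebraMap_mem c) (D.map_algebraMap c)
      | add f f' _ _ h1 h2 => exact add_mem h1 h2
      | mul f f' _ _ h1 h2 => exact mul_mem h1 h2
    have hu' : u ∈ Algebra.adjoin F S := hFS u huA hu
    have h1 : IsAlgebraic (Algebra.adjoin F S) (u * a) :=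
      isAlgebraic_algebraMap (⟨u * a, hle _ hmem⟩ : Algebra.adjoin F S)
    exact IsAlgebraic.of_mul (mem_nonZeroDivisors_of_ne_zero hu0)
      (isAlgebraic_algebraMap (⟨u, hu'⟩ : Algebra.adjoin F S)) h1
  have hg0 : g ∉ (AlgebraicIndependent.matroid F B).closure ∅ := by
    rw [AlgebraicIndependent.matroid_closure_eq]
    intro h
    have h1 : IsAlgebraic (Algebra.adjoin F (∅ : Set B)) g := h
    refine hDg (apply_eq_zero_of_isAlgebraic D
      ((Algebra.adjoin F (∅ : Set B)).restrictScalars k) (fun a ha => ?_) h1)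
    rw [Subalgebra.mem_restrictScalars, Algebra.adjoin_empty, Algebra.mem_bot] at ha
    obtain ⟨f, rfl⟩ := ha
    exact ((hF _).mp f.2).2
  have h1 : s ∈ (AlgebraicIndependent.matroid F B).closure (insert g ∅) :=
    Matroid.mem_closure_insert hg0 (by simpa using hcl g hg)
  have h2 : x ∈ (AlgebraicIndependent.matroid F B).closure {g} := by
    refine Matroid.closure_subset_closure_of_subset_closure ?_ (hcl x hx)
    simpa using h1
  rw [AlgebraicIndependent.matroid_closure_eq] at h2
  exact h2

end Exchange

section Kernel

variable {k : Type*} [Field k] {m : ℕ} {q r : ℕ} {n : Fin (m + 1) → ℕ} {p : Polynomial k}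

/-- Reduction modulo `x_i`, with values in the polynomials without `x_i`. -/
noncomputable def remainderHom (k : Type*) [Field k] {m : ℕ} (i : Fin (m + 1)) :
    polyRing k m →ₐ[k] Laurent k m :=
  AlgHom.ofLinearMap ((component (xWeight i) 0).comp (polyRing k m).val.toLinearMap)
    (component_single_of_eq (map_zero _) 1) (fun f g => by
      have := component_mul (exists_eq_component_add i f.2).1 (exists_eq_component_add i g.2).1
      rwa [add_zero] at this)

theorem remainderHom_apply (i : Fin (m + 1)) (f : polyRing k m) :
    remainderHom k i f = component (xWeight i) 0 (f : Laurent k m) := rfl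

/-- Let `F` be a ring of polynomials on which reduction modulo `x_i` is injective and takes
values in the constants of `D`. If `g` does not involve `x_i` and `x_i` is algebraic over `F[g]`,
then the constant term of an equation for `x_i` reduces to an equation for `g`, and `g` is a
constant of `D`. -/
theorem apply_eq_zero_of_isAlgebraic_adjoin [CharZero k] (i : Fin (m + 1))
    (D : Derivation k (Laurent k m) (Laurent k m)) {F : Subalgebra k (Laurent k m)}
    (hF : F ≤ polyRing k m) (hinj : ∀ f ∈ F, component (xWeight i) 0 f = 0 → f = 0)
    (hD : ∀ f ∈ F, D (component (xWeight i) 0 f) = 0) {g : Laurent k m} (hg : g ∈ polyRing k m)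
    (hgi : component (xWeight i) 0 g = g)
    (h : IsAlgebraic (Algebra.adjoin F {g}) (xL k i)) : D g = 0 := by
  have hle : ∀ f ∈ Algebra.adjoin F {g}, f ∈ polyRing k m := by
    intro f hf
    induction hf using Algebra.adjoin_induction with
    | mem f hf => rw [hf]; exact hg
    | algebraMap a => exact hF a.2
    | add f f' _ _ h1 h2 => exact add_mem h1 h2
    | mul f f' _ _ h1 h2 => exact mul_mem h1 h2
  have hx0 : xL k i ≠ 0 := xMon_ne_zero k _
  obtain ⟨P, hP0, hP⟩ := h
  obtain ⟨Q, hQ, hndvd⟩ := exists_eq_pow_rootMultiplicity_mul_and_not_dvd P hP0 0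
  rw [C_0, sub_zero] at hQ hndvd
  rw [X_dvd_iff] at hndvd
  have hQ0 : aeval (xL k i) Q = 0 := by
    rw [hQ, map_mul, map_pow, aeval_X] at hP
    exact (mul_eq_zero.mp hP).resolve_left (pow_ne_zero _ hx0)
  rw [← divX_mul_X_add Q, map_add, map_mul, aeval_X, aeval_C] at hQ0
  obtain ⟨a, ha⟩ : ∃ a : F[X], aeval g a = (Q.coeff 0 : Laurent k m) := by
    have h1 := (Q.coeff 0).2
    have h2 : (Q.coeff 0 : Laurent k m) ∈ (aeval (R := F) g).range :=
      (Algebra.adjoin_singleton_eq_range_aeval F g).le h1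
    exact h2
  have ha0 : a ≠ 0 := by
    rintro rfl
    rw [map_zero] at ha
    exact hndvd (Subtype.ext ha.symm)
  have hx : xL k i ∈ polyRing k m := Algebra.subset_adjoin (Or.inl ⟨i, rfl⟩)
  have hdiv : aeval (xL k i) Q.divX ∈ polyRing k m := by
    rw [aeval_eq_sum_range]
    exact sum_mem fun l _ => mul_mem (hle _ (Q.divX.coeff l).2) (pow_mem hx _)
  -- The constant term of the equation is divisible by `x_i`, so its reduction vanishes.
  have hag : aeval g a ∈ polyRing k m := by rw [ha]; exact hle _ (Q.coeff 0).2
  have hred : remainderHom k i ⟨aeval g a, hag⟩ = 0 := by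
    have h1 : (⟨aeval g a, hag⟩ : polyRing k m) = -(⟨_, hdiv⟩ * ⟨_, hx⟩) := by
      refine Subtype.ext ?_
      change aeval g a = -(aeval (xL k i) Q.divX * xL k i)
      rw [ha]
      exact eq_neg_of_add_eq_zero_right hQ0
    have h2 : remainderHom k i ⟨_, hx⟩ = 0 := by
      rw [remainderHom_apply]
      refine component_single_of_ne (ne_of_eq_of_ne (b := -1) ?_ (by norm_num)) 1
      simp [xWeight]
    rw [h1, map_neg, map_mul, h2, mul_zero, neg_zero]
  let τ : F →+* derivationKernel D :=
    ((remainderHom k i).comp (Subalgebra.inclusion hF)).toRingHom.codRestrict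
      (derivationKernel D) fun f => hD f f.2
  have hτ : Function.Injective τ := by
    rw [injective_iff_map_eq_zero]
    intro f hf
    exact Subtype.ext (hinj f f.2 (congrArg Subtype.val hf))
  have hev : aeval g (a.map τ) = remainderHom k i ⟨aeval g a, hag⟩ := by
    have h1 : (⟨aeval g a, hag⟩ : polyRing k m) =
        eval₂ (Subalgebra.inclusion hF).toRingHom ⟨g, hg⟩ a := by
      refine Subtype.ext ?_
      change aeval g a = (polyRing k m).val.toRingHom (eval₂ _ _ a)
      rw [hom_eval₂]
      rfl
    have h2 : remainderHom k i ⟨g, hg⟩ = g := hgi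
    rw [h1, aeval_def, eval₂_map]
    change _ = (remainderHom k i).toRingHom _
    rw [hom_eval₂]
    change _ = eval₂ _ (remainderHom k i ⟨g, hg⟩) a
    rw [h2]
    rfl
  refine apply_eq_zero_of_isAlgebraic D (derivationKernel D) (fun f hf => hf)
    ⟨a.map τ, (Polynomial.map_ne_zero_iff hτ).mpr ha0, hev.trans hred⟩

/-- Every locally nilpotent derivation annihilates `x_i`. Otherwise reduction modulo `x_i` is
injective on its constants, and its leading part for `xWeight i` annihilates the `x_j` with `j ≠ i`
as well as `z` and `t`, then also `x_i` by the equation of the coordinate ring, and is zero. -/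
theorem apply_coord_x_eq_zero [CharZero k] (hq : 2 ≤ q) (hr : 2 ≤ r)
    (hqr : Nat.Coprime q r) (hn : ∀ i, 1 < n i) {d : Derivation k (R q r m n p) (R q r m n p)}
    (hd : IsLocallyNilpotentDerivation d) (i : Fin (m + 1)) :
    d (coord q r m n p (.x i)) = 0 := by
  by_contra hdx
  have hd0 : d ≠ 0 := by
    rintro rfl
    exact hdx rfl
  obtain ⟨c, hc⟩ := exists_logDer q r n p d
  have hnil := range_toLaurent_le_nilpotentPart hd hc
  have hstable := logDer_mem_range_toLaurent hc
  have hpoly : polyRing k m ≤ (toLaurent q r n p).range := polyRing_le_range_toLaurent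
  have hx : ∀ j, xL k j ∈ polyRing k m := fun j => Algebra.subset_adjoin (Or.inl ⟨j, rfl⟩)
  have hz : zL k m ∈ polyRing k m := Algebra.subset_adjoin (Or.inr (Or.inl rfl))
  have ht : tL k m ∈ polyRing k m := Algebra.subset_adjoin (Or.inr (Or.inr rfl))
  have hDx : logDer c (xL k i) ≠ 0 := by
    intro h0
    have h1 := hc (coord q r m n p (.x i))
    rw [toLaurent_coord] at h1
    refine hdx (toLaurent_injective q r n p (by omega) ?_)
    rw [← h1, map_zero]
    exact h0
  obtain ⟨δ, hδ, hlead⟩ := exists_leading_degree (xWeight i) (logDer_ne_zero hd0 (by omega) hc)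
  set D' := derComponent (xWeight i) δ c with hD'
  let F : Subalgebra k (Laurent k m) := (toLaurent q r n p).range ⊓ derivationKernel (logDer c)
  have hF : ∀ f, f ∈ F ↔ f ∈ (toLaurent q r n p).range ∧ logDer c f = 0 := fun f => Iff.rfl
  have hFpoly : F ≤ polyRing k m := by
    rintro _ ⟨⟨s, rfl⟩, hs⟩
    refine toLaurent_mem_polyRing (mem_xztSubalgebra_of_apply_eq_zero hq hr hqr hn hd hd0 ?_)
    refine toLaurent_injective q r n p (by omega) ?_
    rw [← hc, map_zero]
    exact hs
  -- A constant divisible by `x_i` vanishes, since `x_i` is not a constant.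
  have hinj : ∀ f ∈ F, component (xWeight i) 0 f = 0 → f = 0 := by
    intro f hf h0
    by_contra hf0
    obtain ⟨-, -, f', hf', heq⟩ := exists_eq_component_add i (hFpoly hf)
    rw [h0, zero_add] at heq
    have h1 : logDer c (xL k i * f') = 0 := by rw [← heq]; exact hf.2
    exact hDx (apply_eq_zero_of_mul (logDer c) (hnil (hpoly (hx i))) (hnil (hpoly hf'))
      (by rw [← heq]; exact hf0) h1).1
  have hDF : ∀ f ∈ F, D' (component (xWeight i) 0 f) = 0 := by
    intro f hf
    have h1 := component_logDer hδ (exists_eq_component_add i (hFpoly hf)).1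
    have h2 : logDer c f = 0 := hf.2
    rw [← h1, h2, map_zero]
  have hkey : ∀ g ∈ xL k '' {i' | i' ≠ i} ∪ {zL k m, tL k m}, D' g = 0 := by
    intro g hg
    have hgp : g ∈ polyRing k m := polyRingWithout_le i (Algebra.subset_adjoin hg)
    have hgi := (hasLeading_of_mem_polyRingWithout hg).2
    by_cases hDg : logDer c g = 0
    · rw [← hgi]
      exact hDF g ⟨hpoly hgp, hDg⟩
    · exact apply_eq_zero_of_isAlgebraic_adjoin i D' hFpoly hinj hDF hgp hgi
        (isAlgebraic_adjoin_of_apply_ne_zero (logDer c) hstable hnil hF (hpoly (hx i))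
          (hpoly hgp) hDg)
  have hnilx : ∀ j, xL k j ∈ nilpotentPart D' := by
    intro j
    have h := hasLeading_single (k := k) (ω := xWeight i)
      (rfl : xWeight i ((Pi.single j 1, 0, 0) : Exponent m) = _) 1
    have h2 : component (xWeight i) _ (xL k j) = xL k j := h.2
    rw [← h2]
    exact component_mem_nilpotentPart hδ h.1 (hnil (hpoly (hx j)))
  -- The product of a power product of the `x_j` with the leading part of `y` does not involve
  -- `x_i`, hence is a constant.
  have hDi : D' (xL k i) = 0 := by
    have hE : zL k m ^ q + tL k m ^ r + pL p ∈ polyRing k m :=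
      add_mem (add_mem (pow_mem hz _) (pow_mem ht _)) (pL_mem_polyRing p)
    obtain ⟨hE1, hE2, -⟩ := exists_eq_component_add i hE
    set W := component (xWeight i) 0 (zL k m ^ q + tL k m ^ r + pL p) with hW
    have hW0 : W ≠ 0 := component_equation_ne_zero (by omega) i p
    have hDW : D' W = 0 := by
      have hle : polyRingWithout k i ≤ derivationKernel D' := by
        rw [polyRingWithout, Algebra.adjoin_le_iff]
        exact hkey
      exact hle hE2
    have hy : HasLeading (xWeight i) _ (yL q r n p) (-(xMon k (fun j => -(n j : ℤ)) * W)) :=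
      ((hasLeading_single rfl 1).mul ⟨hE1, rfl⟩).neg
    have hyn : -(xMon k (fun j => -(n j : ℤ)) * W) ∈ nilpotentPart D' := by
      rw [← hy.2]
      exact component_mem_nilpotentPart hδ hy.1 (hnil ⟨_, toLaurent_coord q r n p .y⟩)
    have hmul : xMon k (fun j => (n j : ℤ)) * -(xMon k (fun j => -(n j : ℤ)) * W) = -W := by
      rw [mul_neg, ← mul_assoc, xMon_mul]
      have : (fun j => (n j : ℤ)) + (fun j => -(n j : ℤ)) = 0 := by ext j; simp
      rw [this, xMon_zero, one_mul]
    have hxn : xMon k (fun j => (n j : ℤ)) ∈ nilpotentPart D' := by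
      rw [← prod_xL_pow]
      exact prod_mem fun j _ => pow_mem (hnilx j) _
    refine apply_xL_eq_zero_of_apply_xMon hnilx (a := n) ?_ (by have := hn i; omega)
    refine (apply_eq_zero_of_mul D' hxn hyn ?_ ?_).1
    · rw [hmul]; exact neg_ne_zero.mpr hW0
    · rw [hmul, map_neg, hDW, neg_zero]
  obtain ⟨j, hj⟩ | h2 | h2 := hlead
  · refine hj ?_
    have h1 : D' (xL k j) = 0 := by
      by_cases h : j = i
      · rw [h, hDi]
      · exact hkey _ (Or.inl ⟨j, h, rfl⟩)
    have h3 := (derComponent_single _ _ _ _ _).symm.trans h1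
    exact (mul_eq_zero.mp h3).resolve_left (xMon_ne_zero k _)
  · have h1 := hkey _ (Or.inr (Or.inl rfl))
    have h3 := (derComponent_single _ _ _ _ _).symm.trans h1
    exact h2 ((mul_eq_zero.mp h3).resolve_left (ztMon_ne_zero k 1 0))
  · have h1 := hkey _ (Or.inr (Or.inr rfl))
    have h3 := (derComponent_single _ _ _ _ _).symm.trans h1
    exact h2 ((mul_eq_zero.mp h3).resolve_left (ztMon_ne_zero k 0 1))

end Kernel

/-! ### Explicit locally nilpotent derivations of the coordinate ring -/

section Shear

variable {k : Type*} [Field k] {m : ℕ} (q r : ℕ) (n : Fin (m + 1) → ℕ) (p : Polynomial k)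

/-- The values on the variables of `α * (x ^ n * ∂_z - q * z ^ (q - 1) * ∂_y)
+ β * (x ^ n * ∂_t - r * t ^ (r - 1) * ∂_y)`. -/
noncomputable def shearValue (α β : k) : Var m → MvPolynomial (Var m) k
  | .x _ => 0
  | .y => -(α • ((q : MvPolynomial (Var m) k) * MvPolynomial.X .z ^ (q - 1)) +
      β • ((r : MvPolynomial (Var m) k) * MvPolynomial.X .t ^ (r - 1)))
  | .z => α • ∏ i, MvPolynomial.X (.x i) ^ n i
  | .t => β • ∏ i, MvPolynomial.X (.x i) ^ n i

theorem mkDerivation_shearValue_of_mem (α β : k) {f : MvPolynomial (Var m) k}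
    (hf : f ∈ Algebra.adjoin k (Set.range fun i : Fin (m + 1) =>
      (MvPolynomial.X (.x i) : MvPolynomial (Var m) k))) :
    MvPolynomial.mkDerivation k (shearValue q r n α β) f = 0 := by
  have hle : Algebra.adjoin k (Set.range fun i : Fin (m + 1) =>
      (MvPolynomial.X (.x i) : MvPolynomial (Var m) k)) ≤
      derivationKernel (MvPolynomial.mkDerivation k (shearValue q r n α β)) := by
    rw [Algebra.adjoin_le_iff]
    rintro _ ⟨i, rfl⟩
    exact MvPolynomial.mkDerivation_X _ _ _
  exact hle hf

theorem mkDerivation_shearValue_equation (α β : k) :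
    MvPolynomial.mkDerivation k (shearValue q r n α β) (equation q r m n p) = 0 := by
  have hX : ∀ i, (MvPolynomial.X (.x i) : MvPolynomial (Var m) k) ∈
      Algebra.adjoin k (Set.range fun i : Fin (m + 1) =>
        (MvPolynomial.X (.x i) : MvPolynomial (Var m) k)) := fun i =>
    Algebra.subset_adjoin ⟨i, rfl⟩
  have h1 := mkDerivation_shearValue_of_mem q r n α β
    (prod_mem fun i (_ : i ∈ Finset.univ) => pow_mem (hX i) (n i))
  have h2 : MvPolynomial.mkDerivation k (shearValue q r n α β) (MvPolynomial.X (Var.x 0) *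
      Polynomial.aeval (∏ i, (MvPolynomial.X (Var.x i) : MvPolynomial (Var m) k)) p) = 0 := by
    refine mkDerivation_shearValue_of_mem q r n α β (mul_mem (hX 0) ?_)
    rw [aeval_eq_sum_range]
    exact sum_mem fun l _ => Subalgebra.smul_mem _ (pow_mem (prod_mem fun i _ => hX i) _) _
  rw [equation, map_add, map_add, map_add, h2, Derivation.leibniz, h1, Derivation.leibniz_pow,
    Derivation.leibniz_pow]
  simp only [MvPolynomial.mkDerivation_X, shearValue, MvPolynomial.smul_eq_C_mul, smul_eq_mul,
    nsmul_eq_mul]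
  ring

theorem mk_mkDerivation_shearValue_eq_zero (α β : k) (f : MvPolynomial (Var m) k)
    (hf : Ideal.Quotient.mkₐ k (Ideal.span {equation q r m n p}) f = 0) :
    Ideal.Quotient.mkₐ k (Ideal.span {equation q r m n p})
      (MvPolynomial.mkDerivation k (shearValue q r n α β) f) = 0 := by
  obtain ⟨b, rfl⟩ := Ideal.mem_span_singleton.mp (Ideal.Quotient.eq_zero_iff_mem.mp hf)
  rw [Derivation.leibniz, mkDerivation_shearValue_equation, smul_zero, add_zero]
  exact Ideal.Quotient.eq_zero_iff_mem.mpr (Ideal.mul_mem_right _ _ (Ideal.subset_span rfl))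

/-- The derivation `α * (x ^ n * ∂_z - q * z ^ (q - 1) * ∂_y)
+ β * (x ^ n * ∂_t - r * t ^ (r - 1) * ∂_y)` of the coordinate ring. -/
noncomputable def shear (α β : k) : Derivation k (R q r m n p) (R q r m n p) :=
  Derivation.liftOfSurjective (Ideal.Quotient.mkₐ_surjective k (Ideal.span {equation q r m n p}))
    (mk_mkDerivation_shearValue_eq_zero q r n p α β)

theorem shear_coord (α β : k) (v : Var m) : shear q r n p α β (coord q r m n p v) =
    Ideal.Quotient.mkₐ k (Ideal.span {equation q r m n p}) (shearValue q r n α β v) := by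
  have h := Derivation.liftOfSurjective_apply
    (Ideal.Quotient.mkₐ_surjective k (Ideal.span {equation q r m n p}))
    (mk_mkDerivation_shearValue_eq_zero q r n p α β) (MvPolynomial.X v)
  rwa [MvPolynomial.mkDerivation_X] at h

theorem shear_coord_x (α β : k) (i : Fin (m + 1)) :
    shear q r n p α β (coord q r m n p (.x i)) = 0 := by
  rw [shear_coord, shearValue, map_zero]

theorem shear_coord_z (α β : k) : shear q r n p α β (coord q r m n p .z) =
    α • ∏ i, coord q r m n p (.x i) ^ n i := by
  rw [shear_coord, shearValue, map_smul, map_prod]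
  simp only [map_pow]
  rfl

theorem shear_coord_t (α β : k) : shear q r n p α β (coord q r m n p .t) =
    β • ∏ i, coord q r m n p (.x i) ^ n i := by
  rw [shear_coord, shearValue, map_smul, map_prod]
  simp only [map_pow]
  rfl

theorem shear_coord_y (α β : k) : shear q r n p α β (coord q r m n p .y) =
    -(α • ((q : R q r m n p) * coord q r m n p .z ^ (q - 1)) +
      β • ((r : R q r m n p) * coord q r m n p .t ^ (r - 1))) := by
  rw [shear_coord, shearValue, map_neg, map_add, map_smul, map_smul, map_mul, map_mul, map_pow,
    map_pow, map_natCast, map_natCast]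
  rfl

theorem toLaurent_prod_coord : toLaurent q r n p (∏ i, coord q r m n p (.x i) ^ n i) =
    xMon k fun i => (n i : ℤ) := by
  rw [map_prod, ← prod_xL_pow]
  exact Finset.prod_congr rfl fun i _ => by rw [map_pow, toLaurent_coord, varL]

theorem isLocallyNilpotentDerivation_shear (α β : k) :
    IsLocallyNilpotentDerivation (shear q r n p α β) := by
  set D := shear q r n p α β with hD
  have hx : ∀ i, coord q r m n p (.x i) ∈ nilpotentPart D := fun i =>
    mem_nilpotentPart_of_apply_eq_zero (shear_coord_x q r n p α β i)
  have hP : ∀ a : k, a • ∏ i, coord q r m n p (.x i) ^ n i ∈ nilpotentPart D := fun a =>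
    Subalgebra.smul_mem _ (prod_mem fun i _ => pow_mem (hx i) _) a
  have hz : coord q r m n p .z ∈ nilpotentPart D := mem_nilpotentPart_of_apply
    ((shear_coord_z q r n p α β).symm ▸ hP α)
  have ht : coord q r m n p .t ∈ nilpotentPart D := mem_nilpotentPart_of_apply
    ((shear_coord_t q r n p α β).symm ▸ hP β)
  have hy : coord q r m n p .y ∈ nilpotentPart D := by
    refine mem_nilpotentPart_of_apply ?_
    rw [hD, shear_coord_y]
    exact neg_mem (add_mem (Subalgebra.smul_mem _ (mul_mem (natCast_mem _ q) (pow_mem hz _)) α)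
      (Subalgebra.smul_mem _ (mul_mem (natCast_mem _ r) (pow_mem ht _)) β))
  intro s
  obtain ⟨e, -, rfl⟩ := exists_normalForm q r n p s
  change _ ∈ nilpotentPart D
  refine sum_mem fun ν _ => Subalgebra.smul_mem _ ?_ _
  rw [monR]
  exact mul_mem (mul_mem (prod_mem fun i _ => pow_mem (hx i) _) (pow_mem hy _))
    (mul_mem (pow_mem hz _) (pow_mem ht _))

end Shear

/-! ### The two invariants -/

section Invariants

/-- A derivation that multiplies each monomial by a multiple `φ g` of a fixed nonzero element
kills only sums of monomials with `φ g = 0`. -/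
theorem eq_zero_of_logDer_eq_zero {k G : Type*} [Field k] [CharZero k] [AddCommGroup G]
    [IsDomain (AddMonoidAlgebra k G)] {c : G →+ AddMonoidAlgebra k G} {φ : G →+ ℤ}
    {u : AddMonoidAlgebra k G} (hu : u ≠ 0) (hc : ∀ g, c g = φ g • u) {f : AddMonoidAlgebra k G}
    (hf : logDer c f = 0) {g : G} (hg : f.coeff g ≠ 0) : φ g = 0 := by
  let ε : G →+ AddMonoidAlgebra k G :=
    { toFun := fun g => (φ g) • (1 : AddMonoidAlgebra k G)
      map_zero' := by simp
      map_add' := fun g g' => by rw [map_add, add_smul] }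
  have h1 : ∀ f, logDer c f = u * logDer ε f := by
    intro f
    induction f using AddMonoidAlgebra.induction_linear with
    | zero => simp
    | add f f' h1 h2 => rw [map_add, map_add, h1, h2, mul_add]
    | single g a =>
      rw [logDer_single, logDer_single, hc]
      change _ = u * (_ * (φ g • 1))
      rw [mul_smul_comm, mul_smul_comm, mul_smul_comm, mul_one, mul_comm]
  have h2 : ∀ f, (logDer ε f).coeff g = φ g * f.coeff g := by
    intro f
    induction f using AddMonoidAlgebra.induction_linear with
    | zero => simp
    | add f f' h1 h2 =>
      rw [map_add, AddMonoidAlgebra.coeff_add, AddMonoidAlgebra.coeff_add, Finsupp.add_apply,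
        Finsupp.add_apply, h1, h2, mul_add]
    | single g' a =>
      rw [logDer_single]
      change (_ * (φ g' • 1) : AddMonoidAlgebra k G).coeff g = _
      rw [mul_smul_comm, mul_one, AddMonoidAlgebra.coeff_smul, AddMonoidAlgebra.coeff_single,
        Finsupp.smul_apply, zsmul_eq_mul]
      by_cases h : g = g'
      · rw [h]
      · rw [Finsupp.single_eq_of_ne h, mul_zero, mul_zero]
  have h3 : logDer ε f = 0 := (mul_eq_zero.mp ((h1 f).symm.trans hf)).resolve_left hu
  have h4 := h2 f
  rw [h3, AddMonoidAlgebra.coeff_zero, Finsupp.zero_apply] at h4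
  exact_mod_cast (mul_eq_zero.mp h4.symm).resolve_right hg

variable {k : Type*} [Field k] {m : ℕ} {q r : ℕ} {n : Fin (m + 1) → ℕ} {p : Polynomial k}

/-- Minus the total degree in `z` and `t`. -/
def ztWeight (m : ℕ) : Exponent m →+ ℤ where
  toFun g := -(g.2.1 + g.2.2)
  map_zero' := by simp
  map_add' g g' := by simp; ring

theorem component_ztWeight_mem {f : Laurent k m} (hf : f ∈ polyRing k m) :
    f ∈ lowPart k (ztWeight m) 0 ∧
      component (ztWeight m) 0 f ∈ Algebra.adjoin k (Set.range (xL k (m := m))) := by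
  induction hf using Algebra.adjoin_induction with
  | mem f hv =>
    rcases hv with ⟨i, rfl⟩ | hv
    · have h : HasLeading (ztWeight m) 0 (xL k i) (xL k i) :=
        hasLeading_single (by simp [ztWeight]) 1
      exact ⟨h.1, by rw [h.2]; exact Algebra.subset_adjoin ⟨i, rfl⟩⟩
    · have h : HasLeading (ztWeight m) 0 f 0 := by
        rcases hv with rfl | rfl
        · exact hasLeading_of_lt (single_mem_lowPart (γ := -1) (by simp [ztWeight]) 1) (by norm_num)
        · exact hasLeading_of_lt (single_mem_lowPart (γ := -1) (by simp [ztWeight]) 1) (by norm_num)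
      exact ⟨h.1, by rw [h.2]; exact zero_mem _⟩
  | algebraMap a =>
    have h : HasLeading (ztWeight m) 0 (algebraMap k (Laurent k m) a)
        (algebraMap k (Laurent k m) a) := hasLeading_single (map_zero _) a
    exact ⟨h.1, by rw [h.2]; exact Subalgebra.algebraMap_mem _ a⟩
  | add f g _ _ h1 h2 => exact ⟨add_mem h1.1 h2.1, by rw [map_add]; exact add_mem h1.2 h2.2⟩
  | mul f g _ _ h1 h2 =>
    have h3 := component_mul h1.1 h2.1
    rw [add_zero] at h3
    exact ⟨by simpa using mul_mem_lowPart h1.1 h2.1, by rw [h3]; exact mul_mem h1.2 h2.2⟩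

theorem shear_ne_zero {α β : k} (h : α ≠ 0 ∨ β ≠ 0) : shear q r n p α β ≠ 0 := by
  intro h0
  have hP : ∏ i, coord q r m n p (.x i) ^ n i ≠ 0 := by
    intro h1
    have h2 := toLaurent_prod_coord q r n p
    rw [h1, map_zero] at h2
    exact xMon_ne_zero k _ h2.symm
  have hz := shear_coord_z q r n p α β
  have ht := shear_coord_t q r n p α β
  rw [h0, Derivation.zero_apply] at hz ht
  rcases h with h | h
  · exact (smul_ne_zero h hP) hz.symm
  · exact (smul_ne_zero h hP) ht.symm

/-- The extension of a shear to Laurent polynomials. -/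
theorem exists_logDer_shear (α β : k) : ∃ c : Exponent m →+ Laurent k m,
    (∀ s, logDer c (toLaurent q r n p s) = toLaurent q r n p (shear q r n p α β s)) ∧
    ∀ g : Exponent m, c g = g.2.1 • (α • (ztMon k (-1) 0 * xMon k fun i => (n i : ℤ))) +
      g.2.2 • (β • (ztMon k 0 (-1) * xMon k fun i => (n i : ℤ))) := by
  obtain ⟨c, hc⟩ := exists_logDer q r n p (shear q r n p α β)
  have hx : ∀ i, c (Pi.single i 1, 0, 0) = 0 := by
    intro i
    have h := hc (coord q r m n p (.x i))
    rw [shear_coord_x, map_zero, toLaurent_coord] at h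
    exact (mul_eq_zero.mp ((logDer_single c _ _).symm.trans h)).resolve_left (xMon_ne_zero k _)
  have hz : c (0, 1, 0) = α • (ztMon k (-1) 0 * xMon k fun i => (n i : ℤ)) := by
    have h := hc (coord q r m n p .z)
    rw [shear_coord_z, map_smul, toLaurent_prod_coord, toLaurent_coord] at h
    have h1 : ztMon k 1 0 * c (0, 1, 0) = α • xMon k fun i => (n i : ℤ) :=
      (logDer_single c _ _).symm.trans h
    rw [← mul_smul_comm, ← h1, ← mul_assoc, ztMon_mul]
    exact (one_mul _).symm
  have ht : c (0, 0, 1) = β • (ztMon k 0 (-1) * xMon k fun i => (n i : ℤ)) := by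
    have h := hc (coord q r m n p .t)
    rw [shear_coord_t, map_smul, toLaurent_prod_coord, toLaurent_coord] at h
    have h1 : ztMon k 0 1 * c (0, 0, 1) = β • xMon k fun i => (n i : ℤ) :=
      (logDer_single c _ _).symm.trans h
    rw [← mul_smul_comm, ← h1, ← mul_assoc, ztMon_mul]
    exact (one_mul _).symm
  refine ⟨c, hc, fun g => ?_⟩
  conv_lhs => rw [exponent_eq_sum g]
  rw [map_add, map_add, map_sum]
  simp only [map_zsmul, hx, hz, ht, smul_zero, Finset.sum_const_zero, zero_add]

/-- An element without `y` that is killed by both coordinate shears is a polynomial in the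
`x_i`. -/
theorem mem_adjoin_coord_x_of_shear_eq_zero [CharZero k] (hq : q ≠ 0) {s : R q r m n p}
    (hs : s ∈ xztSubalgebra q r n p) (hz : shear q r n p 1 0 s = 0)
    (ht : shear q r n p 0 1 s = 0) :
    s ∈ Algebra.adjoin k (Set.range fun i : Fin (m + 1) => coord q r m n p (.x i)) := by
  set f := toLaurent q r n p s with hf
  have hzf : ∀ g, f.coeff g ≠ 0 → g.2.1 = 0 := by
    obtain ⟨c, hc, hcg⟩ := exists_logDer_shear (q := q) (r := r) (n := n) (p := p) (1 : k) 0
    intro g hg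
    refine eq_zero_of_logDer_eq_zero (φ := zWeight m)
      (mul_ne_zero (ztMon_ne_zero k (-1) 0) (xMon_ne_zero k fun i => (n i : ℤ))) (c := c)
      (fun g => ?_) (by rw [hf, hc, hz, map_zero]) hg
    rw [hcg, zero_smul, smul_zero, add_zero, one_smul]
    rfl
  have htf : ∀ g, f.coeff g ≠ 0 → g.2.2 = 0 := by
    obtain ⟨c, hc, hcg⟩ := exists_logDer_shear (q := q) (r := r) (n := n) (p := p) (0 : k) 1
    let φ : Exponent m →+ ℤ := (AddMonoidHom.snd ℤ ℤ).comp (AddMonoidHom.snd _ _)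
    intro g hg
    refine eq_zero_of_logDer_eq_zero (φ := φ)
      (mul_ne_zero (ztMon_ne_zero k 0 (-1)) (xMon_ne_zero k fun i => (n i : ℤ))) (c := c)
      (fun g => ?_) (by rw [hf, hc, ht, map_zero]) hg
    rw [hcg, zero_smul, smul_zero, zero_add, one_smul]
    rfl
  have hfc : component (ztWeight m) 0 f = f := by
    apply AddMonoidAlgebra.coeff_injective
    ext g
    rw [coeff_component, Finsupp.filter_apply]
    split_ifs with h
    · rfl
    · by_contra hg
      refine h ?_
      change -(g.2.1 + g.2.2) = 0
      rw [hzf g (Ne.symm hg), htf g (Ne.symm hg), add_zero, neg_zero]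
  have hmem := (component_ztWeight_mem (toLaurent_mem_polyRing hs)).2
  rw [← hf, hfc] at hmem
  have hrange : Set.range (xL k (m := m)) = toLaurent q r n p ''
      (Set.range fun i : Fin (m + 1) => coord q r m n p (.x i)) := by
    rw [← Set.range_comp]
    exact congrArg Set.range (funext fun i => (toLaurent_coord q r n p (.x i)).symm)
  rw [hrange, ← AlgHom.map_adjoin] at hmem
  obtain ⟨s', hs', h⟩ := hmem
  rwa [← toLaurent_injective q r n p hq h]

theorem makarLimanovInvariant_eq [CharZero k] (hq : 2 ≤ q) (hr : 2 ≤ r)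
    (hqr : Nat.Coprime q r) (hn : ∀ i, 1 < n i) :
    makarLimanovInvariant k (R q r m n p) =
      Algebra.adjoin k (Set.range fun i : Fin (m + 1) => coord q r m n p (.x i)) := by
  refine le_antisymm (fun s hs => ?_) (le_iInf₂ fun d hd => ?_)
  · have h : ∀ α β, shear q r n p α β s = 0 := fun α β =>
      iInf₂_le (f := fun d (_ : IsLocallyNilpotentDerivation d) => derivationKernel d)
        (shear q r n p α β) (isLocallyNilpotentDerivation_shear q r n p α β) hs
    exact mem_adjoin_coord_x_of_shear_eq_zero (by omega)
      (mem_xztSubalgebra_of_apply_eq_zero hq hr hqr hn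
        (isLocallyNilpotentDerivation_shear q r n p 1 0) (shear_ne_zero (Or.inl one_ne_zero))
        (h 1 0)) (h 1 0) (h 0 1)
  · rw [Algebra.adjoin_le_iff]
    rintro _ ⟨i, rfl⟩
    exact apply_coord_x_eq_zero hq hr hqr hn hd i

theorem derksenInvariant_eq [CharZero k] (hq : 2 ≤ q) (hr : 2 ≤ r)
    (hqr : Nat.Coprime q r) (hn : ∀ i, 1 < n i) :
    derksenInvariant k (R q r m n p) = xztSubalgebra q r n p := by
  refine le_antisymm (iSup₂_le fun d hd s hs =>
    mem_xztSubalgebra_of_apply_eq_zero hq hr hqr hn hd.1 hd.2 hs) ?_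
  have hle : ∀ {α β : k}, (α ≠ 0 ∨ β ≠ 0) →
      derivationKernel (shear q r n p α β) ≤ derksenInvariant k (R q r m n p) :=
    fun {α β} h => le_iSup₂ (f := fun d (_ : IsLocallyNilpotentDerivation d ∧ d ≠ 0) =>
      derivationKernel d) (shear q r n p α β)
      ⟨isLocallyNilpotentDerivation_shear q r n p α β, shear_ne_zero h⟩
  have h0 : ∀ (α β : k) (s : R q r m n p), shear q r n p α β s = 0 →
      s ∈ derivationKernel (shear q r n p α β) := fun _ _ _ h => h
  rw [xztSubalgebra, Algebra.adjoin_le_iff]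
  rintro _ (⟨i, rfl⟩ | rfl | rfl)
  · exact hle (Or.inl one_ne_zero) (h0 1 0 _ (shear_coord_x q r n p 1 0 i))
  · refine hle (Or.inr one_ne_zero) (h0 0 1 _ ?_)
    rw [shear_coord_z, zero_smul]
  · refine hle (Or.inl one_ne_zero) (h0 1 0 _ ?_)
    rw [shear_coord_t, zero_smul]

end Invariants

/-! ### The coordinate ring is not a polynomial ring -/

section PolynomialRing

theorem isLocallyNilpotentDerivation_pderiv {k σ : Type*} [Field k] (v : σ) :
    IsLocallyNilpotentDerivation (MvPolynomial.pderiv (R := k) v) := by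
  classical
  intro f
  change f ∈ nilpotentPart (MvPolynomial.pderiv (R := k) v)
  induction f using MvPolynomial.induction_on with
  | C a => exact (nilpotentPart _).algebraMap_mem a
  | add f g hf hg => exact add_mem hf hg
  | mul_X f w hf =>
    refine mul_mem hf (mem_nilpotentPart_of_apply (mem_nilpotentPart_of_apply_eq_zero ?_))
    rw [MvPolynomial.pderiv_X, Pi.single_apply]
    split_ifs
    · exact Derivation.map_one_eq_zero _
    · exact map_zero _

theorem eq_C_of_pderiv_eq_zero {k σ : Type*} [Field k] [CharZero k] {f : MvPolynomial σ k}
    (h : ∀ v, MvPolynomial.pderiv v f = 0) : f = MvPolynomial.C (f.coeff 0) := by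
  classical
  ext g
  rw [MvPolynomial.coeff_C]
  split_ifs with hg
  · rw [hg]
  · obtain ⟨v, hv⟩ : ∃ v, g v ≠ 0 := by
      by_contra! h0
      exact hg (Finsupp.ext h0).symm
    have h1 := MvPolynomial.coeff_pderiv (i := v) f (g - Finsupp.single v 1)
    have h2 : Finsupp.single v 1 ≤ g :=
      Finsupp.single_le_iff.mpr (Nat.one_le_iff_ne_zero.mpr hv)
    rw [h v, MvPolynomial.coeff_zero, tsub_add_cancel_of_le h2] at h1
    exact (mul_eq_zero.mp h1.symm).resolve_right (Nat.cast_add_one_ne_zero _)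

/-- The transport of a derivation along an isomorphism of algebras. -/
def transport {k A B : Type*} [CommRing k] [CommRing A] [CommRing B] [Algebra k A] [Algebra k B]
    (e : A ≃ₐ[k] B) (D : Derivation k B B) : Derivation k A A :=
  Derivation.mk' (e.symm.toLinearMap ∘ₗ D.toLinearMap ∘ₗ e.toLinearMap) fun a b => by
    change e.symm (D (e (a * b))) = a * e.symm (D (e b)) + b * e.symm (D (e a))
    rw [map_mul, D.leibniz, map_add, smul_eq_mul, smul_eq_mul, map_mul, map_mul,
      e.symm_apply_apply, e.symm_apply_apply]

theorem transport_apply {k A B : Type*} [CommRing k] [CommRing A] [CommRing B] [Algebra k A]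
    [Algebra k B] (e : A ≃ₐ[k] B) (D : Derivation k B B) (a : A) :
    transport e D a = e.symm (D (e a)) := rfl

theorem isLocallyNilpotentDerivation_transport {k A B : Type*} [CommRing k] [CommRing A]
    [CommRing B] [Algebra k A] [Algebra k B] (e : A ≃ₐ[k] B) {D : Derivation k B B}
    (hD : IsLocallyNilpotentDerivation D) : IsLocallyNilpotentDerivation (transport e D) := by
  have h : ∀ (N : ℕ) (a : A), (transport e D)^[N] a = e.symm (D^[N] (e a)) := by
    intro N
    induction N with
    | zero => exact fun a => (e.symm_apply_apply a).symm
    | succ N ih =>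
      intro a
      rw [Function.iterate_succ_apply, ih, transport_apply, e.apply_symm_apply,
        Function.iterate_succ_apply]
  intro a
  obtain ⟨N, hN⟩ := hD (e a)
  exact ⟨N, by rw [h, hN, map_zero]⟩

variable {k : Type*} [Field k] {m : ℕ} {q r : ℕ} {n : Fin (m + 1) → ℕ} {p : Polynomial k}

theorem coord_x_ne_algebraMap (i : Fin (m + 1)) (a : k) :
    coord q r m n p (.x i) ≠ algebraMap k _ a := by
  intro h
  have h1 := congrArg (toLaurent q r n p) h
  rw [toLaurent_coord, AlgHom.commutes] at h1
  have h2 := congrArg (component (xWeight i) 0) h1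
  have h3 : component (xWeight i) 0 (xL k i) = 0 := by
    refine component_single_of_ne (ne_of_eq_of_ne (b := -1) ?_ (by norm_num)) 1
    simp [xWeight]
  have h4 : component (xWeight i) 0 (algebraMap k (Laurent k m) a) = algebraMap k _ a :=
    component_single_of_eq (map_zero _) a
  have h5 : xL k i = 0 := by
    rw [h4] at h2
    exact h1.trans (h2.symm.trans h3)
  exact xMon_ne_zero k _ h5

/-- The partial derivatives of a polynomial ring are locally nilpotent and have no common constants
besides the scalars, whereas `x_0` is a common constant of all locally nilpotent derivations of the
coordinate ring. -/
theorem isEmpty_algEquiv_mvPolynomial [CharZero k] (hq : 2 ≤ q) (hr : 2 ≤ r)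
    (hqr : Nat.Coprime q r) (hn : ∀ i, 1 < n i) (σ : Type*) :
    IsEmpty (R q r m n p ≃ₐ[k] MvPolynomial σ k) := by
  refine ⟨fun e => ?_⟩
  have h := eq_C_of_pderiv_eq_zero (f := e (coord q r m n p (.x 0))) fun v => by
    have h1 := apply_coord_x_eq_zero hq hr hqr hn
      (isLocallyNilpotentDerivation_transport e (isLocallyNilpotentDerivation_pderiv v)) 0
    rw [transport_apply] at h1
    exact (map_eq_zero_iff e.symm e.symm.injective).mp h1
  refine coord_x_ne_algebraMap (q := q) (r := r) (n := n) (p := p) 0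
    (MvPolynomial.coeff 0 (e (coord q r m n p (.x 0)))) (e.injective ?_)
  rw [AlgEquiv.commutes]
  exact h

end PolynomialRing

section Scheme

open CategoryTheory AlgebraicGeometry

/-- An isomorphism of the spectrum of an algebra with an affine space over `Spec k` comes from an
isomorphism of algebras. -/
theorem nonempty_algEquiv_of_iso {k : Type u} [Field k] {A : Type u} [CommRing A] [Algebra k A]
    {d : ℕ} (i : Over.mk (Spec.map (CommRingCat.ofHom (algebraMap k A))) ≅ affineSpace k d) :
    Nonempty (A ≃ₐ[k] MvPolynomial (ULift.{u} (Fin d)) k) := by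
  let j : Spec (CommRingCat.of A) ≅
      Spec (CommRingCat.of (MvPolynomial (ULift.{u} (Fin d)) (CommRingCat.of k))) :=
    (Over.forget _).mapIso i ≪≫ AffineSpace.SpecIso _ (CommRingCat.of k)
  have hj : j.inv ≫ Spec.map (CommRingCat.ofHom (algebraMap k A)) =
      Spec.map (CommRingCat.ofHom MvPolynomial.C) := by
    have h1 : i.inv.left ≫ Spec.map (CommRingCat.ofHom (algebraMap k A)) =
        AffineSpace (ULift.{u} (Fin d)) (Spec (CommRingCat.of k)) ↘ Spec (CommRingCat.of k) :=
      Over.w i.inv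
    refine (Category.assoc (AffineSpace.SpecIso _ (CommRingCat.of k)).inv i.inv.left _).trans ?_
    exact (congrArg (fun f => (AffineSpace.SpecIso _ (CommRingCat.of k)).inv ≫ f) h1).trans
      (AffineSpace.SpecIso_inv_over _)
  let φ := Spec.preimage j.inv
  let ψ := Spec.preimage j.hom
  have h1 : φ ≫ ψ = 𝟙 _ := Spec.map_injective (by
    rw [Spec.map_comp, Spec.map_preimage, Spec.map_preimage, j.hom_inv_id, Spec.map_id])
  have h2 : ψ ≫ φ = 𝟙 _ := Spec.map_injective (by
    rw [Spec.map_comp, Spec.map_preimage, Spec.map_preimage, j.inv_hom_id, Spec.map_id])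
  have h3 : CommRingCat.ofHom (algebraMap k A) ≫ φ = CommRingCat.ofHom MvPolynomial.C :=
    Spec.map_injective (by rw [Spec.map_comp, Spec.map_preimage, hj])
  refine ⟨AlgEquiv.ofRingEquiv (f := RingEquiv.ofRingHom φ.hom ψ.hom ?_ ?_) fun a => ?_⟩
  · exact congrArg CommRingCat.Hom.hom h2
  · exact congrArg CommRingCat.Hom.hom h1
  · exact congrArg (fun f => f.hom a) h3

end Scheme

end KorasRussell

theorem mainTheorem3 {k : Type*} [Field k] [CharZero k]
    (q r : ℕ) (hq : 2 ≤ q) (hr : 2 ≤ r) (hqr : Nat.Coprime q r)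
    (m : ℕ) (n : Fin (m + 1) → ℕ) (hn : ∀ i, 1 < n i)
    (p : Polynomial k) (hp : p.eval 0 ≠ 0) :
    makarLimanovInvariant k (KorasRussell.R q r m n p) =
        Algebra.adjoin k (Set.range fun i : Fin (m + 1) =>
          KorasRussell.coord q r m n p (KorasRussell.Var.x i)) ∧
      derksenInvariant k (KorasRussell.R q r m n p) =
        Algebra.adjoin k
          ((Set.range fun i : Fin (m + 1) =>
              KorasRussell.coord q r m n p (KorasRussell.Var.x i)) ∪
            {KorasRussell.coord q r m n p KorasRussell.Var.z,
              KorasRussell.coord q r m n p KorasRussell.Var.t}) ∧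
      (∀ σ : Type*, IsEmpty (KorasRussell.R q r m n p ≃ₐ[k] MvPolynomial σ k)) ∧
      IsEmpty (KorasRussell.X q r m n p ≅ KorasRussell.affineSpace k (m + 3)) := by
  refine ⟨KorasRussell.makarLimanovInvariant_eq hq hr hqr hn,
    KorasRussell.derksenInvariant_eq hq hr hqr hn,
    fun σ => KorasRussell.isEmpty_algEquiv_mvPolynomial hq hr hqr hn σ, ⟨fun i => ?_⟩⟩
  obtain ⟨e⟩ := KorasRussell.nonempty_algEquiv_of_iso i
  exact (KorasRussell.isEmpty_algEquiv_mvPolynomial hq hr hqr hn _).false e
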